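/- Let $\mathbb T=\mathbb R/\mathbb Z$, and let $|x|=\sqrt{|x_0|}+|x_1|$ for $x=(x_0,x_1)\in\mathbb R\times\mathbb T$, where $|x_1|$ is the distance of $x_1$ to $0$ in $\mathbb T$. Let $\mathcal Q:\mathbb R\to\mathbb R$ be an even polynomial of degree $2n\ge 4$ with $\mathcal Q(0)=0$, $\mathcal Q(r)>0$ for $r\neq 0$, and quadratic coefficient $1$. For $\varepsilon\in(0,1]$ let $\mathcal L_\varepsilon=-\varepsilon^{-2}\mathcal Q(i\varepsilon\partial_{1})$, i.e. $\widehat{\mathcal L_\varepsilon f}(k)=-\varepsilon^{-2}\mathcal Q(-2\pi\varepsilon k)\widehat f(k)$ for $k\in\mathbb Z$, and let $\mathcal L_0=\partial_{1}^2$. Write $-q_\varepsilon(k)$ for the Fourier multiplier of $\mathcal L_\varepsilon$, and for $\varepsilon\in[0,1]$ let $$P_\varepsilon(x_0,x_1)=\mathbf 1_{x_0>0}\sum_{k\in\mathbb Z}e^{-q_\varepsilon(k)x_0}e^{2\pi i k x_1}.$$ Then for every $\varepsilon\in[0,1]$, $P_\varepsilon$ is the Green's function of $\partial_0-\mathcal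 L_\varepsilon$ on $\mathbb R\times\mathbb T$ (it is locally integrable, vanishes for $x_0<0$ and satisfies $(\partial_0-\mathcal L_\varepsilon)P_\varepsilon=\delta_0$ in the sense of distributions), it is smooth on $(\mathbb R\times\mathbb T)\setminus\{0\}$, and there are functions $K_\varepsilon,R_\varepsilon:\mathbb R\times\mathbb T\to\mathbb R$, both vanishing for $x_0<0$ and both even in $x_1$, with $$P_\varepsilon=K_\varepsilon+R_\varepsilon,$$ such that $K_\varepsilon$ is supported in $[0,1]\times\mathbb T$ and smooth away from $0$, and $R_\varepsilon$ is smooth uniformly in $\varepsilon$: each $R_\varepsilon$ is smooth and $\sup_{\varepsilon\in[0,1]}\sup_{x}|\partial_0^m\partial_1^\ell R_\varepsilon(x)|<\infty$ for all $m,\ell\in\mathbb N$. Moreover the following bounds hold, where $f'=\partial_1 f$, and where the constants $C$ may depend on $\mathcal Q$ and on the parameters $\ell,c,\delta$ but not on $\varepsilon\in[0,1]$ or on the points $x,y\in\mathbb R\times\mathbb T$. 1. For every $\ell\ge 1$ and all $x\ne 0$, $|\partial_1^\ell P_\varepsilon(x)|\le C|x|^{-\ell-1}$; for $\ell=0$,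 $|P_\varepsilon(x)|\le C(1+|x|^{-1})$ for all $x\neq0$. 2. For every $\ell\ge 0$ and $c>0$, and all $x\neq 0$ with $|x|\ge c\,\varepsilon$, $|\partial_0\partial_1^\ell P_\varepsilon(x)|\le C|x|^{-\ell-3}$. 3. For every $\delta\in(0,1)$ and all $x\neq0$, $|P_\varepsilon'(x)-P_0'(x)|\le C\varepsilon^\delta|x|^{-2-\delta}$. 4. For every $\delta\in[0,1]$ and all $x,y$ with $y\ne0$ and $x\neq y$, $$|P_\varepsilon'(x-y)-P_\varepsilon'(-y)|\le C\begin{cases}|y|^{-2}, & |x|\ge 2|y|,\\ |x-y|^{-2}, & |x-y|\le |y|/2,\\ \mathbf 1_{|y|<\varepsilon}|y|^{-2}+\mathbf 1_{|y|\ge\varepsilon}|x|^\delta|y|^{-2-\delta}, & \text{otherwise.}\end{cases}$$ All these bounds also hold with $K_\varepsilon$ (and $K_0$) in place of $P_\varepsilon$ (and $P_0$), and for $K_\varepsilon$ the bound in 1 with $\ell=0$ holds in the form $|K_\varepsilon(x)|\le C|x|^{-1}$. -/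

import Mathlib

open scoped ContDiff

noncomputable section

/-- Space-time `ℝ × 𝕋`, where `𝕋 = ℝ / ℤ`. -/
abbrev SpaceTime : Type := ℝ × UnitAddCircle

/-- The parabolic size `|(x₀, x₁)| = √|x₀| + |x₁|`, where `|x₁|` is the distance of `x₁` to `0`
on the circle. -/
def parSize (x : SpaceTime) : ℝ := √|x.1| + ‖x.2‖

/-- The lift of a function on `ℝ × 𝕋` to a function on `ℝ × ℝ`, periodic in the second variable. -/
def spaceLift (f : SpaceTime → ℝ) : ℝ × ℝ → ℝ := fun p => f (p.1, (p.2 : UnitAddCircle))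

/-- `f` is smooth on `ℝ × 𝕋`. -/
def IsSmooth (f : SpaceTime → ℝ) : Prop := ContDiff ℝ ∞ (spaceLift f)

/-- `f` is smooth on `(ℝ × 𝕋) \ {0}`. -/
def IsSmoothOffOrigin (f : SpaceTime → ℝ) : Prop :=
  ContDiffOn ℝ ∞ (spaceLift f) {p | ((p.1, (p.2 : UnitAddCircle)) : SpaceTime) ≠ 0}

/-- The time derivative `∂₀`. -/
def timeDeriv (f : SpaceTime → ℝ) : SpaceTime → ℝ :=
  fun x => deriv (fun s : ℝ => f (s, x.2)) x.1

/-- The spatial derivative `∂₁`. -/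
def spaceDeriv (f : SpaceTime → ℝ) : SpaceTime → ℝ :=
  fun x => deriv (fun s : ℝ => f (x.1, x.2 + (s : UnitAddCircle))) 0

/-- The mixed derivative `∂₀ᵐ ∂₁ˡ f`. -/
def mixedDeriv (m l : ℕ) (f : SpaceTime → ℝ) : SpaceTime → ℝ :=
  timeDeriv^[m] (spaceDeriv^[l] f)

/-- `Q` is an even polynomial of degree at least `4`, positive except for `Q(0) = 0`, whose
quadratic coefficient is `1`. (The degree of an even polynomial is automatically even.) -/
structure IsAdmissible (Q : Polynomial ℝ) : Prop where
  even : ∀ r : ℝ, Q.eval (-r) = Q.eval r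
  eval_zero : Q.eval 0 = 0
  pos : ∀ r : ℝ, r ≠ 0 → 0 < Q.eval r
  four_le_natDegree : 4 ≤ Q.natDegree
  coeff_two : Q.coeff 2 = 1

/-- The operator `L_ε = -ε⁻² Q(i ε ∂₁)` for `ε ≠ 0`, and `L_0 = ∂₁²`. Only even powers of `∂₁`
occur for even `Q`, so that taking real parts of the coefficients changes nothing. -/
def opL (Q : Polynomial ℝ) (ε : ℝ) (f : SpaceTime → ℝ) : SpaceTime → ℝ :=
  fun x =>
    if ε = 0 then mixedDeriv 0 2 f x
    else -(ε ^ 2)⁻¹ * ∑ j ∈ Finset.range (Q.natDegree + 1),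
      Q.coeff j * ((Complex.I * (ε : ℂ)) ^ j).re * mixedDeriv 0 j f x

/-- `-symbolL Q ε k` is the Fourier multiplier of `L_ε`: it equals `-ε⁻² Q(-2π ε k)` for `ε ≠ 0`
and `-(2π k)²` for `ε = 0`. -/
def symbolL (Q : Polynomial ℝ) (ε : ℝ) (k : ℤ) : ℝ :=
  if ε = 0 then (2 * Real.pi * k) ^ 2 else (ε ^ 2)⁻¹ * Q.eval (-(2 * Real.pi * ε * k))

/-- The Green's function `P_ε` of `∂₀ - L_ε` on `ℝ × 𝕋`, that is, the kernel of the semigroup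
`exp (t L_ε)` for `t > 0`, extended by `0` to `t ≤ 0`. -/
def greenP (Q : Polynomial ℝ) (ε : ℝ) : SpaceTime → ℝ :=
  fun x =>
    if 0 < x.1 then
      (∑' k : ℤ, (Real.exp (-(symbolL Q ε k * x.1)) : ℂ) * fourier k x.2).re
    else 0

/-- `G` vanishes at negative times. -/
def IsNonAnticipative (G : SpaceTime → ℝ) : Prop := ∀ x : SpaceTime, x.1 < 0 → G x = 0

/-- `G` is symmetric in the spatial variable. -/
def IsSpaceSymmetric (G : SpaceTime → ℝ) : Prop :=
  ∀ (t : ℝ) (y : UnitAddCircle), G (t, -y) = G (t, y)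

/-- `G` is a retarded fundamental solution of `∂₀ - L`: it vanishes at negative times and
`(∂₀ - L) G = δ₀` in the sense of distributions on `ℝ × 𝕋`. Here `L` is a formally self-adjoint
differential operator in the spatial variable. -/
structure IsGreenFunction (L : (SpaceTime → ℝ) → SpaceTime → ℝ) (G : SpaceTime → ℝ) : Prop where
  nonAnticipative : IsNonAnticipative G
  locallyIntegrable : MeasureTheory.LocallyIntegrable G
  weak_eq : ∀ φ : SpaceTime → ℝ, IsSmooth φ → HasCompactSupport φ →
    ∫ x, G x * (-(timeDeriv φ x) - L φ x) = φ 0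

/-- `|∂₀ᵐ ∂₁ˡ G_ε(x)| ≤ C |x|^{-2m-l-1}` for all `ε ∈ [0,1]` and all `x ≠ 0` with `|x| ≥ c ε`. -/
def DerivBound (G : ℝ → SpaceTime → ℝ) (m l : ℕ) (c : ℝ) : Prop :=
  ∃ C : ℝ, ∀ ε ∈ Set.Icc (0 : ℝ) 1, ∀ x : SpaceTime, x ≠ 0 → c * ε ≤ parSize x →
    |mixedDeriv m l (G ε) x| ≤ C * (parSize x ^ (2 * m + l + 1))⁻¹

/-- `|G_ε'(x) - G_0'(x)| ≤ C ε^δ |x|^{-2-δ}` for all `ε ∈ [0,1]` and all `x ≠ 0`. -/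
def ComparisonBound (G : ℝ → SpaceTime → ℝ) (δ : ℝ) : Prop :=
  ∃ C : ℝ, ∀ ε ∈ Set.Icc (0 : ℝ) 1, ∀ x : SpaceTime, x ≠ 0 →
    |mixedDeriv 0 1 (G ε) x - mixedDeriv 0 1 (G 0) x| ≤ C * (ε ^ δ * parSize x ^ (-2 - δ))

/-- The right-hand side of the increment bound. -/
def incrementRHS (δ ε : ℝ) (x y : SpaceTime) : ℝ :=
  if 2 * parSize y ≤ parSize x then (parSize y ^ 2)⁻¹
  else if parSize (x - y) ≤ parSize y / 2 then (parSize (x - y) ^ 2)⁻¹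
  else if parSize y < ε then (parSize y ^ 2)⁻¹
  else parSize x ^ δ * parSize y ^ (-2 - δ)

/-- The increment bound on `|G_ε'(x - y) - G_ε'(-y)|`, uniformly in `ε ∈ [0,1]` and in all
`x, y` with `y ≠ 0` and `x ≠ y`. -/
def IncrementBound (G : ℝ → SpaceTime → ℝ) (δ : ℝ) : Prop :=
  ∃ C : ℝ, ∀ ε ∈ Set.Icc (0 : ℝ) 1, ∀ x y : SpaceTime, y ≠ 0 → x ≠ y →
    |mixedDeriv 0 1 (G ε) (x - y) - mixedDeriv 0 1 (G ε) (-y)| ≤ C * incrementRHS δ ε x y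

end

noncomputable section

/-!
For `t > 0` every derivative of `P_ε` is a series `∑ p(k) e^{-q(k) t} e^{2πikx}`, where `q` is the
symbol of `L_ε` and `p` is a polynomial, so all bounds are bounds on such series, uniform over the
polynomials `q` with `q(k) ≥ k² / M` all of whose monomials are at most `M q`.

Decay in `x` comes from summation by parts: multiplying the series by `(e^{-2πix} - 1)ᴺ` replaces
the coefficients by their `N`-th differences. As soon as `N` exceeds the degree of `p`, these
no longer see `p` itself, hence carry a factor `t q(k)`, and the remaining sum over `k` is a
telescoping sum in disguise. Decay in `t` comes from `q(k) ≥ k² / M`. The series also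
tends to `0` with all its derivatives as `t → 0` away from `x = 0`, which makes the extension by
zero smooth off the origin. The comparison with `P_0` interpolates between the crude bound for each
kernel and the bound of order `ε²` on the difference of the two series, and the cutoff
`K_ε = (1 - χ(t)) P_ε`, `R_ε = χ(t) P_ε` splits off the smooth part. Finally, the equation
`(∂₀ - L_ε) P_ε = δ₀` is checked one Fourier mode at a time.
-/

open Polynomial MeasureTheory Filter
open scoped Topology

/-! ### Polynomials with absolute values of coefficients -/

/-- The polynomial whose coefficients are the absolute values of those of `p`. -/
def absPoly (p : ℝ[X]) : ℝ[X] := ∑ i ∈ p.support, monomial i |p.coeff i|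

/-- The value at `r` of the polynomial with the absolute values of the coefficients of `p`; for
`r ≥ 0` it dominates every monomial of `p`. -/
def absEval (p : ℝ[X]) (r : ℝ) : ℝ := (absPoly p).eval r

lemma coeff_absPoly (p : ℝ[X]) (i : ℕ) : (absPoly p).coeff i = |p.coeff i| := by
  simp only [absPoly, finsetSum_coeff, coeff_monomial]
  rw [Finset.sum_ite_eq' p.support i, ite_eq_left_iff]
  intro h
  rw [notMem_support_iff.1 h, abs_zero]

lemma eval_le_eval_of_coeff_le {p q : ℝ[X]} (h : ∀ i, p.coeff i ≤ q.coeff i) {r : ℝ}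
    (hr : 0 ≤ r) : p.eval r ≤ q.eval r := by
  have hp : p.natDegree < max p.natDegree q.natDegree + 1 := by omega
  have hq : q.natDegree < max p.natDegree q.natDegree + 1 := by omega
  rw [eval_eq_sum_range' hp, eval_eq_sum_range' hq]
  exact Finset.sum_le_sum fun i _ => mul_le_mul_of_nonneg_right (h i) (pow_nonneg hr i)

lemma absEval_eq_sum {p : ℝ[X]} {n : ℕ} (hn : p.natDegree < n) (r : ℝ) :
    absEval p r = ∑ i ∈ Finset.range n, |p.coeff i| * r ^ i := by
  have h : (absPoly p).natDegree < n := by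
    refine lt_of_le_of_lt (natDegree_le_iff_coeff_eq_zero.2 fun i hi => ?_) hn
    rw [coeff_absPoly, coeff_eq_zero_of_natDegree_lt hi, abs_zero]
  rw [absEval, eval_eq_sum_range' h]
  simp only [coeff_absPoly]

lemma absEval_nonneg (p : ℝ[X]) {r : ℝ} (hr : 0 ≤ r) : 0 ≤ absEval p r := by
  rw [absEval_eq_sum (Nat.lt_succ_self _)]
  positivity

lemma abs_eval_le_absEval (p : ℝ[X]) (x : ℝ) : |p.eval x| ≤ absEval p |x| := by
  rw [absEval_eq_sum (Nat.lt_succ_self _), eval_eq_sum_range]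
  refine (Finset.abs_sum_le_sum_abs _ _).trans (le_of_eq ?_)
  simp only [abs_mul, abs_pow]

lemma absEval_add_le (p q : ℝ[X]) {r : ℝ} (hr : 0 ≤ r) :
    absEval (p + q) r ≤ absEval p r + absEval q r := by
  rw [absEval, absEval, absEval, ← eval_add]
  refine eval_le_eval_of_coeff_le (fun i => ?_) hr
  simp only [coeff_absPoly, coeff_add]
  exact abs_add_le _ _

lemma absEval_neg (p : ℝ[X]) (r : ℝ) : absEval (-p) r = absEval p r := by
  simp only [absEval, absPoly, support_neg, coeff_neg, abs_neg]

lemma absEval_mul_le (p q : ℝ[X]) {r : ℝ} (hr : 0 ≤ r) :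
    absEval (p * q) r ≤ absEval p r * absEval q r := by
  rw [absEval, absEval, absEval, ← eval_mul]
  refine eval_le_eval_of_coeff_le (fun i => ?_) hr
  simp only [coeff_absPoly, coeff_mul]
  refine (Finset.abs_sum_le_sum_abs _ _).trans (le_of_eq ?_)
  simp only [abs_mul]

lemma absEval_C_mul (a : ℝ) (p : ℝ[X]) (r : ℝ) : absEval (C a * p) r = |a| * absEval p r := by
  rw [absEval, absEval, ← eval_C_mul]
  congr 1
  ext i
  simp only [coeff_absPoly, coeff_C_mul, abs_mul]

lemma absEval_C (a r : ℝ) : absEval (C a) r = |a| := by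
  rw [absEval_eq_sum (n := 1) (by simp)]
  simp

lemma natDegree_X_mul_derivative_le (p : ℝ[X]) : (X * derivative p).natDegree ≤ p.natDegree := by
  refine natDegree_le_iff_coeff_eq_zero.2 fun i hi => ?_
  cases i with
  | zero => rw [coeff_X_mul_zero]
  | succ i => rw [coeff_X_mul, coeff_derivative, coeff_eq_zero_of_natDegree_lt hi, zero_mul]

lemma absEval_X_mul_derivative_le {p : ℝ[X]} {d : ℕ} (hd : p.natDegree ≤ d) {r : ℝ}
    (hr : 0 ≤ r) : absEval (X * derivative p) r ≤ d * absEval p r := by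
  rw [absEval, absEval, ← eval_C_mul]
  refine eval_le_eval_of_coeff_le (fun i => ?_) hr
  rw [coeff_absPoly, coeff_C_mul, coeff_absPoly]
  cases i with
  | zero => rw [coeff_X_mul_zero, abs_zero]; positivity
  | succ i =>
    rw [coeff_X_mul, coeff_derivative, abs_mul, mul_comm]
    by_cases h : i + 1 ≤ d
    · gcongr
      rw [abs_of_nonneg (by positivity)]
      exact_mod_cast h
    · rw [coeff_eq_zero_of_natDegree_lt (by omega), abs_zero, mul_zero, mul_zero]

lemma absEval_le_of_le_two_mul {p : ℝ[X]} {d : ℕ} (hd : p.natDegree ≤ d) {r s : ℝ} (hr : 0 ≤ r)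
    (hrs : r ≤ 2 * s) : absEval p r ≤ 2 ^ d * absEval p s := by
  rw [absEval_eq_sum (Nat.lt_succ_of_le hd), absEval_eq_sum (Nat.lt_succ_of_le hd),
    Finset.mul_sum]
  refine Finset.sum_le_sum fun i hi => ?_
  have hs : 0 ≤ s := by linarith
  have hid : i ≤ d := Nat.lt_succ_iff.1 (Finset.mem_range.1 hi)
  calc |p.coeff i| * r ^ i ≤ |p.coeff i| * (2 * s) ^ i := by gcongr
    _ = 2 ^ i * (|p.coeff i| * s ^ i) := by ring
    _ ≤ 2 ^ d * (|p.coeff i| * s ^ i) := by gcongr; norm_num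

/-! ### Derivatives of `ξ ^ L * exp (-U ξ)` -/

/-- The polynomial `E` for which the `N`-th derivative of `ξ ^ L * exp (-U ξ)` is
`ξ ^ (L - N) * (L (L - 1) ⋯ (L - N + 1) + E ξ) * exp (-U ξ)`. -/
def expCofactor (L : ℕ) (U : ℝ[X]) : ℕ → ℝ[X]
  | 0 => 0
  | N + 1 => C ((L : ℝ) - N) * expCofactor L U N + X * derivative (expCofactor L U N) +
      -(X * derivative U * (C (L.descFactorial N : ℝ) + expCofactor L U N))

lemma natDegree_expCofactor_le (L : ℕ) {U : ℝ[X]} {d : ℕ} (hd : U.natDegree ≤ d) (N : ℕ) :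
    (expCofactor L U N).natDegree ≤ N * d := by
  induction N with
  | zero => rw [expCofactor, natDegree_zero]; exact Nat.zero_le _
  | succ N ih =>
    have hNd : N * d ≤ (N + 1) * d := Nat.mul_le_mul_right _ (Nat.le_succ N)
    refine natDegree_add_le_of_degree_le (natDegree_add_le_of_degree_le ?_ ?_) ?_
    · exact (natDegree_C_mul_le _ _).trans (ih.trans hNd)
    · exact (natDegree_X_mul_derivative_le _).trans (ih.trans hNd)
    · have hsum : (C (L.descFactorial N : ℝ) + expCofactor L U N).natDegree ≤ N * d :=
        natDegree_add_le_of_degree_le (by rw [natDegree_C]; exact Nat.zero_le _) ih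
      calc _ ≤ d + N * d := (natDegree_neg _).trans_le <| natDegree_mul_le.trans <|
            add_le_add ((natDegree_X_mul_derivative_le U).trans hd) hsum
        _ = _ := by ring

lemma absEval_expCofactor_succ_le (L N : ℕ) {U : ℝ[X]} {d : ℕ} (hd : U.natDegree ≤ d) {r : ℝ}
    (hr : 0 ≤ r) :
    absEval (expCofactor L U (N + 1)) r ≤
      (|(L : ℝ) - N| + (N * d : ℕ)) * absEval (expCofactor L U N) r +
        d * absEval U r * (L.descFactorial N + absEval (expCofactor L U N) r) := by
  set E := expCofactor L U N with hE
  have hderiv : absEval (X * derivative E) r ≤ (N * d : ℕ) * absEval E r :=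
    absEval_X_mul_derivative_le (natDegree_expCofactor_le L hd N) hr
  have hsum : absEval (C (L.descFactorial N : ℝ) + E) r ≤ L.descFactorial N + absEval E r :=
    (absEval_add_le _ _ hr).trans_eq (by rw [absEval_C, Nat.abs_cast])
  have hprod : absEval (-(X * derivative U * (C (L.descFactorial N : ℝ) + E))) r ≤
      d * absEval U r * (L.descFactorial N + absEval E r) := by
    rw [absEval_neg]
    exact (absEval_mul_le _ _ hr).trans <|
      mul_le_mul (absEval_X_mul_derivative_le hd hr) hsum (absEval_nonneg _ hr)
        (mul_nonneg d.cast_nonneg (absEval_nonneg _ hr))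
  calc absEval (expCofactor L U (N + 1)) r
      ≤ |(L : ℝ) - N| * absEval E r + absEval (X * derivative E) r +
          absEval (-(X * derivative U * (C (L.descFactorial N : ℝ) + E))) r := by
        rw [expCofactor, ← hE, ← absEval_C_mul]
        exact (absEval_add_le _ _ hr).trans (add_le_add_left (absEval_add_le _ _ hr) _)
    _ ≤ |(L : ℝ) - N| * absEval E r + (N * d : ℕ) * absEval E r +
          d * absEval U r * (L.descFactorial N + absEval E r) := by gcongr
    _ = _ := by ring

lemma exists_absEval_expCofactor_le (L d N : ℕ) : ∃ A : ℝ, 0 ≤ A ∧ ∀ U : ℝ[X], U.natDegree ≤ d →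
    ∀ r : ℝ, 0 ≤ r →
      absEval (expCofactor L U N) r ≤ A * (absEval U r * (1 + absEval U r) ^ N) := by
  induction N with
  | zero => exact ⟨0, le_rfl, fun U _ r _ => by simp [expCofactor, absEval, absPoly]⟩
  | succ N ih =>
    obtain ⟨A, hA, h⟩ := ih
    refine ⟨(|(L : ℝ) - N| + (N * d : ℕ)) * A + d * (L.descFactorial N + A), by positivity,
      fun U hU r hr => ?_⟩
    have hV : 0 ≤ absEval U r := absEval_nonneg U hr
    have ih := h U hU r hr
    refine (absEval_expCofactor_succ_le L N hU hr).trans ?_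
    set V := absEval U r
    have hpow : (1 + V) ^ N ≤ (1 + V) ^ (N + 1) :=
      pow_le_pow_right₀ (by linarith) (Nat.le_succ N)
    have hone : 1 ≤ (1 + V) ^ (N + 1) := one_le_pow₀ (by linarith)
    have hV_pow : V * (1 + V) ^ N ≤ (1 + V) ^ (N + 1) := by
      rw [pow_succ']; gcongr; linarith
    calc _ ≤ (|(L : ℝ) - N| + (N * d : ℕ)) * (A * (V * (1 + V) ^ (N + 1))) +
          d * V * (L.descFactorial N * (1 + V) ^ (N + 1) + A * (1 + V) ^ (N + 1)) := by
          gcongr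
          · exact ih.trans (by gcongr)
          · exact le_mul_of_one_le_right (Nat.cast_nonneg _) hone
          · exact ih.trans (by gcongr)
      _ = _ := by ring

/-- The `N`-th derivative of `ξ ^ L * exp (-U ξ)` away from `0`. -/
def expDeriv (L : ℕ) (U : ℝ[X]) (N : ℕ) (x : ℝ) : ℝ :=
  x ^ ((L : ℤ) - N) * (L.descFactorial N + (expCofactor L U N).eval x) * Real.exp (-U.eval x)

lemma expDeriv_zero (L : ℕ) (U : ℝ[X]) (x : ℝ) :
    expDeriv L U 0 x = x ^ L * Real.exp (-U.eval x) := by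
  simp [expDeriv, expCofactor]

lemma hasDerivAt_expDeriv (L : ℕ) (U : ℝ[X]) (N : ℕ) {x : ℝ} (hx : x ≠ 0) :
    HasDerivAt (expDeriv L U N) (expDeriv L U (N + 1) x) x := by
  have hpow := hasDerivAt_zpow ((L : ℤ) - N) x (Or.inl hx)
  have hcof := ((expCofactor L U N).hasDerivAt x).const_add (L.descFactorial N : ℝ)
  have hexp := (U.hasDerivAt x).neg.exp
  refine ((hpow.mul hcof).mul hexp).congr_deriv ?_
  have hz : x ^ ((L : ℤ) - N) = x ^ ((L : ℤ) - N - 1) * x := by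
    rw [← zpow_add_one₀ hx, sub_add_cancel]
  have hc : (L : ℤ) - ((N + 1 : ℕ) : ℤ) = (L : ℤ) - N - 1 := by push_cast; ring
  have hdesc : (L.descFactorial (N + 1) : ℝ) = L.descFactorial N * ((L : ℝ) - N) := by
    simp only [← descPochhammer_eval_eq_descFactorial, descPochhammer_succ_eval]
  simp only [expDeriv, expCofactor, hc, hdesc, hz, eval_add, eval_mul, eval_neg, eval_C, eval_X,
    Pi.mul_apply, Pi.neg_apply]
  push_cast
  ring

lemma abs_fwdDiff_iter_le (N : ℕ) : ∀ (f : ℕ → ℝ → ℝ) (a B : ℝ),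
    (∀ i < N, ∀ y ∈ Set.Icc a (a + N), HasDerivAt (f i) (f (i + 1) y) y) →
    (∀ y ∈ Set.Icc a (a + N), |f N y| ≤ B) → |(fwdDiff (1 : ℝ))^[N] (f 0) a| ≤ B := by
  induction N with
  | zero => intro f a B _ hB; exact hB a (by simp)
  | succ N ih =>
    intro f a B hf hB
    rw [Function.iterate_succ_apply]
    have hsub : ∀ y ∈ Set.Icc a (a + N), Set.Icc y (y + 1) ⊆ Set.Icc a (a + (N + 1 : ℕ)) := by
      rintro y ⟨hay, hya⟩ z ⟨hyz, hzy⟩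
      push_cast
      exact ⟨by linarith, by linarith⟩
    refine ih (fun i => fwdDiff 1 (f i)) a B (fun i hi y hy => ?_) (fun y hy => ?_)
    · have hleft := hf i (by omega) y (hsub y hy ⟨le_rfl, by linarith⟩)
      have hright := hf i (by omega) (y + 1) (hsub y hy ⟨by linarith, le_rfl⟩)
      exact (hright.comp_add_const y 1).sub hleft
    · have hmvt := (convex_Icc y (y + 1)).norm_image_sub_le_of_norm_hasDerivWithin_le (f := f N)
        (f' := f (N + 1)) (C := B)
        (fun z hz => (hf N (by omega) z (hsub y hy hz)).hasDerivWithinAt)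
        (fun z hz => hB z (hsub y hy hz)) (x := y) (y := y + 1) (by simp) (by simp)
      simpa [fwdDiff] using hmvt

/-! ### Elementary estimates -/

lemma exists_pow_mul_exp_neg_le (n : ℕ) {c : ℝ} (hc : 0 < c) :
    ∃ B : ℝ, 0 ≤ B ∧ ∀ u : ℝ, 0 ≤ u → u ^ n * Real.exp (-(c * u)) ≤ B := by
  refine ⟨n.factorial / c ^ n, by positivity, fun u hu => ?_⟩
  have h := Real.pow_div_factorial_le_exp (c * u) (by positivity) n
  rw [div_le_iff₀ (by positivity), mul_pow] at h
  rw [Real.exp_neg, ← div_eq_mul_inv, div_le_div_iff₀ (Real.exp_pos _) (by positivity)]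
  linarith

lemma exists_pow_mul_exp_neg_sq_le (n : ℕ) {M : ℝ} (hM : 0 < M) :
    ∃ B : ℝ, 0 ≤ B ∧ ∀ u : ℝ, 0 ≤ u → u ^ n * Real.exp (-(u ^ 2 / M)) ≤ B * Real.exp (-u) := by
  obtain ⟨B, hB, h⟩ := exists_pow_mul_exp_neg_le n one_pos
  refine ⟨Real.exp M * B, by positivity, fun u hu => ?_⟩
  have hsq : 2 * u - M ≤ u ^ 2 / M := by
    rw [le_div_iff₀ hM]
    nlinarith [sq_nonneg (u - M)]
  calc u ^ n * Real.exp (-(u ^ 2 / M)) ≤ u ^ n * Real.exp (M + -(1 * u) + -u) := by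
        gcongr
        linarith
    _ = Real.exp M * (u ^ n * Real.exp (-(1 * u))) * Real.exp (-u) := by
        rw [Real.exp_add, Real.exp_add]; ring
    _ ≤ _ := by gcongr; exact h u hu

lemma exists_one_add_pow_mul_exp_neg_le (n : ℕ) {c : ℝ} (hc : 0 < c) :
    ∃ B : ℝ, 0 ≤ B ∧ ∀ u : ℝ, 0 ≤ u → (1 + u) ^ n * Real.exp (-(c * u)) ≤ B := by
  obtain ⟨B, hB, h⟩ := exists_pow_mul_exp_neg_le n hc
  refine ⟨Real.exp c * B, by positivity, fun u hu => ?_⟩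
  calc (1 + u) ^ n * Real.exp (-(c * u))
      = Real.exp c * ((1 + u) ^ n * Real.exp (-(c * (1 + u)))) := by
        rw [mul_left_comm, ← Real.exp_add]; ring_nf
    _ ≤ _ := by gcongr; exact h _ (by positivity)

lemma sum_range_div_mul_exp_le {W : ℕ → ℝ} (hW : ∀ n, 0 ≤ W n)
    (hstep : ∀ n : ℕ, (n + 1) * W n ≤ n * W (n + 1)) {c : ℝ} (hc : 0 < c) (n : ℕ) :
    ∑ i ∈ Finset.range n, W i / i * Real.exp (-(c * W i)) ≤ 1 / c := by
  have hterm : ∀ i : ℕ, W (i + 1) / ((i + 1 : ℕ) : ℝ) * Real.exp (-(c * W (i + 1))) ≤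
      (Real.exp (-(c * W i)) - Real.exp (-(c * W (i + 1)))) / c := fun i => by
    have hle : W (i + 1) / ((i + 1 : ℕ) : ℝ) ≤ W (i + 1) - W i := by
      rw [div_le_iff₀ (by positivity)]
      push_cast
      linarith [hstep i]
    rw [le_div_iff₀ hc, le_sub_iff_add_le]
    calc _ = Real.exp (-(c * W (i + 1))) * (c * (W (i + 1) / ((i + 1 : ℕ) : ℝ)) + 1) := by ring
      _ ≤ Real.exp (-(c * W (i + 1))) * Real.exp (c * (W (i + 1) - W i)) := by
        gcongr
        exact (Real.add_one_le_exp _).trans (Real.exp_le_exp.2 (by gcongr))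
      _ = Real.exp (-(c * W i)) := by rw [← Real.exp_add]; ring_nf
  have hexp : Real.exp (-(c * W 0)) ≤ 1 := Real.exp_le_one_iff.2 (by have := hW 0; nlinarith)
  cases n with
  | zero => rw [Finset.range_zero, Finset.sum_empty]; positivity
  | succ n =>
    calc _ = ∑ i ∈ Finset.range n,
          W (i + 1) / ((i + 1 : ℕ) : ℝ) * Real.exp (-(c * W (i + 1))) := by
          rw [Finset.sum_range_succ', Nat.cast_zero, div_zero, zero_mul, add_zero]
      _ ≤ ∑ i ∈ Finset.range n, (Real.exp (-(c * W i)) - Real.exp (-(c * W (i + 1)))) / c :=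
          Finset.sum_le_sum fun i _ => hterm i
      _ = (Real.exp (-(c * W 0)) - Real.exp (-(c * W n))) / c := by
          rw [← Finset.sum_div, Finset.sum_range_sub']
      _ ≤ 1 / c := by gcongr; linarith [Real.exp_pos (-(c * W n))]

lemma hasSum_comp_natAbs {g : ℕ → ℝ} {a : ℝ} (hg : HasSum g a) :
    HasSum (fun k : ℤ => g k.natAbs) (a + a - g 0) :=
  HasSum.of_nat_of_neg (f := fun k : ℤ => g k.natAbs) (by simpa using hg) (by simpa using hg)

lemma natAbs_cast_eq_abs (k : ℤ) : ((k.natAbs : ℕ) : ℝ) = |(k : ℝ)| := by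
  rw [Nat.cast_natAbs, Int.cast_abs]

lemma summable_abs_pow_mul_exp_neg (L : ℕ) {c : ℝ} (hc : 0 < c) :
    Summable fun k : ℤ => |(k : ℝ)| ^ L * Real.exp (-(c * (k : ℝ) ^ 2)) := by
  refine Summable.of_nonneg_of_le (fun k => by positivity) (fun k => ?_)
    (hasSum_comp_natAbs (Real.summable_pow_mul_exp_neg_nat_mul L hc).hasSum).summable
  have hk : |(k : ℝ)| ≤ (k : ℝ) ^ 2 := by
    rw [← sq_abs, ← natAbs_cast_eq_abs]
    exact_mod_cast Nat.le_self_pow two_ne_zero _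
  rw [natAbs_cast_eq_abs, neg_mul]
  gcongr

lemma norm_tsum_int_le_of_superlinear {E : Type*} [NormedAddCommGroup E]
    {f : ℤ → E} {m : ℕ} {A B c : ℝ} {W : ℕ → ℝ} (hA : 0 ≤ A) (hB : 0 ≤ B) (hc : 0 < c)
    (hW : ∀ n, 0 ≤ W n) (hstep : ∀ n : ℕ, (n + 1) * W n ≤ n * W (n + 1))
    (hlow : ∀ k : ℤ, k.natAbs < m → ‖f k‖ ≤ B)
    (hhigh : ∀ k : ℤ, m ≤ k.natAbs →
      ‖f k‖ ≤ A * (W k.natAbs / k.natAbs * Real.exp (-(c * W k.natAbs)))) :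
    ‖∑' k, f k‖ ≤ 2 * (m * B + A / c) := by
  set tail : ℕ → ℝ := fun n => W n / n * Real.exp (-(c * W n))
  have htail : ∀ n, 0 ≤ tail n := fun n => by have := hW n; positivity
  set g : ℕ → ℝ := fun n => (if n < m then B else 0) + A * tail n
  have hg0 : ∀ n, 0 ≤ g n := fun n =>
    add_nonneg (by split_ifs <;> simp [hB]) (mul_nonneg hA (htail n))
  have hfg : ∀ k, ‖f k‖ ≤ g k.natAbs := fun k => by
    by_cases hk : k.natAbs < m
    · simpa [g, hk] using
        (hlow k hk).trans (le_add_of_nonneg_right (mul_nonneg hA (htail _)))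
    · simpa only [g, hk, if_false, zero_add] using hhigh k (not_lt.1 hk)
  have hsum : ∀ n, ∑ i ∈ Finset.range n, g i ≤ m * B + A / c := fun n => by
    rw [Finset.sum_add_distrib, ← Finset.mul_sum, ← mul_one_div A c]
    gcongr
    · rw [← Finset.sum_filter, Finset.sum_const, nsmul_eq_mul]
      gcongr
      refine (Finset.card_le_card fun i hi => ?_).trans_eq (Finset.card_range m)
      exact Finset.mem_range.2 (Finset.mem_filter.1 hi).2
    · exact sum_range_div_mul_exp_le hW hstep hc n
  have hsummable : HasSum g (∑' n, g n) := (summable_of_sum_range_le hg0 hsum).hasSum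
  calc ‖∑' k, f k‖ ≤ ∑' n, g n + ∑' n, g n - g 0 :=
        tsum_of_norm_bounded (hasSum_comp_natAbs hsummable) hfg
    _ ≤ 2 * (m * B + A / c) := by linarith [hg0 0, Real.tsum_le_of_sum_range_le hg0 hsum]

/-! ### Symbols -/

/-- `q` is a polynomial of degree at most `d` without constant and linear term, with a
nondegenerate quadratic term, all of whose monomials are controlled by `q`. The family
`q_ε`, `ε ∈ [0,1]`, consists of such symbols with `d` and `M` independent of `ε`. -/
structure IsSymbol (d : ℕ) (M : ℝ) (q : ℝ[X]) : Prop where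
  pos : 0 < M
  natDegree_le : q.natDegree ≤ d
  coeff_zero : q.coeff 0 = 0
  coeff_one : q.coeff 1 = 0
  one_le_coeff_two : 1 ≤ q.coeff 2
  absEval_le : ∀ x : ℝ, absEval q |x| ≤ M * q.eval x

namespace IsSymbol

variable {d : ℕ} {M : ℝ} {q : ℝ[X]}

lemma two_le_natDegree (h : IsSymbol d M q) : 2 ≤ q.natDegree :=
  le_natDegree_of_ne_zero (zero_lt_one.trans_le h.one_le_coeff_two).ne'

lemma sq_le_absEval (h : IsSymbol d M q) (x : ℝ) : x ^ 2 ≤ absEval q |x| := by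
  rw [absEval_eq_sum (Nat.lt_succ_self _)]
  calc x ^ 2 ≤ |q.coeff 2| * |x| ^ 2 := by
        rw [sq_abs]
        exact le_mul_of_one_le_left (sq_nonneg x) (h.one_le_coeff_two.trans (le_abs_self _))
    _ ≤ _ := Finset.single_le_sum (f := fun i => |q.coeff i| * |x| ^ i)
        (fun i _ => by positivity)
        (Finset.mem_range.2 (by have := h.two_le_natDegree; omega))

lemma sq_le (h : IsSymbol d M q) (x : ℝ) : x ^ 2 ≤ M * q.eval x :=
  (h.sq_le_absEval x).trans (h.absEval_le x)

lemma eval_nonneg (h : IsSymbol d M q) (x : ℝ) : 0 ≤ q.eval x :=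
  nonneg_of_mul_nonneg_right ((sq_nonneg x).trans (h.sq_le x)) h.pos

lemma eval_zero (h : IsSymbol d M q) : q.eval 0 = 0 := by
  rw [← coeff_zero_eq_eval_zero, h.coeff_zero]

lemma sq_div_le (h : IsSymbol d M q) (x : ℝ) : x ^ 2 / M ≤ q.eval x := by
  rw [div_le_iff₀' h.pos]
  exact h.sq_le x

lemma absEval_superlinear (h : IsSymbol d M q) (n : ℕ) :
    (n + 1) * absEval q n ≤ n * absEval q ((n + 1 : ℕ) : ℝ) := by
  rw [absEval_eq_sum (Nat.lt_succ_self _), absEval_eq_sum (Nat.lt_succ_self _), Finset.mul_sum,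
    Finset.mul_sum]
  refine Finset.sum_le_sum fun i _ => ?_
  cases i with
  | zero => simp [h.coeff_zero]
  | succ i =>
    push_cast
    calc ((n : ℝ) + 1) * (|q.coeff (i + 1)| * (n : ℝ) ^ (i + 1))
        = |q.coeff (i + 1)| * n * (n + 1) * (n : ℝ) ^ i := by ring
      _ ≤ |q.coeff (i + 1)| * n * (n + 1) * ((n : ℝ) + 1) ^ i := by gcongr; linarith
      _ = _ := by ring

end IsSymbol

/-! ### Differences of the coefficients -/

/-- The function `ξ ↦ ξ ^ L * exp (-(q ξ * t))`, whose values at the integers are the Fourier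
coefficients of the `L`-th space derivative of the heat kernel, up to `(2πi) ^ L`. -/
def expCoeff (q : ℝ[X]) (L : ℕ) (t x : ℝ) : ℝ := x ^ L * Real.exp (-(q.eval x * t))

/-- For `L < N` the falling factorial in `expDeriv` vanishes, which gains the factor
`t * absEval q |y|`. -/
lemma exists_abs_expDeriv_le (d : ℕ) {M : ℝ} (hM : 0 < M) {L N : ℕ} (hLN : L < N) :
    ∃ A : ℝ, 0 ≤ A ∧ ∀ q, IsSymbol d M q → ∀ t : ℝ, 0 < t → ∀ y : ℝ,
      |expDeriv L (C t * q) N y| ≤ A * (|y| ^ ((L : ℤ) - N) *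
        (t * absEval q |y| * Real.exp (-(1 / (2 * M) * (t * absEval q |y|))))) := by
  obtain ⟨A, hA, hcof⟩ := exists_absEval_expCofactor_le L d N
  obtain ⟨B, hB, hexp⟩ := exists_one_add_pow_mul_exp_neg_le N (c := 1 / (2 * M)) (by positivity)
  refine ⟨A * B, by positivity, fun q hq t ht y => ?_⟩
  have hcof : |(expCofactor L (C t * q) N).eval y| ≤
      A * (t * absEval q |y| * (1 + t * absEval q |y|) ^ N) := by
    have h := (abs_eval_le_absEval _ y).trans
      (hcof _ ((natDegree_C_mul_le t q).trans hq.natDegree_le) |y| (abs_nonneg y))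
    rwa [absEval_C_mul, abs_of_pos ht] at h
  have hW : 0 ≤ t * absEval q |y| := mul_nonneg ht.le (absEval_nonneg q (abs_nonneg y))
  have hq_le : t * absEval q |y| / M ≤ t * q.eval y := by
    rw [div_le_iff₀' hM, mul_left_comm]
    gcongr
    exact hq.absEval_le y
  set W := t * absEval q |y|
  have hsplit : Real.exp (-(C t * q).eval y) ≤
      Real.exp (-(1 / (2 * M) * W)) * Real.exp (-(1 / (2 * M) * W)) := by
    rw [← Real.exp_add, eval_C_mul, Real.exp_le_exp]
    have hhalf : 1 / (2 * M) * W + 1 / (2 * M) * W = W / M := by field_simp; ring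
    linarith
  rw [expDeriv, Nat.descFactorial_eq_zero_iff_lt.2 hLN, Nat.cast_zero, zero_add, abs_mul, abs_mul,
    abs_zpow, Real.abs_exp]
  calc |y| ^ ((L : ℤ) - N) * |(expCofactor L (C t * q) N).eval y| * Real.exp (-(C t * q).eval y)
      ≤ |y| ^ ((L : ℤ) - N) * (A * (W * (1 + W) ^ N)) *
        (Real.exp (-(1 / (2 * M) * W)) * Real.exp (-(1 / (2 * M) * W))) := by gcongr
    _ = |y| ^ ((L : ℤ) - N) * (A * (W * ((1 + W) ^ N * Real.exp (-(1 / (2 * M) * W))))) *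
        Real.exp (-(1 / (2 * M) * W)) := by ring
    _ ≤ |y| ^ ((L : ℤ) - N) * (A * (W * B)) * Real.exp (-(1 / (2 * M) * W)) := by
        gcongr
        exact hexp W hW
    _ = _ := by ring

lemma zpow_sub_le_of_half_le {a b : ℝ} (ha : 0 < a) (hab : a / 2 ≤ b) {L N : ℕ} (hLN : L ≤ N) :
    b ^ ((L : ℤ) - N) ≤ 2 ^ (N - L) * a ^ ((L : ℤ) - N) := by
  have hb : 0 < b := (half_pos ha).trans_le hab
  have hexp : (L : ℤ) - N = -((N - L : ℕ) : ℤ) := by omega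
  rw [hexp, zpow_neg, zpow_neg, zpow_natCast, zpow_natCast, ← div_eq_mul_inv, inv_eq_one_div,
    div_le_div_iff₀ (by positivity) (by positivity), one_mul, ← mul_pow]
  gcongr
  linarith

lemma expCoeff_eq_expDeriv (q : ℝ[X]) (L : ℕ) (t : ℝ) :
    expCoeff q L t = expDeriv L (C t * q) 0 := by
  ext x
  rw [expDeriv_zero, expCoeff, eval_C_mul, mul_comm (q.eval x)]

lemma half_abs_le_abs_and_abs_le_two_mul_abs {k n y : ℝ} (hk : 2 * n ≤ |k|)
    (hy : y ∈ Set.Icc k (k + n)) : |k| / 2 ≤ |y| ∧ |y| ≤ 2 * |k| := by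
  obtain ⟨hky, hyk⟩ := hy
  have hdist : |y - k| ≤ |k| / 2 := by rw [abs_of_nonneg (by linarith)]; linarith
  have hlow := abs_sub_abs_le_abs_sub k y
  rw [abs_sub_comm] at hlow
  exact ⟨by linarith, by linarith [abs_sub_abs_le_abs_sub y k]⟩

lemma exists_abs_fwdDiff_expCoeff_le (d : ℕ) {M : ℝ} (hM : 0 < M) {L N : ℕ} (hLN : L < N) :
    ∃ A c : ℝ, 0 ≤ A ∧ 0 < c ∧ ∀ q, IsSymbol d M q → ∀ t : ℝ, 0 < t → ∀ k : ℝ, 2 * N ≤ |k| →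
      |(fwdDiff (1 : ℝ))^[N] (expCoeff q L t) k| ≤
        A * (|k| ^ ((L : ℤ) - N) *
          (t * absEval q |k| * Real.exp (-(c * (t * absEval q |k|))))) := by
  obtain ⟨A, hA, hderiv⟩ := exists_abs_expDeriv_le d hM hLN
  refine ⟨A * (2 ^ (N - L) * 2 ^ d), 1 / (2 * M) / 2 ^ d, by positivity, by positivity,
    fun q hq t ht k hk => ?_⟩
  have hN : (1 : ℝ) ≤ N := by exact_mod_cast (show 1 ≤ N by omega)
  have hk0 : 0 < |k| := by linarith
  have hcomparable : ∀ y ∈ Set.Icc k (k + N), |k| / 2 ≤ |y| ∧ |y| ≤ 2 * |k| :=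
    fun y hy => half_abs_le_abs_and_abs_le_two_mul_abs hk hy
  rw [expCoeff_eq_expDeriv]
  refine abs_fwdDiff_iter_le N (fun i => expDeriv L (C t * q) i) k _
    (fun i _ y hy => hasDerivAt_expDeriv L _ i ?_) (fun y hy => ?_)
  · exact abs_pos.1 ((half_pos hk0).trans_le (hcomparable y hy).1)
  obtain ⟨hlow, hhigh⟩ := hcomparable y hy
  have hup : absEval q |y| ≤ 2 ^ d * absEval q |k| :=
    absEval_le_of_le_two_mul hq.natDegree_le (abs_nonneg y) hhigh
  have hdown : absEval q |k| ≤ 2 ^ d * absEval q |y| :=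
    absEval_le_of_le_two_mul hq.natDegree_le (abs_nonneg k) (by linarith)
  have hy0 : 0 ≤ absEval q |y| := absEval_nonneg q (abs_nonneg y)
  have hk0' : 0 ≤ absEval q |k| := absEval_nonneg q (abs_nonneg k)
  have hrate : 1 / (2 * M) / 2 ^ d * (t * absEval q |k|) ≤ 1 / (2 * M) * (t * absEval q |y|) := by
    rw [div_mul_eq_mul_div, div_le_iff₀ (by positivity), mul_assoc, mul_assoc,
      mul_comm (absEval q |y|)]
    gcongr
  calc |expDeriv L (C t * q) N y| ≤ _ := hderiv q hq t ht y
    _ ≤ A * (2 ^ (N - L) * |k| ^ ((L : ℤ) - N) * (t * (2 ^ d * absEval q |k|) *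
        Real.exp (-(1 / (2 * M) / 2 ^ d * (t * absEval q |k|))))) := by
        refine mul_le_mul_of_nonneg_left (mul_le_mul
          (zpow_sub_le_of_half_le hk0 hlow hLN.le) ?_ (by positivity) (by positivity)) hA
        exact mul_le_mul (by gcongr) (Real.exp_le_exp.2 (neg_le_neg hrate)) (by positivity)
          (by positivity)
    _ = _ := by ring

/-! ### Exponential series on the circle -/

lemma exists_coe_eq_and_abs_eq_norm (x : UnitAddCircle) :
    ∃ r : ℝ, (r : UnitAddCircle) = x ∧ |r| = ‖x‖ ∧ |r| ≤ 1 / 2 := by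
  obtain ⟨y, rfl⟩ := QuotientAddGroup.mk_surjective x
  have hround : ((round y : ℝ) : UnitAddCircle) = 0 :=
    (AddCircle.coe_eq_zero_iff (1 : ℝ)).2 ⟨round y, by simp⟩
  refine ⟨y - round y, ?_, UnitAddCircle.norm_eq.symm, abs_sub_round y⟩
  rw [AddCircle.coe_sub, hround, sub_zero]

lemma four_mul_norm_le_norm_fourier_sub_one (x : UnitAddCircle) :
    4 * ‖x‖ ≤ ‖fourier (-1) x - 1‖ := by
  obtain ⟨r, rfl, hnorm, hhalf⟩ := exists_coe_eq_and_abs_eq_norm x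
  have harg : (2 * Real.pi * Complex.I * ((-1 : ℤ) : ℂ) * (r : ℂ) / ((1 : ℝ) : ℂ)) =
      Complex.I * ((-(2 * Real.pi * r) : ℝ) : ℂ) := by
    push_cast; ring
  have hsin : 2 * |r| ≤ |Real.sin (Real.pi * r)| := by
    calc 2 * |r| = 2 / Real.pi * (Real.pi * |r|) := by field_simp
      _ ≤ |Real.sin (Real.pi * |r|)| :=
        (Real.mul_le_sin (by positivity) (by nlinarith [Real.pi_pos])).trans (le_abs_self _)
      _ = |Real.sin (Real.pi * r)| := by
        rcases abs_cases r with ⟨h, -⟩ | ⟨h, -⟩ <;> simp [h]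
  rw [← hnorm, fourier_coe_apply, harg, Complex.norm_exp_I_mul_ofReal_sub_one, norm_mul,
    Real.norm_eq_abs, Real.norm_eq_abs, abs_two,
    show -(2 * Real.pi * r) / 2 = -(Real.pi * r) by ring, Real.sin_neg, abs_neg]
  linarith

lemma norm_fourier_apply (k : ℤ) (x : UnitAddCircle) : ‖(fourier k x : ℂ)‖ = 1 := by
  rw [fourier_apply]; exact Circle.norm_coe _

lemma summable_mul_fourier {a : ℤ → ℂ} (ha : Summable a) (x : UnitAddCircle) :
    Summable fun k => a k * fourier k x :=
  Summable.of_norm_bounded ha.norm fun k => by rw [norm_mul, norm_fourier_apply, mul_one]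

lemma summable_fwdDiff {a : ℤ → ℂ} (ha : Summable a) : Summable (fwdDiff (1 : ℤ) a) :=
  ((Equiv.addRight (1 : ℤ)).summable_iff.2 ha).sub ha

lemma tsum_fwdDiff_mul_fourier {a : ℤ → ℂ} (ha : Summable a) (x : UnitAddCircle) :
    ∑' k, fwdDiff (1 : ℤ) a k * fourier k x = (fourier (-1) x - 1) * ∑' k, a k * fourier k x := by
  have hterm : ∀ k : ℤ, fwdDiff (1 : ℤ) a k * fourier k x =
      fourier (-1) x * (a (k + 1) * fourier (k + 1) x) - a k * fourier k x := fun k => by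
    rw [mul_left_comm, ← fourier_add, neg_add_cancel_comm_assoc, fwdDiff, sub_mul]
  have hb := summable_mul_fourier ha x
  rw [tsum_congr hterm]
  generalize hb_def : (fun k => a k * (fourier k x : ℂ)) = b at hb
  simp only [funext_iff] at hb_def
  have hb_shift : Summable fun k : ℤ => b (k + 1) := (Equiv.addRight (1 : ℤ)).summable_iff.2 hb
  have htsum_shift : ∑' k : ℤ, b (k + 1) = ∑' k, b k := (Equiv.addRight (1 : ℤ)).tsum_eq b
  simp only [hb_def]
  rw [(hb_shift.mul_left _).tsum_sub hb, tsum_mul_left, htsum_shift]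
  ring

lemma tsum_fwdDiff_iter_mul_fourier {a : ℤ → ℂ} (ha : Summable a) (x : UnitAddCircle) (N : ℕ) :
    ∑' k, (fwdDiff (1 : ℤ))^[N] a k * fourier k x =
      (fourier (-1) x - 1) ^ N * ∑' k, a k * fourier k x := by
  induction N generalizing a with
  | zero => simp
  | succ N ih =>
    simp only [Function.iterate_succ_apply]
    rw [ih (summable_fwdDiff ha), tsum_fwdDiff_mul_fourier ha]
    ring

lemma norm_fwdDiff_iter_le_of_bdd {B : ℝ} (N : ℕ) : ∀ {f : ℤ → ℂ} {k : ℤ},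
    (∀ j : ℤ, k ≤ j → j ≤ k + N → ‖f j‖ ≤ B) → ‖(fwdDiff (1 : ℤ))^[N] f k‖ ≤ 2 ^ N * B := by
  induction N with
  | zero => intro f k h; simpa using h k le_rfl (by simp)
  | succ N ih =>
    intro f k h
    rw [Function.iterate_succ_apply', fwdDiff]
    have hright := ih (f := f) (k := k + 1) fun j hk hj => h j (by omega) (by push_cast; omega)
    have hleft := ih (f := f) (k := k) fun j hk hj => h j (by omega) (by push_cast; omega)
    calc _ ≤ _ := norm_sub_le _ _
      _ ≤ 2 ^ N * B + 2 ^ N * B := add_le_add hright hleft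
      _ = _ := by ring

lemma fwdDiff_iter_intCast (f : ℝ → ℝ) (N : ℕ) (k : ℤ) :
    (fwdDiff (1 : ℤ))^[N] (fun j : ℤ => ((f j : ℝ) : ℂ)) k =
      (((fwdDiff (1 : ℝ))^[N] f k : ℝ) : ℂ) := by
  induction N generalizing f with
  | zero => rfl
  | succ N ih =>
    have hone : fwdDiff (1 : ℤ) (fun j : ℤ => ((f j : ℝ) : ℂ)) =
        fun j : ℤ => ((fwdDiff (1 : ℝ) f j : ℝ) : ℂ) := by
      ext j
      simp [fwdDiff]
    rw [Function.iterate_succ_apply, Function.iterate_succ_apply, ← ih, hone]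

/-- The series `∑ₖ p(k) exp (-q(k) t) exp (2πi k x)`: for `q = q_ε` and `p = 1` it is the kernel
`P_ε(t, x)`, and its derivatives are series of the same kind with another `p`. -/
def expSeries (q : ℝ[X]) (p : ℂ[X]) (t : ℝ) (x : UnitAddCircle) : ℂ :=
  ∑' k : ℤ, p.eval (k : ℂ) * (Real.exp (-(q.eval (k : ℝ) * t)) : ℂ) * fourier k x

lemma summable_norm_eval_mul_exp (p : ℂ[X]) {c : ℝ} (hc : 0 < c) :
    Summable fun k : ℤ => ‖p.eval (k : ℂ)‖ * Real.exp (-(c * (k : ℝ) ^ 2)) := by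
  have h : Summable fun k : ℤ => ∑ j ∈ Finset.range (p.natDegree + 1),
      ‖p.coeff j‖ * (|(k : ℝ)| ^ j * Real.exp (-(c * (k : ℝ) ^ 2))) :=
    summable_sum fun j _ => (summable_abs_pow_mul_exp_neg j hc).mul_left _
  refine Summable.of_nonneg_of_le (fun k => by positivity) (fun k => ?_) h
  rw [eval_eq_sum_range]
  calc _ ≤ (∑ j ∈ Finset.range (p.natDegree + 1), ‖p.coeff j * (k : ℂ) ^ j‖) *
        Real.exp (-(c * (k : ℝ) ^ 2)) := by gcongr; exact norm_sum_le _ _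
    _ = _ := by
      simp only [Finset.sum_mul, norm_mul, norm_pow, Complex.norm_intCast, mul_assoc]

section Symbol

variable {d : ℕ} {M : ℝ} {q : ℝ[X]}

lemma IsSymbol.exp_neg_mul_le (hq : IsSymbol d M q) {t₀ t : ℝ} (h0 : 0 ≤ t₀) (ht : t₀ ≤ t)
    (x : ℝ) : Real.exp (-(q.eval x * t)) ≤ Real.exp (-(t₀ / M * x ^ 2)) := by
  refine Real.exp_le_exp.2 (neg_le_neg ?_)
  calc t₀ / M * x ^ 2 = x ^ 2 / M * t₀ := by ring
    _ ≤ q.eval x * t := mul_le_mul (hq.sq_div_le x) ht h0 (hq.eval_nonneg x)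

lemma IsSymbol.norm_term_le (hq : IsSymbol d M q) (p : ℂ[X]) {t₀ t : ℝ}
    (h0 : 0 ≤ t₀) (ht : t₀ ≤ t) (k : ℤ) :
    ‖p.eval (k : ℂ) * (Real.exp (-(q.eval (k : ℝ) * t)) : ℂ)‖ ≤
      ‖p.eval (k : ℂ)‖ * Real.exp (-(t₀ / M * (k : ℝ) ^ 2)) := by
  rw [norm_mul, Complex.norm_real, Real.norm_eq_abs, Real.abs_exp]
  exact mul_le_mul_of_nonneg_left (hq.exp_neg_mul_le h0 ht _) (norm_nonneg _)

lemma IsSymbol.summable (hq : IsSymbol d M q) (p : ℂ[X]) {t : ℝ} (ht : 0 < t) :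
    Summable fun k : ℤ => p.eval (k : ℂ) * (Real.exp (-(q.eval (k : ℝ) * t)) : ℂ) :=
  Summable.of_norm_bounded (summable_norm_eval_mul_exp p (div_pos ht hq.pos))
    fun k => hq.norm_term_le p ht.le le_rfl k

lemma expSeries_eq_sum (hq : IsSymbol d M q) (p : ℂ[X]) {t : ℝ} (ht : 0 < t)
    (x : UnitAddCircle) {n : ℕ} (hn : p.natDegree < n) :
    expSeries q p t x = ∑ j ∈ Finset.range n, p.coeff j * expSeries q (X ^ j) t x := by
  simp_rw [expSeries, ← tsum_mul_left]
  rw [← Summable.tsum_finsetSum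
    fun j _ => (summable_mul_fourier (hq.summable (X ^ j) ht) x).mul_left _]
  refine tsum_congr fun k => ?_
  simp only [eval_eq_sum_range' hn, Finset.sum_mul, eval_pow, eval_X, mul_assoc]

lemma eval_X_pow_mul_exp (q : ℝ[X]) (L : ℕ) (t : ℝ) (k : ℤ) :
    (X ^ L : ℂ[X]).eval (k : ℂ) * (Real.exp (-(q.eval (k : ℝ) * t)) : ℂ) =
      ((expCoeff q L t k : ℝ) : ℂ) := by
  simp [expCoeff]

/-- The iterated differences of the coefficients of `expSeries q (X ^ L)`. -/
def coeffDiff (q : ℝ[X]) (L N : ℕ) (t : ℝ) (k : ℤ) : ℂ :=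
  (fwdDiff (1 : ℤ))^[N] (fun j : ℤ => ((expCoeff q L t j : ℝ) : ℂ)) k

lemma tsum_coeffDiff_mul_fourier (hq : IsSymbol d M q) (L N : ℕ) {t : ℝ}
    (ht : 0 < t) (x : UnitAddCircle) :
    ∑' k, coeffDiff q L N t k * fourier k x =
      (fourier (-1) x - 1) ^ N * expSeries q (X ^ L) t x := by
  have h := hq.summable (X ^ L) ht
  simp only [expSeries, eval_X_pow_mul_exp] at h ⊢
  exact tsum_fwdDiff_iter_mul_fourier h x N

lemma norm_coeffDiff_le_of_natAbs_lt (hq : IsSymbol d M q) (L : ℕ) {N : ℕ} {t : ℝ} (ht : 0 ≤ t)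
    {k : ℤ} (hk : k.natAbs < 2 * N) : ‖coeffDiff q L N t k‖ ≤ 2 ^ N * (3 * N) ^ L := by
  refine norm_fwdDiff_iter_le_of_bdd N fun j hkj hjk => ?_
  have hj : |(j : ℝ)| ≤ 3 * N := by
    have : |j| ≤ 3 * N := by rw [abs_le]; omega
    exact_mod_cast this
  have hexp : Real.exp (-(q.eval (j : ℝ) * t)) ≤ 1 :=
    Real.exp_le_one_iff.2 (neg_nonpos.2 (mul_nonneg (hq.eval_nonneg _) ht))
  rw [Complex.norm_real, Real.norm_eq_abs, expCoeff, abs_mul, Real.abs_exp, abs_pow]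
  calc |(j : ℝ)| ^ L * Real.exp (-(q.eval (j : ℝ) * t)) ≤ (3 * N) ^ L * 1 := by gcongr
    _ = _ := mul_one _

lemma exists_norm_coeffDiff_le (d : ℕ) {M : ℝ} (hM : 0 < M) {L N : ℕ} (hLN : L < N) :
    ∃ A c : ℝ, 0 ≤ A ∧ 0 < c ∧ ∀ q, IsSymbol d M q → ∀ t : ℝ, 0 < t → ∀ k : ℤ,
      2 * N ≤ k.natAbs → ‖coeffDiff q L N t k‖ ≤ A * ((k.natAbs : ℝ) ^ ((L : ℤ) - N) *
        (t * absEval q k.natAbs * Real.exp (-(c * (t * absEval q k.natAbs))))) := by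
  obtain ⟨A, c, hA, hc, h⟩ := exists_abs_fwdDiff_expCoeff_le d hM hLN
  refine ⟨A, c, hA, hc, fun q hq t ht k hk => ?_⟩
  rw [coeffDiff, fwdDiff_iter_intCast, Complex.norm_real, Real.norm_eq_abs, natAbs_cast_eq_abs]
  refine h q hq t ht k ?_
  rw [← natAbs_cast_eq_abs]
  exact_mod_cast hk

lemma exists_norm_pow_mul_expSeries_le (d : ℕ) {M : ℝ} (hM : 0 < M) (L : ℕ) :
    ∃ B : ℝ, 0 ≤ B ∧ ∀ q, IsSymbol d M q → ∀ t : ℝ, 0 < t → ∀ x : UnitAddCircle,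
      ‖x‖ ^ (L + 1) * ‖expSeries q (X ^ L) t x‖ ≤ B := by
  obtain ⟨A, c, hA, hc, h⟩ := exists_norm_coeffDiff_le d hM (Nat.lt_succ_self L)
  refine ⟨2 * ((2 * (L + 1) : ℕ) * (2 ^ (L + 1) * (3 * (L + 1 : ℕ)) ^ L) + A / c), by positivity,
    fun q hq t ht x => ?_⟩
  have hsum := norm_tsum_int_le_of_superlinear
    (f := fun k => coeffDiff q L (L + 1) t k * fourier k x)
    (m := 2 * (L + 1)) (B := 2 ^ (L + 1) * (3 * (L + 1 : ℕ)) ^ L) (W := fun n => t * absEval q n)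
    hA (by positivity) hc (fun n => mul_nonneg ht.le (absEval_nonneg q n.cast_nonneg))
    (fun n => by
      rw [mul_left_comm, mul_left_comm (n : ℝ)]
      exact mul_le_mul_of_nonneg_left (hq.absEval_superlinear n) ht.le)
    (fun k hk => by
      rw [norm_mul, norm_fourier_apply, mul_one]
      exact norm_coeffDiff_le_of_natAbs_lt hq L ht.le hk)
    (fun k hk => by
      rw [norm_mul, norm_fourier_apply, mul_one]
      refine (h q hq t ht k hk).trans_eq ?_
      have hexponent : (L : ℤ) - ((L + 1 : ℕ) : ℤ) = -1 := by push_cast; ring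
      rw [Nat.succ_eq_add_one, hexponent, zpow_neg_one]
      ring)
  rw [tsum_coeffDiff_mul_fourier hq L (L + 1) ht x, norm_mul, norm_pow] at hsum
  refine le_trans ?_ hsum
  gcongr
  linarith [four_mul_norm_le_norm_fourier_sub_one x, norm_nonneg x]

/-- The mode `k = 0` does not decay in time; it contributes `0 ^ L`. -/
lemma exists_sqrt_pow_mul_expSeries_sub_le (d : ℕ) {M : ℝ} (hM : 0 < M) (L : ℕ) :
    ∃ B : ℝ, 0 ≤ B ∧ ∀ q, IsSymbol d M q → ∀ t : ℝ, 0 < t → ∀ x : UnitAddCircle,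
      √t ^ (L + 1) * ‖expSeries q (X ^ L) t x - 0 ^ L‖ ≤ B := by
  obtain ⟨B, hB, h⟩ := exists_pow_mul_exp_neg_sq_le L hM
  refine ⟨2 * ((1 : ℕ) * 0 + B / 1), by positivity, fun q hq t ht x => ?_⟩
  have hs : 0 < √t := Real.sqrt_pos.2 ht
  set a : ℤ → ℂ := fun k => (X ^ L : ℂ[X]).eval (k : ℂ) * (Real.exp (-(q.eval (k : ℝ) * t)) : ℂ)
  have hseries : expSeries q (X ^ L) t x - 0 ^ L =
      ∑' k : ℤ, if k = 0 then 0 else a k * fourier k x := by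
    rw [expSeries, (summable_mul_fourier (hq.summable (X ^ L) ht) x).tsum_eq_add_tsum_ite 0]
    simp [hq.eval_zero, a]
  have hsum := norm_tsum_int_le_of_superlinear
    (f := fun k : ℤ => (√t : ℂ) ^ (L + 1) * if k = 0 then 0 else a k * fourier k x)
    (m := 1) (W := fun n => √t * n) hB le_rfl one_pos (fun n => by positivity)
    (fun n => le_of_eq (by push_cast; ring))
    (fun k hk => by simp [show k = 0 by omega])
    (fun k hk => by
      have hterm : ‖a k‖ ≤ (k.natAbs : ℝ) ^ L * Real.exp (-((√t * k.natAbs) ^ 2 / M)) := by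
        refine (hq.norm_term_le (X ^ L) ht.le le_rfl k).trans_eq ?_
        rw [eval_pow, eval_X, norm_pow, Complex.norm_intCast, natAbs_cast_eq_abs, mul_pow,
          Real.sq_sqrt ht.le, sq_abs, mul_div_right_comm]
      rw [if_neg (by omega), norm_mul, norm_mul, norm_fourier_apply, mul_one, norm_pow,
        Complex.norm_real, Real.norm_eq_abs, abs_of_pos hs]
      calc √t ^ (L + 1) * ‖a k‖
          ≤ √t ^ (L + 1) * ((k.natAbs : ℝ) ^ L * Real.exp (-((√t * k.natAbs) ^ 2 / M))) := by
            gcongr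
        _ = √t * ((√t * k.natAbs) ^ L * Real.exp (-((√t * k.natAbs) ^ 2 / M))) := by ring
        _ ≤ √t * (B * Real.exp (-(√t * k.natAbs))) :=
            mul_le_mul_of_nonneg_left (h _ (by positivity)) hs.le
        _ = _ := by field_simp)
  rwa [tsum_mul_left, norm_mul, norm_pow, Complex.norm_real, Real.norm_eq_abs,
    abs_of_pos hs, ← hseries] at hsum

lemma tendsto_coeffDiff (q : ℝ[X]) {L N : ℕ} (hLN : L < N) (k : ℤ) :
    Tendsto (fun t => coeffDiff q L N t k) (𝓝[>] 0) (𝓝 0) := by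
  have hzero : (fwdDiff (1 : ℝ))^[N] (fun y : ℝ => y ^ L) k = 0 := by
    rw [fwdDiff_iter_pow_eq_zero_of_lt hLN, Pi.zero_apply]
  have hreal : Tendsto (fun t => (fwdDiff (1 : ℝ))^[N] (expCoeff q L t) k) (𝓝[>] 0)
      (𝓝 ((fwdDiff (1 : ℝ))^[N] (fun y : ℝ => y ^ L) k)) := by
    simp only [fwdDiff_iter_eq_sum_shift (1 : ℝ)]
    refine tendsto_finsetSum _ fun i _ => Tendsto.const_smul ?_ _
    have hcont : Continuous fun t : ℝ => expCoeff q L t (k + i • (1 : ℝ)) := by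
      unfold expCoeff; fun_prop
    simpa [expCoeff] using (hcont.tendsto 0).mono_left (nhdsWithin_le_nhds (s := Set.Ioi 0))
  rw [hzero] at hreal
  simp only [coeffDiff, fwdDiff_iter_intCast]
  exact_mod_cast (Complex.continuous_ofReal.tendsto 0).comp hreal

lemma exists_summable_norm_coeffDiff_le (hq : IsSymbol d M q) (L : ℕ) :
    ∃ b : ℤ → ℝ, Summable b ∧ ∀ t : ℝ, 0 < t → ∀ k, ‖coeffDiff q L (L + 2) t k‖ ≤ b k := by
  obtain ⟨A, c, hA, hc, h⟩ := exists_norm_coeffDiff_le d hq.pos (show L < L + 2 by omega)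
  obtain ⟨B, hB, hexp⟩ := exists_pow_mul_exp_neg_le 1 hc
  set N := L + 2 with hN
  refine ⟨fun k => (if k.natAbs < 2 * N then (2 : ℝ) ^ N * (3 * N) ^ L else 0) +
    A * B * (1 / (k : ℝ) ^ 2), Summable.add ?_
      ((Real.summable_one_div_int_pow.2 one_lt_two).mul_left _), fun t ht k => ?_⟩
  · refine summable_of_ne_finset_zero (s := Finset.Icc (-(2 * N : ℤ)) (2 * N)) fun k hk => ?_
    exact if_neg fun hk' => hk (Finset.mem_Icc.2 ⟨by omega, by omega⟩)
  beta_reduce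
  split_ifs with hk
  · exact (norm_coeffDiff_le_of_natAbs_lt hq L ht.le hk).trans
      (le_add_of_nonneg_right (by positivity))
  have hW : 0 ≤ t * absEval q k.natAbs :=
    mul_nonneg ht.le (absEval_nonneg q k.natAbs.cast_nonneg)
  have hexponent : (L : ℤ) - (N : ℤ) = -2 := by rw [hN]; push_cast; ring
  have hk2 : (k.natAbs : ℝ) ^ (-2 : ℤ) = 1 / (k : ℝ) ^ 2 := by
    rw [natAbs_cast_eq_abs, zpow_neg, one_div, ← sq_abs (k : ℝ)]
    rfl
  rw [zero_add]
  calc ‖coeffDiff q L N t k‖ ≤ A * (1 / (k : ℝ) ^ 2 *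
        ((t * absEval q k.natAbs) ^ 1 * Real.exp (-(c * (t * absEval q k.natAbs))))) := by
        rw [pow_one, ← hk2, ← hexponent]
        exact h q hq t ht k (not_lt.1 hk)
    _ ≤ A * (1 / (k : ℝ) ^ 2 * B) := by gcongr; exact hexp _ hW
    _ = _ := by ring

lemma tendsto_expSeries_X_pow (hq : IsSymbol d M q) (L : ℕ) {x : UnitAddCircle} (hx : x ≠ 0) :
    Tendsto (fun t => expSeries q (X ^ L) t x) (𝓝[>] 0) (𝓝 0) := by
  obtain ⟨b, hb, hle⟩ := exists_summable_norm_coeffDiff_le hq L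
  have hne : (fourier (-1) x - 1 : ℂ) ^ (L + 2) ≠ 0 := by
    refine pow_ne_zero _ (norm_pos_iff.1 ?_)
    linarith [four_mul_norm_le_norm_fourier_sub_one x, norm_pos_iff.2 hx]
  have hlim : Tendsto (fun t => ∑' k, coeffDiff q L (L + 2) t k * fourier k x) (𝓝[>] 0)
      (𝓝 (∑' k : ℤ, 0 * (fourier k x : ℂ))) := by
    refine tendsto_tsum_of_dominated_convergence hb
      (fun k => (tendsto_coeffDiff q (by omega) k).mul_const _) ?_
    filter_upwards [self_mem_nhdsWithin] with t ht k
    rw [norm_mul, norm_fourier_apply, mul_one]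
    exact hle t ht k
  simp only [zero_mul, tsum_zero] at hlim
  have hdiv := hlim.const_mul ((fourier (-1) x - 1 : ℂ) ^ (L + 2))⁻¹
  rw [mul_zero] at hdiv
  refine hdiv.congr' ?_
  filter_upwards [self_mem_nhdsWithin] with t ht
  rw [tsum_coeffDiff_mul_fourier hq L (L + 2) ht x, inv_mul_cancel_left₀ hne]

lemma exists_norm_expSeries_sub_le (d : ℕ) {M : ℝ} (hM : 0 < M) (L : ℕ) :
    ∃ B : ℝ, 0 ≤ B ∧ ∀ q, IsSymbol d M q → ∀ t : ℝ, 0 < t → ∀ x : UnitAddCircle,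
      (√t + ‖x‖) ^ (L + 1) * ‖expSeries q (X ^ L) t x - 0 ^ L‖ ≤ B := by
  obtain ⟨B₁, hB₁, hspace⟩ := exists_norm_pow_mul_expSeries_le d hM L
  obtain ⟨B₂, hB₂, htime⟩ := exists_sqrt_pow_mul_expSeries_sub_le d hM L
  refine ⟨2 ^ L * (B₂ + (B₁ + 1)), by positivity, fun q hq t ht x => ?_⟩
  have hx1 : ‖x‖ ≤ 1 := by
    have := AddCircle.norm_le_half_period (x := x) 1 one_ne_zero
    rw [abs_one] at this
    linarith
  have hspace_sub : ‖x‖ ^ (L + 1) * ‖expSeries q (X ^ L) t x - 0 ^ L‖ ≤ B₁ + 1 := by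
    calc _ ≤ ‖x‖ ^ (L + 1) * (‖expSeries q (X ^ L) t x‖ + ‖(0 : ℂ) ^ L‖) := by
          gcongr; exact norm_sub_le _ _
      _ = ‖x‖ ^ (L + 1) * ‖expSeries q (X ^ L) t x‖ + ‖x‖ ^ (L + 1) * 0 ^ L := by
          rw [mul_add, norm_pow, norm_zero]
      _ ≤ _ := add_le_add (hspace q hq t ht x) <| mul_le_one₀
          (pow_le_one₀ (norm_nonneg x) hx1) (by positivity) (pow_le_one₀ le_rfl zero_le_one)
  calc (√t + ‖x‖) ^ (L + 1) * ‖expSeries q (X ^ L) t x - 0 ^ L‖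
      ≤ 2 ^ L * (√t ^ (L + 1) + ‖x‖ ^ (L + 1)) * ‖expSeries q (X ^ L) t x - 0 ^ L‖ := by
        gcongr
        exact add_pow_le (Real.sqrt_nonneg t) (norm_nonneg x) _
    _ = 2 ^ L * (√t ^ (L + 1) * ‖expSeries q (X ^ L) t x - 0 ^ L‖ +
        ‖x‖ ^ (L + 1) * ‖expSeries q (X ^ L) t x - 0 ^ L‖) := by ring
    _ ≤ _ := by gcongr; exact htime q hq t ht x

lemma exists_norm_expSeries_le (d : ℕ) {M : ℝ} (hM : 0 < M) {L : ℕ} (hL : L ≠ 0) :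
    ∃ B : ℝ, 0 ≤ B ∧ ∀ q, IsSymbol d M q → ∀ t : ℝ, 0 < t → ∀ x : UnitAddCircle,
      ‖expSeries q (X ^ L) t x‖ ≤ B * ((√t + ‖x‖) ^ (L + 1))⁻¹ := by
  obtain ⟨B, hB, h⟩ := exists_norm_expSeries_sub_le d hM L
  refine ⟨B, hB, fun q hq t ht x => ?_⟩
  rw [← div_eq_mul_inv, le_div_iff₀' (by positivity)]
  simpa only [zero_pow hL, sub_zero] using h q hq t ht x

lemma exists_norm_expSeries_one_le (d : ℕ) {M : ℝ} (hM : 0 < M) :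
    ∃ B : ℝ, 0 ≤ B ∧ ∀ q, IsSymbol d M q → ∀ t : ℝ, 0 < t → ∀ x : UnitAddCircle,
      ‖expSeries q 1 t x‖ ≤ B * (1 + (√t + ‖x‖)⁻¹) := by
  obtain ⟨B, hB, h⟩ := exists_norm_expSeries_sub_le d hM 0
  refine ⟨B + 1, by positivity, fun q hq t ht x => ?_⟩
  have hsub : ‖expSeries q 1 t x - 1‖ ≤ B * (√t + ‖x‖)⁻¹ := by
    rw [← div_eq_mul_inv, le_div_iff₀' (by positivity)]
    simpa only [pow_zero, zero_add, pow_one] using h q hq t ht x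
  have htri : ‖expSeries q 1 t x‖ ≤ ‖expSeries q 1 t x - 1‖ + 1 := by
    simpa using norm_add_le (expSeries q 1 t x - 1) 1
  have hinv : 0 ≤ (√t + ‖x‖)⁻¹ := by positivity
  linarith
end Symbol

/-! ### The kernels of the exponential series -/

/-- The coefficient polynomial by which `∂₀` acts on `expSeries q p`. -/
def timeFactor (q : ℝ[X]) : ℂ[X] := -(q.map Complex.ofRealHom)

/-- The coefficient polynomial by which `∂₁` acts on `expSeries q p`. -/
def spaceFactor : ℂ[X] := C (2 * Real.pi * Complex.I) * X

lemma eval_timeFactor (q : ℝ[X]) (k : ℤ) :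
    (timeFactor q).eval (k : ℂ) = -((q.eval (k : ℝ) : ℝ) : ℂ) := by
  have heval := Polynomial.eval_map_apply (p := q) Complex.ofRealHom (k : ℝ)
  rw [Complex.ofRealHom_eq_coe, Complex.ofReal_intCast, Complex.ofRealHom_eq_coe] at heval
  rw [timeFactor, eval_neg, heval]

lemma eval_spaceFactor (k : ℤ) :
    spaceFactor.eval (k : ℂ) = 2 * Real.pi * Complex.I * k := by
  simp [spaceFactor]

/-- The lift of `expSeries q p` to `ℝ × ℝ`, periodic in the second variable and extended by zero
to nonpositive times. -/
def expKernel (q : ℝ[X]) (p : ℂ[X]) (z : ℝ × ℝ) : ℂ :=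
  if 0 < z.1 then expSeries q p z.1 (z.2 : UnitAddCircle) else 0

lemma expKernel_of_pos (q : ℝ[X]) (p : ℂ[X]) {z : ℝ × ℝ} (hz : 0 < z.1) :
    expKernel q p z = expSeries q p z.1 (z.2 : UnitAddCircle) := if_pos hz

lemma expKernel_of_nonpos (q : ℝ[X]) (p : ℂ[X]) {z : ℝ × ℝ} (hz : z.1 ≤ 0) :
    expKernel q p z = 0 := if_neg hz.not_gt

section OfPartials

variable {E : Type*} [NormedAddCommGroup E] [NormedSpace ℝ E]

/-- The total derivative with partial derivatives `a` and `b`, as a continuous linear function of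
`(a, b)`. -/
def ofPartials : E × E →L[ℝ] ℝ × ℝ →L[ℝ] E :=
  (ContinuousLinearMap.smulRightL ℝ (ℝ × ℝ) E (ContinuousLinearMap.fst ℝ ℝ ℝ)).comp
      (ContinuousLinearMap.fst ℝ E E) +
    (ContinuousLinearMap.smulRightL ℝ (ℝ × ℝ) E (ContinuousLinearMap.snd ℝ ℝ ℝ)).comp
      (ContinuousLinearMap.snd ℝ E E)

lemma ofPartials_apply (a b : E) (z : ℝ × ℝ) : ofPartials (a, b) z = z.1 • a + z.2 • b := rfl

lemma norm_ofPartials_le (a b : E) : ‖ofPartials (a, b)‖ ≤ ‖a‖ + ‖b‖ := by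
  refine ContinuousLinearMap.opNorm_le_bound _ (by positivity) fun z => ?_
  calc ‖z.1 • a + z.2 • b‖ ≤ ‖z.1‖ * ‖a‖ + ‖z.2‖ * ‖b‖ := by
        rw [← norm_smul, ← norm_smul]; exact norm_add_le _ _
    _ ≤ ‖z‖ * ‖a‖ + ‖z‖ * ‖b‖ := by gcongr; exacts [norm_fst_le z, norm_snd_le z]
    _ = (‖a‖ + ‖b‖) * ‖z‖ := by ring

end OfPartials

/-- The complement of the origin of `ℝ × 𝕋`, lifted to `ℝ × ℝ`. -/
def offOrigin : Set (ℝ × ℝ) := {p | ((p.1, (p.2 : UnitAddCircle)) : SpaceTime) ≠ 0}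

lemma isOpenQuotientMap_spaceProj :
    IsOpenQuotientMap fun p : ℝ × ℝ => ((p.1, (p.2 : UnitAddCircle)) : SpaceTime) :=
  IsOpenQuotientMap.id.prodMap QuotientAddGroup.isOpenQuotientMap_mk

lemma isOpen_offOrigin : IsOpen offOrigin :=
  isOpen_ne.preimage isOpenQuotientMap_spaceProj.continuous

section Symbol

variable {d : ℕ} {M : ℝ} {q : ℝ[X]}

lemma hasFDerivAt_term (q : ℝ[X]) (p : ℂ[X]) (k : ℤ) (z : ℝ × ℝ) :
    HasFDerivAt (fun z : ℝ × ℝ => p.eval (k : ℂ) * (Real.exp (-(q.eval (k : ℝ) * z.1)) : ℂ) *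
        fourier k (z.2 : UnitAddCircle))
      (ofPartials ((timeFactor q * p).eval (k : ℂ) * (Real.exp (-(q.eval (k : ℝ) * z.1)) : ℂ) *
        fourier k (z.2 : UnitAddCircle),
        (spaceFactor * p).eval (k : ℂ) * (Real.exp (-(q.eval (k : ℝ) * z.1)) : ℂ) *
        fourier k (z.2 : UnitAddCircle))) z := by
  have htime : HasDerivAt (fun s : ℝ => (Real.exp (-(q.eval (k : ℝ) * s)) : ℂ))
      ((Real.exp (-(q.eval (k : ℝ) * z.1)) * -(q.eval (k : ℝ) * 1) : ℝ) : ℂ) z.1 :=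
    ((((hasDerivAt_id z.1).const_mul (q.eval (k : ℝ))).neg).exp).ofReal_comp
  have htime' := htime.hasFDerivAt.comp z
    (hasFDerivAt_fst (𝕜 := ℝ) (E := ℝ) (F := ℝ) (p := z))
  have hspace' := (hasDerivAt_fourier 1 k z.2).hasFDerivAt.comp z
    (hasFDerivAt_snd (𝕜 := ℝ) (E := ℝ) (F := ℝ) (p := z))
  refine ((htime'.const_mul (p.eval (k : ℂ))).mul hspace').congr_fderiv ?_
  ext <;>
  · simp [ofPartials_apply, eval_timeFactor, eval_spaceFactor]
    try ring

lemma hasFDerivAt_expKernel_of_pos (hq : IsSymbol d M q) (p : ℂ[X]) {z : ℝ × ℝ}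
    (hz : 0 < z.1) : HasFDerivAt (expKernel q p)
      (ofPartials (expKernel q (timeFactor q * p) z, expKernel q (spaceFactor * p) z)) z := by
  set U : Set (ℝ × ℝ) := {w | z.1 / 2 < w.1}
  have hU : IsOpen U := isOpen_lt continuous_const continuous_fst
  have hconv : Convex ℝ U := convex_halfSpace_gt (f := Prod.fst) ⟨fun _ _ => rfl, fun _ _ => rfl⟩ _
  have hzU : z ∈ U := half_lt_self hz
  have hbound := (summable_norm_eval_mul_exp (timeFactor q * p) (div_pos (half_pos hz) hq.pos)).add
    (summable_norm_eval_mul_exp (spaceFactor * p) (div_pos (half_pos hz) hq.pos))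
  have hsummable (p : ℂ[X]) := summable_mul_fourier (hq.summable p hz) (z.2 : UnitAddCircle)
  have hderiv := hasFDerivAt_tsum_of_isPreconnected (𝕜 := ℝ) hbound hU hconv.isPreconnected
    (fun k w _ => hasFDerivAt_term q p k w) (fun k w hw => ?_) hzU (hsummable p) hzU
  · rw [(ofPartials.hasSum ((hsummable _).hasSum.prodMk (hsummable _).hasSum)).tsum_eq] at hderiv
    rw [expKernel_of_pos _ _ hz, expKernel_of_pos _ _ hz]
    refine hderiv.congr_of_eventuallyEq ?_
    filter_upwards [hU.mem_nhds hzU] with w hw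
    exact expKernel_of_pos q p ((half_pos hz).trans hw)
  · refine (norm_ofPartials_le _ _).trans (add_le_add ?_ ?_) <;>
    · rw [norm_mul, norm_fourier_apply, mul_one]
      exact hq.norm_term_le _ (half_pos hz).le (le_of_lt hw) k

lemma hasDerivAt_expSeries_time (hq : IsSymbol d M q) (p : ℂ[X]) {t : ℝ}
    (ht : 0 < t) (x : UnitAddCircle) :
    HasDerivAt (fun s => expSeries q p s x) (expSeries q (timeFactor q * p) t x) t := by
  obtain ⟨r, rfl, -⟩ := exists_coe_eq_and_abs_eq_norm x
  have hderiv := (hasFDerivAt_expKernel_of_pos hq p (z := (t, r)) ht).comp_hasDerivAt t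
    ((hasDerivAt_id t).prodMk (hasDerivAt_const t r))
  rw [ofPartials_apply, one_smul, zero_smul, add_zero,
    expKernel_of_pos _ _ (z := (t, r)) ht] at hderiv
  refine hderiv.congr_of_eventuallyEq ?_
  filter_upwards [lt_mem_nhds ht] with s hs
  exact (expKernel_of_pos q p (z := (s, r)) hs).symm

lemma exists_norm_expSeries_le_of_le_norm (hq : IsSymbol d M q) (p : ℂ[X]) {δ : ℝ}
    (hδ : 0 < δ) : ∃ B : ℝ, 0 ≤ B ∧ ∀ t : ℝ, 0 < t → ∀ x : UnitAddCircle, δ ≤ ‖x‖ →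
      ‖expSeries q p t x‖ ≤ B := by
  choose B hB hBq using fun L => exists_norm_pow_mul_expSeries_le d hq.pos L
  refine ⟨∑ j ∈ Finset.range (p.natDegree + 1), ‖p.coeff j‖ * (B j / δ ^ (j + 1)),
    Finset.sum_nonneg fun j _ => by have := hB j; positivity, fun t ht x hx => ?_⟩
  rw [expSeries_eq_sum hq p ht x (Nat.lt_succ_self _)]
  refine (norm_sum_le _ _).trans (Finset.sum_le_sum fun j _ => ?_)
  rw [norm_mul]
  gcongr
  rw [le_div_iff₀ (by positivity), mul_comm]
  calc δ ^ (j + 1) * ‖expSeries q (X ^ j) t x‖ ≤ ‖x‖ ^ (j + 1) * ‖expSeries q (X ^ j) t x‖ := by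
        gcongr
    _ ≤ B j := hBq j q hq t ht x

lemma tendsto_expSeries (hq : IsSymbol d M q) (p : ℂ[X]) {x : UnitAddCircle} (hx : x ≠ 0) :
    Tendsto (fun t => expSeries q p t x) (𝓝[>] 0) (𝓝 0) := by
  have hsum : Tendsto (fun t => ∑ j ∈ Finset.range (p.natDegree + 1),
      p.coeff j * expSeries q (X ^ j) t x) (𝓝[>] 0)
      (𝓝 (∑ j ∈ Finset.range (p.natDegree + 1), p.coeff j * 0)) :=
    tendsto_finsetSum _ fun j _ => (tendsto_expSeries_X_pow hq j hx).const_mul _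
  simp only [mul_zero, Finset.sum_const_zero] at hsum
  refine hsum.congr' ?_
  filter_upwards [self_mem_nhdsWithin] with t ht
  exact (expSeries_eq_sum hq p ht x (Nat.lt_succ_self _)).symm

lemma norm_expSeries_le_of_timeDeriv_le (hq : IsSymbol d M q) (p : ℂ[X])
    {x : UnitAddCircle} (hx : x ≠ 0) {t C : ℝ} (ht : 0 < t)
    (hC : ∀ s ∈ Set.Ioc 0 t, ‖expSeries q (timeFactor q * p) s x‖ ≤ C) :
    ‖expSeries q p t x‖ ≤ C * t := by
  have hincr : ∀ s ∈ Set.Ioc 0 t, ‖expSeries q p t x - expSeries q p s x‖ ≤ C * t := by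
    intro s hs
    have hC0 : 0 ≤ C := (norm_nonneg _).trans (hC s hs)
    calc ‖expSeries q p t x - expSeries q p s x‖ ≤ C * ‖t - s‖ :=
          (convex_Ioc (0 : ℝ) t).norm_image_sub_le_of_norm_hasDerivWithin_le
            (fun s hs => (hasDerivAt_expSeries_time hq p hs.1 x).hasDerivWithinAt) hC hs
            (Set.right_mem_Ioc.2 ht)
      _ ≤ C * t := by
          gcongr
          rw [Real.norm_eq_abs, abs_of_nonneg (sub_nonneg.2 hs.2)]
          exact sub_le_self t hs.1.le
  have hlim : Tendsto (fun s => ‖expSeries q p t x - expSeries q p s x‖) (𝓝[>] 0)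
      (𝓝 ‖expSeries q p t x - 0‖) :=
    (tendsto_const_nhds.sub (tendsto_expSeries hq p hx)).norm
  rw [sub_zero] at hlim
  refine le_of_tendsto hlim ?_
  filter_upwards [Ioc_mem_nhdsGT ht] with s hs using hincr s hs

lemma exists_norm_expSeries_le_mul_sq (hq : IsSymbol d M q) (p : ℂ[X]) {δ : ℝ}
    (hδ : 0 < δ) : ∃ B : ℝ, 0 ≤ B ∧ ∀ t : ℝ, 0 < t → ∀ x : UnitAddCircle, δ ≤ ‖x‖ →
      ‖expSeries q p t x‖ ≤ B * t ^ 2 := by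
  obtain ⟨B, hB, hsecond⟩ := exists_norm_expSeries_le_of_le_norm hq
    (timeFactor q * (timeFactor q * p)) hδ
  refine ⟨B, hB, fun t ht x hx => ?_⟩
  have hx0 : x ≠ 0 := norm_pos_iff.1 (hδ.trans_le hx)
  rw [pow_two, ← mul_assoc]
  refine norm_expSeries_le_of_timeDeriv_le hq p hx0 ht fun s hs => ?_
  calc ‖expSeries q (timeFactor q * p) s x‖ ≤ B * s :=
        norm_expSeries_le_of_timeDeriv_le hq _ hx0 hs.1 fun r hr => hsecond r hr.1 x hx
    _ ≤ B * t := by gcongr; exact hs.2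

lemma hasFDerivAt_expKernel_of_eq_zero (hq : IsSymbol d M q) (p : ℂ[X]) {z : ℝ × ℝ}
    (hz : z.1 = 0) (hx : (z.2 : UnitAddCircle) ≠ 0) :
    HasFDerivAt (expKernel q p) (0 : ℝ × ℝ →L[ℝ] ℂ) z := by
  have hnorm : 0 < ‖(z.2 : UnitAddCircle)‖ := norm_pos_iff.2 hx
  obtain ⟨B, hB, hquad⟩ := exists_norm_expSeries_le_mul_sq hq p (half_pos hnorm)
  have hcont : Continuous fun w : ℝ × ℝ => ‖(w.2 : UnitAddCircle)‖ :=
    ((AddCircle.continuous_mk' 1).comp continuous_snd).norm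
  refine Asymptotics.IsBigO.hasFDerivAt (n := 2) (.of_bound B ?_) one_lt_two
  filter_upwards [(isOpen_lt continuous_const hcont).mem_nhds (half_lt_self hnorm)] with w hw
  rcases le_or_gt w.1 0 with hw1 | hw1
  · rw [expKernel_of_nonpos _ _ hw1, norm_zero]; positivity
  · rw [expKernel_of_pos _ _ hw1, norm_pow, norm_norm]
    have hle : w.1 ≤ ‖w - z‖ := by
      have := norm_fst_le (w - z)
      rw [Prod.fst_sub, hz, sub_zero] at this
      exact (le_abs_self _).trans this
    calc ‖expSeries q p w.1 (w.2 : UnitAddCircle)‖ ≤ B * w.1 ^ 2 := hquad w.1 hw1 _ (le_of_lt hw)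
      _ ≤ B * ‖w - z‖ ^ 2 := by gcongr

lemma hasFDerivAt_expKernel (hq : IsSymbol d M q) (p : ℂ[X]) {z : ℝ × ℝ}
    (hz : z ∈ offOrigin) : HasFDerivAt (expKernel q p)
      (ofPartials (expKernel q (timeFactor q * p) z, expKernel q (spaceFactor * p) z)) z := by
  rcases lt_or_ge 0 z.1 with hpos | hnonpos
  · exact hasFDerivAt_expKernel_of_pos hq p hpos
  rw [expKernel_of_nonpos _ _ hnonpos, expKernel_of_nonpos _ _ hnonpos, Prod.mk_zero_zero, map_zero]
  rcases hnonpos.lt_or_eq with hneg | hzero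
  · refine (hasFDerivAt_const (0 : ℂ) z).congr_of_eventuallyEq ?_
    filter_upwards [(isOpen_lt continuous_fst continuous_const).mem_nhds hneg] with w hw
    exact expKernel_of_nonpos q p (le_of_lt hw)
  · exact hasFDerivAt_expKernel_of_eq_zero hq p hzero fun hx => hz (by rw [hzero, hx]; rfl)

lemma contDiffOn_expKernel (hq : IsSymbol d M q) (p : ℂ[X]) :
    ContDiffOn ℝ ∞ (expKernel q p) offOrigin := by
  rw [contDiffOn_infty]
  intro n
  induction n generalizing p with
  | zero =>
    rw [Nat.cast_zero, contDiffOn_zero]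
    exact fun z hz => (hasFDerivAt_expKernel hq p hz).continuousAt.continuousWithinAt
  | succ n ih =>
    rw [Nat.cast_succ, contDiffOn_succ_iff_fderiv_of_isOpen isOpen_offOrigin]
    refine ⟨fun z hz => (hasFDerivAt_expKernel hq p hz).differentiableAt.differentiableWithinAt,
      by simp, ?_⟩
    exact (ofPartials.contDiff.comp_contDiffOn
      ((ih (timeFactor q * p)).prodMk (ih (spaceFactor * p)))).congr
        fun z hz => (hasFDerivAt_expKernel hq p hz).fderiv

end Symbol

/-! ### Real kernels on space-time -/

/-- The real part of `expSeries q p`, extended by zero to nonpositive times. The Green's function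
is the case `p = 1`. -/
def reKernel (q : ℝ[X]) (p : ℂ[X]) (x : SpaceTime) : ℝ :=
  if 0 < x.1 then (expSeries q p x.1 x.2).re else 0

lemma spaceLift_reKernel (q : ℝ[X]) (p : ℂ[X]) (z : ℝ × ℝ) :
    spaceLift (reKernel q p) z = (expKernel q p z).re := by
  simp only [spaceLift, reKernel, expKernel]
  split_ifs <;> rfl

lemma abs_reKernel_le (q : ℝ[X]) (p : ℂ[X]) (x : SpaceTime) {B : ℝ} (hB : 0 ≤ B)
    (hseries : 0 < x.1 → ‖expSeries q p x.1 x.2‖ ≤ B) : |reKernel q p x| ≤ B := by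
  rw [reKernel]
  split_ifs with hx
  · exact (Complex.abs_re_le_norm _).trans (hseries hx)
  · rwa [abs_zero]

lemma eventually_ne_zero_time {x : SpaceTime} (hx : x ≠ 0) :
    ∀ᶠ s in 𝓝 x.1, ((s, x.2) : SpaceTime) ≠ 0 :=
  (Continuous.prodMk_left x.2).continuousAt.eventually_ne hx

lemma eventually_ne_zero_space {x : SpaceTime} (hx : x ≠ 0) :
    ∀ᶠ s : ℝ in 𝓝 0, ((x.1, x.2 + (s : UnitAddCircle)) : SpaceTime) ≠ 0 := by
  have hcont : Continuous fun s : ℝ => ((x.1, x.2 + (s : UnitAddCircle)) : SpaceTime) :=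
    continuous_const.prodMk (continuous_const.add (AddCircle.continuous_mk' 1))
  exact hcont.continuousAt.eventually_ne (by simpa using hx)

lemma timeDeriv_congr {f g : SpaceTime → ℝ} (hfg : ∀ x ≠ 0, f x = g x) :
    ∀ x ≠ 0, timeDeriv f x = timeDeriv g x := fun x hx => by
  refine Filter.EventuallyEq.deriv_eq ?_
  filter_upwards [eventually_ne_zero_time hx] with s hs using hfg _ hs

lemma spaceDeriv_congr {f g : SpaceTime → ℝ} (hfg : ∀ x ≠ 0, f x = g x) :
    ∀ x ≠ 0, spaceDeriv f x = spaceDeriv g x := fun x hx => by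
  refine Filter.EventuallyEq.deriv_eq ?_
  filter_upwards [eventually_ne_zero_space hx] with s hs using hfg _ hs

section Symbol

variable {d : ℕ} {M : ℝ} {q : ℝ[X]}

lemma hasDerivAt_reKernel_time (hq : IsSymbol d M q) (p : ℂ[X]) {t : ℝ}
    {x : UnitAddCircle} (hx : ((t, x) : SpaceTime) ≠ 0) :
    HasDerivAt (fun s : ℝ => reKernel q p (s, x)) (reKernel q (timeFactor q * p) (t, x)) t := by
  obtain ⟨r, rfl, -⟩ := exists_coe_eq_and_abs_eq_norm x
  have hderiv := (hasFDerivAt_expKernel hq p (z := (t, r)) hx).comp_hasDerivAt t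
    ((hasDerivAt_id t).prodMk (hasDerivAt_const t r))
  rw [ofPartials_apply, one_smul, zero_smul, add_zero] at hderiv
  convert! Complex.reCLM.hasFDerivAt.comp_hasDerivAt t hderiv using 1
  · ext s; exact spaceLift_reKernel q p (s, r)
  · exact spaceLift_reKernel q _ (t, r)

lemma hasDerivAt_reKernel_space (hq : IsSymbol d M q) (p : ℂ[X]) {t r : ℝ}
    (hx : ((t, (r : UnitAddCircle)) : SpaceTime) ≠ 0) :
    HasDerivAt (fun s : ℝ => reKernel q p (t, (s : UnitAddCircle)))
      (reKernel q (spaceFactor * p) (t, (r : UnitAddCircle))) r := by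
  have hderiv := (hasFDerivAt_expKernel hq p (z := (t, r)) hx).comp_hasDerivAt r
    ((hasDerivAt_const r t).prodMk (hasDerivAt_id r))
  rw [ofPartials_apply, one_smul, zero_smul, zero_add] at hderiv
  convert! Complex.reCLM.hasFDerivAt.comp_hasDerivAt r hderiv using 1
  · ext s; exact spaceLift_reKernel q p (t, s)
  · exact spaceLift_reKernel q _ (t, r)

lemma timeDeriv_reKernel (hq : IsSymbol d M q) (p : ℂ[X]) {x : SpaceTime}
    (hx : x ≠ 0) : timeDeriv (reKernel q p) x = reKernel q (timeFactor q * p) x :=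
  (hasDerivAt_reKernel_time hq p hx).deriv

lemma spaceDeriv_reKernel (hq : IsSymbol d M q) (p : ℂ[X]) {x : SpaceTime}
    (hx : x ≠ 0) : spaceDeriv (reKernel q p) x = reKernel q (spaceFactor * p) x := by
  obtain ⟨t, y⟩ := x
  obtain ⟨r, rfl, -⟩ := exists_coe_eq_and_abs_eq_norm y
  have hshift : HasDerivAt (fun s : ℝ => reKernel q p (t, ((r + s : ℝ) : UnitAddCircle)))
      (reKernel q (spaceFactor * p) (t, (r : UnitAddCircle))) 0 := by
    refine HasDerivAt.comp_const_add (f := fun s : ℝ => reKernel q p (t, (s : UnitAddCircle)))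
      r 0 ?_
    rw [add_zero]
    exact hasDerivAt_reKernel_space hq p hx
  simp only [AddCircle.coe_add] at hshift
  exact hshift.deriv

lemma iterate_spaceDeriv_reKernel (hq : IsSymbol d M q) (p : ℂ[X]) (l : ℕ) :
    ∀ x ≠ 0, spaceDeriv^[l] (reKernel q p) x = reKernel q (spaceFactor ^ l * p) x := by
  induction l with
  | zero => simp
  | succ l ih =>
    intro x hx
    rw [Function.iterate_succ_apply', spaceDeriv_congr ih x hx, spaceDeriv_reKernel hq _ hx,
      pow_succ', mul_assoc]

lemma mixedDeriv_reKernel (hq : IsSymbol d M q) (p : ℂ[X]) (m l : ℕ) :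
    ∀ x ≠ 0, mixedDeriv m l (reKernel q p) x =
      reKernel q (timeFactor q ^ m * (spaceFactor ^ l * p)) x := by
  induction m with
  | zero => simpa [mixedDeriv] using iterate_spaceDeriv_reKernel hq p l
  | succ m ih =>
    intro x hx
    rw [mixedDeriv, Function.iterate_succ_apply', ← mixedDeriv, timeDeriv_congr ih x hx,
      timeDeriv_reKernel hq _ hx, pow_succ', mul_assoc]

lemma isSmoothOffOrigin_reKernel (hq : IsSymbol d M q) (p : ℂ[X]) :
    IsSmoothOffOrigin (reKernel q p) :=
  (Complex.reCLM.contDiff.comp_contDiffOn (contDiffOn_expKernel hq p)).congr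
    fun z _ => spaceLift_reKernel q p z

end Symbol

/-! ### The parabolic size -/

lemma parSize_nonneg (x : SpaceTime) : 0 ≤ parSize x := by unfold parSize; positivity

lemma parSize_pos {x : SpaceTime} (hx : x ≠ 0) : 0 < parSize x := by
  rcases eq_or_ne x.1 0 with ht | ht
  · have hy : x.2 ≠ 0 := fun hy => hx (Prod.ext ht hy)
    exact add_pos_of_nonneg_of_pos (Real.sqrt_nonneg _) (norm_pos_iff.2 hy)
  · exact add_pos_of_pos_of_nonneg (Real.sqrt_pos.2 (abs_pos.2 ht)) (norm_nonneg _)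

lemma parSize_neg (x : SpaceTime) : parSize (-x) = parSize x := by simp [parSize]

lemma parSize_add_le (x y : SpaceTime) : parSize (x + y) ≤ parSize x + parSize y := by
  have htime : √|x.1 + y.1| ≤ √|x.1| + √|y.1| := by
    refine Real.sqrt_le_iff.2 ⟨by positivity, (abs_add_le _ _).trans ?_⟩
    nlinarith [Real.sq_sqrt (abs_nonneg x.1), Real.sq_sqrt (abs_nonneg y.1),
      Real.sqrt_nonneg |x.1|, Real.sqrt_nonneg |y.1|]
  have hspace := norm_add_le x.2 y.2
  simp only [parSize, Prod.fst_add, Prod.snd_add]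
  linarith

/-! ### Varying the symbol -/

section Interpolation

variable {d : ℕ} {M : ℝ}

lemma IsSymbol.combo {q₀ q₁ : ℝ[X]} (h₀ : IsSymbol d M q₀)
    (h₁ : IsSymbol d M q₁) {a b : ℝ} (ha : 0 ≤ a) (hb : 0 ≤ b) (hab : a + b = 1) :
    IsSymbol d M (C a * q₁ + C b * q₀) where
  pos := h₀.pos
  natDegree_le := natDegree_add_le_of_degree_le
    ((natDegree_C_mul_le _ _).trans h₁.natDegree_le)
    ((natDegree_C_mul_le _ _).trans h₀.natDegree_le)
  coeff_zero := by simp [h₀.coeff_zero, h₁.coeff_zero]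
  coeff_one := by simp [h₀.coeff_one, h₁.coeff_one]
  one_le_coeff_two := by
    simp only [coeff_add, coeff_C_mul]
    nlinarith [h₀.one_le_coeff_two, h₁.one_le_coeff_two]
  absEval_le x := by
    refine (absEval_add_le _ _ (abs_nonneg x)).trans ?_
    rw [absEval_C_mul, absEval_C_mul, abs_of_nonneg ha, abs_of_nonneg hb, eval_add, eval_C_mul,
      eval_C_mul]
    have := mul_le_mul_of_nonneg_left (h₀.absEval_le x) hb
    have := mul_le_mul_of_nonneg_left (h₁.absEval_le x) ha
    linarith

lemma hasDerivAt_expSeries_symbol {qs : ℝ → ℝ[X]} {r : ℝ[X]} {v : ℝ → ℝ} {V : ℝ}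
    (hqs : ∀ s, IsSymbol d M (qs s))
    (hderiv : ∀ s y, HasDerivAt (fun s => (qs s).eval y) (v s * r.eval y) s)
    (hv : ∀ s, |v s| ≤ V) (p : ℂ[X]) {t : ℝ} (ht : 0 < t) (x : UnitAddCircle) (s : ℝ) :
    HasDerivAt (fun s => expSeries (qs s) p t x)
      (((v s * t : ℝ) : ℂ) * expSeries (qs s) (timeFactor r * p) t x) s := by
  have hterm : ∀ (k : ℤ) (s : ℝ), HasDerivAt
      (fun s => p.eval (k : ℂ) * (Real.exp (-((qs s).eval (k : ℝ) * t)) : ℂ) * fourier k x)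
      (((v s * t : ℝ) : ℂ) * ((timeFactor r * p).eval (k : ℂ) *
        (Real.exp (-((qs s).eval (k : ℝ) * t)) : ℂ) * fourier k x)) s := by
    intro k s
    refine ((((((hderiv s k).mul_const t).neg.exp).ofReal_comp).const_mul
      (p.eval (k : ℂ))).mul_const (fourier k x : ℂ)).congr_deriv ?_
    simp only [eval_mul, eval_timeFactor, Pi.neg_apply]
    push_cast
    ring
  have hbound := (summable_norm_eval_mul_exp (timeFactor r * p)
    (div_pos ht (hqs 0).pos)).mul_left (V * t)
  have hsum := hasDerivAt_tsum hbound hterm (fun k s => ?_)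
    (summable_mul_fourier ((hqs 0).summable p ht) x) s
  · rwa [tsum_mul_left] at hsum
  · have hV : 0 ≤ V := (abs_nonneg _).trans (hv s)
    rw [norm_mul, norm_mul _ (fourier k x : ℂ), norm_fourier_apply, mul_one, Complex.norm_real,
      Real.norm_eq_abs, abs_mul, abs_of_pos ht]
    gcongr
    · exact hv s
    · exact (hqs s).norm_term_le _ ht.le le_rfl k

lemma norm_expSeries_sub_le {q₀ q₁ : ℝ[X]} (h₀ : IsSymbol d M q₀)
    (h₁ : IsSymbol d M q₁) (p : ℂ[X]) {t : ℝ} (ht : 0 < t) (x : UnitAddCircle) {B : ℝ}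
    (hB : ∀ q, IsSymbol d M q → ‖expSeries q (timeFactor (q₁ - q₀) * p) t x‖ ≤ B) :
    ‖expSeries q₁ p t x - expSeries q₀ p t x‖ ≤ 2 * (t * B) := by
  -- Interpolating along `sin² s, cos² s` stays within the symbols for all `s ∈ ℝ`.
  let qs : ℝ → ℝ[X] := fun s => C (Real.sin s ^ 2) * q₁ + C (Real.cos s ^ 2) * q₀
  have hqs (s) : IsSymbol d M (qs s) :=
    h₀.combo h₁ (sq_nonneg _) (sq_nonneg _) (Real.sin_sq_add_cos_sq s)
  have hderiv (s y : ℝ) : HasDerivAt (fun s => (qs s).eval y)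
      (Real.sin (2 * s) * (q₁ - q₀).eval y) s := by
    simp only [qs, eval_add, eval_C_mul]
    refine (((Real.hasDerivAt_sin s).pow 2).mul_const (q₁.eval y) |>.add
      (((Real.hasDerivAt_cos s).pow 2).mul_const (q₀.eval y))).congr_deriv ?_
    rw [Real.sin_two_mul, eval_sub]
    push_cast
    ring
  have hsin (s : ℝ) : |Real.sin (2 * s)| ≤ 1 := Real.abs_sin_le_one _
  have hmean := convex_univ.norm_image_sub_le_of_norm_hasDerivWithin_le (C := t * B)
    (fun s _ => (hasDerivAt_expSeries_symbol hqs hderiv hsin p ht x s).hasDerivWithinAt)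
    (fun s _ => by
      rw [norm_mul, Complex.norm_real, Real.norm_eq_abs, abs_mul, abs_of_pos ht]
      exact mul_le_mul (mul_le_of_le_one_left ht.le (hsin s)) (hB _ (hqs s)) (norm_nonneg _) ht.le)
    (Set.mem_univ (0 : ℝ)) (Set.mem_univ (Real.pi / 2))
  have hend : qs (Real.pi / 2) = q₁ := by simp [qs]
  have hstart : qs 0 = q₀ := by simp [qs]
  rw [hend, hstart, sub_zero, Real.norm_eq_abs, abs_of_pos (by positivity), mul_comm] at hmean
  refine hmean.trans (mul_le_mul_of_nonneg_right (by linarith [Real.pi_le_four]) ?_)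
  exact mul_nonneg ht.le ((norm_nonneg _).trans (hB q₀ h₀))

lemma exists_norm_expSeries_le_of_coeff (d : ℕ) {M : ℝ} (hM : 0 < M) {c : ℝ} (hc : 0 < c) (D : ℕ)
    {a : ℕ} (ha : a ≠ 0) : ∃ B : ℝ, 0 ≤ B ∧ ∀ q, IsSymbol d M q → ∀ (ε A : ℝ) (p : ℂ[X]), 0 ≤ ε →
      0 ≤ A → p.natDegree < D → (∀ n < a, p.coeff n = 0) →
      (∀ n, a ≤ n → ‖p.coeff n‖ ≤ A * ε ^ (n - a)) →
      ∀ (t : ℝ) (x : UnitAddCircle), 0 < t → c * ε ≤ √t + ‖x‖ →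
        ‖expSeries q p t x‖ ≤ A * (B * ((√t + ‖x‖) ^ (a + 1))⁻¹) := by
  choose! B _ hBq using fun L (hL : L ≠ 0) => exists_norm_expSeries_le d hM hL
  refine ⟨∑ n ∈ Finset.range D, |B n| * c⁻¹ ^ (n - a), by positivity,
    fun q hq ε A p hε hA hD hlow hcoeff t x ht hsize => ?_⟩
  have hpos : 0 < √t + ‖x‖ := add_pos_of_pos_of_nonneg (Real.sqrt_pos.2 ht) (norm_nonneg x)
  set ρ := √t + ‖x‖
  have hερ : ε ≤ c⁻¹ * ρ := by rwa [inv_mul_eq_div, le_div_iff₀ hc, mul_comm]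
  rw [expSeries_eq_sum hq p ht x hD, Finset.sum_mul, Finset.mul_sum]
  refine (norm_sum_le _ _).trans (Finset.sum_le_sum fun n _ => ?_)
  rcases lt_or_ge n a with hn | hn
  · rw [hlow n hn, zero_mul, norm_zero]
    positivity
  have hn0 : n ≠ 0 := by omega
  have hsplit : ρ ^ (n + 1) = ρ ^ (n - a) * ρ ^ (a + 1) := by rw [← pow_add]; congr 1; omega
  calc ‖p.coeff n * expSeries q (X ^ n) t x‖
      = ‖p.coeff n‖ * ‖expSeries q (X ^ n) t x‖ := norm_mul _ _
    _ ≤ (A * (c⁻¹ * ρ) ^ (n - a)) * (|B n| * (ρ ^ (n + 1))⁻¹) := by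
      gcongr
      · exact (hcoeff n hn).trans (by gcongr)
      · exact (hBq n hn0 q hq t ht x).trans (by gcongr; exact le_abs_self _)
    _ = A * (|B n| * c⁻¹ ^ (n - a) * (ρ ^ (n - a) * (ρ ^ (n + 1))⁻¹)) := by rw [mul_pow]; ring
    _ = _ := by rw [hsplit, mul_inv, mul_inv_cancel_left₀ (by positivity)]

end Interpolation

/-! ### The symbol of `L_ε` -/

/-- The polynomial `x ↦ ε⁻² Q(2π ε x)` for `Q` without constant and linear terms, written without
division so that it also covers `ε = 0`. -/
def symbolPoly (Q : ℝ[X]) (ε : ℝ) : ℝ[X] :=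
  C ((2 * Real.pi) ^ 2) * (Q.divX.divX.comp (C (2 * Real.pi * ε) * X) * X ^ 2)

lemma eval_symbolPoly (Q : ℝ[X]) (ε x : ℝ) :
    (symbolPoly Q ε).eval x = (2 * Real.pi * x) ^ 2 * Q.divX.divX.eval (2 * Real.pi * ε * x) := by
  simp only [symbolPoly, eval_mul, eval_C, eval_comp, eval_X, eval_pow]
  ring

lemma coeff_symbolPoly_of_lt (Q : ℝ[X]) (ε : ℝ) {j : ℕ} (hj : j < 2) :
    (symbolPoly Q ε).coeff j = 0 := by
  rw [symbolPoly, coeff_C_mul, coeff_mul_X_pow', if_neg hj.not_ge, mul_zero]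

lemma coeff_symbolPoly (Q : ℝ[X]) (ε : ℝ) (j : ℕ) :
    (symbolPoly Q ε).coeff (j + 2) =
      (2 * Real.pi) ^ 2 * (Q.coeff (j + 2) * (2 * Real.pi * ε) ^ j) := by
  rw [symbolPoly, coeff_C_mul, coeff_mul_X_pow, comp_C_mul_X_coeff, coeff_divX, coeff_divX]

lemma natDegree_symbolPoly_le (Q : ℝ[X]) (ε : ℝ) :
    (symbolPoly Q ε).natDegree ≤ Q.natDegree + 2 := by
  refine natDegree_le_iff_coeff_eq_zero.2 fun n hn => ?_
  obtain ⟨j, rfl⟩ : ∃ j, n = j + 2 := ⟨n - 2, by omega⟩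
  rw [coeff_symbolPoly, coeff_eq_zero_of_natDegree_lt (by omega), zero_mul, mul_zero]

lemma absEval_symbolPoly (Q : ℝ[X]) {ε : ℝ} (hε : 0 ≤ ε) (r : ℝ) :
    absEval (symbolPoly Q ε) r =
      (2 * Real.pi * r) ^ 2 * absEval Q.divX.divX (2 * Real.pi * ε * r) := by
  have habs : absPoly (symbolPoly Q ε) =
      C ((2 * Real.pi) ^ 2) * ((absPoly Q.divX.divX).comp (C (2 * Real.pi * ε) * X) * X ^ 2) := by
    ext n
    rw [coeff_absPoly, symbolPoly, coeff_C_mul, coeff_C_mul, coeff_mul_X_pow', coeff_mul_X_pow']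
    split_ifs
    · rw [comp_C_mul_X_coeff, comp_C_mul_X_coeff, coeff_absPoly, abs_mul, abs_mul,
        abs_of_pos (by positivity : 0 < (2 * Real.pi) ^ 2),
        abs_of_nonneg (by positivity : 0 ≤ (2 * Real.pi * ε) ^ (n - 2))]
    · rw [mul_zero, abs_zero]
  rw [absEval, habs, absEval]
  simp only [eval_mul, eval_C, eval_comp, eval_X, eval_pow]
  ring

lemma exists_absEval_le_mul_eval {S : ℝ[X]} (hS : ∀ r, 0 ≤ r → 0 < S.eval r) :
    ∃ M : ℝ, ∀ r, 0 ≤ r → absEval S r ≤ M * S.eval r := by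
  have hdeg : (absPoly S).degree ≤ S.degree := by
    rw [degree_le_iff_coeff_zero]
    intro m hm
    rw [coeff_absPoly, coeff_eq_zero_of_degree_lt hm, abs_zero]
  obtain ⟨C₁, hlarge⟩ := (Polynomial.isBigO_atTop_of_degree_le (absPoly S) S hdeg).bound
  obtain ⟨R, hR⟩ := eventually_atTop.1 hlarge
  obtain ⟨C₂, hsmall⟩ := (isCompact_Icc (a := (0 : ℝ)) (b := R)).exists_bound_of_continuousOn
    ((absPoly S).continuous.continuousOn.div S.continuous.continuousOn fun r hr => (hS r hr.1).ne')
  refine ⟨max C₁ C₂, fun r hr => ?_⟩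
  have hpos := hS r hr
  rcases le_total r R with hrR | hrR
  · have hratio := (le_abs_self _).trans (hsmall r ⟨hr, hrR⟩)
    exact ((div_le_iff₀ hpos).1 hratio).trans (by gcongr; exact le_max_right _ _)
  · have hratio := (le_abs_self _).trans (hR r hrR)
    rw [Real.norm_eq_abs, abs_of_pos hpos] at hratio
    exact hratio.trans (by gcongr; exact le_max_left _ _)

namespace IsAdmissible

variable {Q : ℝ[X]}

lemma coeff_odd (hQ : IsAdmissible Q) {n : ℕ} (hn : Odd n) : Q.coeff n = 0 := by
  have hcomp : Q.comp (C (-1) * X) = Q := Polynomial.funext fun r => by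
    simp [eval_comp, hQ.even]
  have hcoeff := congrArg (fun p => p.coeff n) hcomp
  simp only [comp_C_mul_X_coeff, hn.neg_one_pow] at hcoeff
  linarith

lemma eval_eq (hQ : IsAdmissible Q) (r : ℝ) :
    Q.eval r = r ^ 2 * Q.divX.divX.eval r := by
  have hdiv := divX_mul_X_add Q
  have hdiv' := divX_mul_X_add Q.divX
  rw [coeff_zero_eq_eval_zero, hQ.eval_zero, C_0, add_zero] at hdiv
  rw [coeff_divX, zero_add, hQ.coeff_odd odd_one, C_0, add_zero] at hdiv'
  conv_lhs => rw [← hdiv, ← hdiv']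
  simp only [eval_mul, eval_X]
  ring

lemma divX_pos (hQ : IsAdmissible Q) (r : ℝ) : 0 < Q.divX.divX.eval r := by
  rcases eq_or_ne r 0 with rfl | hr
  · rw [← coeff_zero_eq_eval_zero, coeff_divX, coeff_divX, hQ.coeff_two]
    exact one_pos
  · exact pos_of_mul_pos_right (hQ.eval_eq r ▸ hQ.pos r hr) (sq_nonneg r)

lemma divX_even (hQ : IsAdmissible Q) (r : ℝ) :
    Q.divX.divX.eval (-r) = Q.divX.divX.eval r := by
  rcases eq_or_ne r 0 with rfl | hr
  · rw [neg_zero]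
  · have heven := hQ.even r
    rw [hQ.eval_eq, hQ.eval_eq, neg_sq] at heven
    exact mul_left_cancel₀ (pow_ne_zero 2 hr) heven

lemma exists_isSymbol (hQ : IsAdmissible Q) :
    ∃ M : ℝ, 0 < M ∧ ∀ ε : ℝ, 0 ≤ ε → IsSymbol (Q.natDegree + 2) M (symbolPoly Q ε) := by
  obtain ⟨M, hM⟩ := exists_absEval_le_mul_eval fun r _ => hQ.divX_pos r
  refine ⟨max M 1, by positivity, fun ε hε =>
    ⟨by positivity, natDegree_symbolPoly_le Q ε, coeff_symbolPoly_of_lt Q ε zero_lt_two,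
      coeff_symbolPoly_of_lt Q ε one_lt_two, ?_, fun x => ?_⟩⟩
  · rw [coeff_symbolPoly Q ε 0, hQ.coeff_two]
    nlinarith [Real.pi_gt_three]
  · have heven : Q.divX.divX.eval (2 * Real.pi * ε * |x|) =
        Q.divX.divX.eval (2 * Real.pi * ε * x) := by
      rcases abs_choice x with habs | habs
      · rw [habs]
      · rw [habs, mul_neg, hQ.divX_even]
    have hpos := hQ.divX_pos (2 * Real.pi * ε * x)
    rw [absEval_symbolPoly Q hε, eval_symbolPoly, mul_pow, sq_abs, ← mul_pow]
    calc (2 * Real.pi * x) ^ 2 * absEval Q.divX.divX (2 * Real.pi * ε * |x|)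
        ≤ (2 * Real.pi * x) ^ 2 * (M * Q.divX.divX.eval (2 * Real.pi * ε * x)) := by
          gcongr; exact heven ▸ hM _ (by positivity)
      _ ≤ (2 * Real.pi * x) ^ 2 * (max M 1 * Q.divX.divX.eval (2 * Real.pi * ε * x)) := by
          gcongr; exact le_max_left _ _
      _ = _ := by ring

lemma symbolL_eq (hQ : IsAdmissible Q) (ε : ℝ) (k : ℤ) :
    symbolL Q ε k = (symbolPoly Q ε).eval (k : ℝ) := by
  rw [eval_symbolPoly, symbolL]
  split_ifs with hε
  · rw [hε, mul_zero, zero_mul, ← coeff_zero_eq_eval_zero, coeff_divX, coeff_divX, hQ.coeff_two,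
      mul_one]
  · rw [hQ.even, hQ.eval_eq]
    field_simp

lemma greenP_eq (hQ : IsAdmissible Q) (ε : ℝ) :
    greenP Q ε = reKernel (symbolPoly Q ε) 1 := by
  ext x
  simp only [greenP, reKernel, expSeries, eval_one, one_mul, hQ.symbolL_eq]

end IsAdmissible

lemma exists_abs_coeff_symbolPoly_le (Q : ℝ[X]) : ∃ A : ℝ, 0 ≤ A ∧ ∀ ε : ℝ, 0 ≤ ε → ∀ j : ℕ,
    |(symbolPoly Q ε).coeff (j + 2)| ≤ A * ε ^ j := by
  refine ⟨∑ j ∈ Finset.range (Q.natDegree + 1), (2 * Real.pi) ^ 2 *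
    (|Q.coeff (j + 2)| * (2 * Real.pi) ^ j), by positivity, fun ε hε j => ?_⟩
  rw [coeff_symbolPoly]
  rcases le_or_gt j Q.natDegree with hj | hj
  · calc |(2 * Real.pi) ^ 2 * (Q.coeff (j + 2) * (2 * Real.pi * ε) ^ j)|
        = (2 * Real.pi) ^ 2 * (|Q.coeff (j + 2)| * (2 * Real.pi) ^ j) * ε ^ j := by
          rw [abs_mul, abs_mul, abs_of_pos (by positivity : 0 < (2 * Real.pi) ^ 2),
            abs_of_nonneg (by positivity : 0 ≤ (2 * Real.pi * ε) ^ j), mul_pow _ ε]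
          ring
      _ ≤ _ := by
          gcongr
          exact Finset.single_le_sum (f := fun j => (2 * Real.pi) ^ 2 *
            (|Q.coeff (j + 2)| * (2 * Real.pi) ^ j)) (fun j _ => by positivity)
            (Finset.mem_range.2 (Nat.lt_succ_of_le hj))
  · rw [coeff_eq_zero_of_natDegree_lt (by omega), zero_mul, mul_zero, abs_zero]
    positivity

/-! ### Bounds on the Green's function -/

lemma expSeries_C_mul (q : ℝ[X]) (c : ℂ) (p : ℂ[X]) (t : ℝ) (x : UnitAddCircle) :
    expSeries q (C c * p) t x = c * expSeries q p t x := by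
  simp only [expSeries, eval_mul, eval_C, mul_assoc, tsum_mul_left]

lemma spaceFactor_pow (l : ℕ) :
    spaceFactor ^ l = C ((2 * Real.pi * Complex.I) ^ l) * X ^ l := by
  rw [spaceFactor, mul_pow, C_pow]

lemma norm_coeff_timeFactor (q : ℝ[X]) (n : ℕ) : ‖(timeFactor q).coeff n‖ = |q.coeff n| := by
  simp [timeFactor]

lemma natDegree_timeFactor_le (q : ℝ[X]) : (timeFactor q).natDegree ≤ q.natDegree := by
  rw [timeFactor, natDegree_neg]; exact natDegree_map_le

lemma parSize_of_pos {x : SpaceTime} (hx : 0 < x.1) : parSize x = √x.1 + ‖x.2‖ := by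
  rw [parSize, abs_of_pos hx]

lemma exists_norm_expSeries_spaceFactor_pow_le (d : ℕ) {M : ℝ} (hM : 0 < M) {l : ℕ} (hl : l ≠ 0) :
    ∃ B : ℝ, 0 ≤ B ∧ ∀ q, IsSymbol d M q → ∀ (t : ℝ) (x : UnitAddCircle), 0 < t →
      ‖expSeries q (spaceFactor ^ l) t x‖ ≤ B * ((√t + ‖x‖) ^ (l + 1))⁻¹ := by
  obtain ⟨B, hB, hBq⟩ := exists_norm_expSeries_le d hM hl
  refine ⟨‖(2 * Real.pi * Complex.I : ℂ) ^ l‖ * B, by positivity, fun q hq t x ht => ?_⟩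
  rw [spaceFactor_pow, expSeries_C_mul, norm_mul, mul_assoc ‖_‖]
  gcongr
  exact hBq q hq t ht x

lemma exists_norm_expSeries_timeFactor_mul_le (d : ℕ) {M : ℝ} (hM : 0 < M) {c : ℝ} (hc : 0 < c)
    (D l : ℕ) {a : ℕ} (ha : a ≠ 0) :
    ∃ B : ℝ, 0 ≤ B ∧ ∀ q, IsSymbol d M q → ∀ (ε A : ℝ) (r : ℝ[X]), 0 ≤ ε → 0 ≤ A →
      r.natDegree ≤ D → (∀ n < a, r.coeff n = 0) → (∀ n, |r.coeff (n + a)| ≤ A * ε ^ n) →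
      ∀ (t : ℝ) (x : UnitAddCircle), 0 < t → c * ε ≤ √t + ‖x‖ →
        ‖expSeries q (timeFactor r * spaceFactor ^ l) t x‖ ≤
          A * (B * ((√t + ‖x‖) ^ (a + l + 1))⁻¹) := by
  obtain ⟨B, hB, hBq⟩ := exists_norm_expSeries_le_of_coeff d hM hc (D + l + 1)
    (a := a + l) (by omega)
  refine ⟨‖(2 * Real.pi * Complex.I : ℂ) ^ l‖ * B, by positivity,
    fun q hq ε A r hε hA hD hlow hcoeff t x ht hsize => ?_⟩
  have hdeg : (timeFactor r * X ^ l).natDegree < D + l + 1 := by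
    have hmul := natDegree_mul_le (p := timeFactor r) (q := X ^ l)
    have htime := natDegree_timeFactor_le r
    rw [natDegree_X_pow] at hmul
    omega
  rw [spaceFactor_pow, mul_left_comm, expSeries_C_mul, norm_mul, mul_assoc ‖_‖ B,
    mul_left_comm A]
  gcongr
  refine hBq q hq ε A _ hε hA hdeg (fun n hn => ?_) (fun n hn => ?_) t x ht hsize
  · rw [coeff_mul_X_pow', ← norm_eq_zero]
    split_ifs
    · rw [norm_coeff_timeFactor, hlow _ (by omega), abs_zero]
    · exact norm_zero
  · obtain ⟨n, rfl⟩ : ∃ j, n = j + a + l := ⟨n - (a + l), by omega⟩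
    rw [coeff_mul_X_pow, norm_coeff_timeFactor, add_assoc, Nat.add_sub_cancel]
    exact hcoeff n

section SymbolDifference

variable (Q : ℝ[X])

lemma coeff_symbolPoly_sub_of_lt (ε : ℝ) {n : ℕ} (hn : n < 3) :
    (symbolPoly Q ε - symbolPoly Q 0).coeff n = 0 := by
  rw [coeff_sub]
  rcases lt_or_ge n 2 with hn2 | hn2
  · rw [coeff_symbolPoly_of_lt Q _ hn2, coeff_symbolPoly_of_lt Q _ hn2, sub_self]
  · rw [show n = 0 + 2 by omega, coeff_symbolPoly, coeff_symbolPoly, pow_zero, pow_zero, sub_self]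

lemma coeff_symbolPoly_sub (ε : ℝ) (n : ℕ) :
    (symbolPoly Q ε - symbolPoly Q 0).coeff (n + 3) = (symbolPoly Q ε).coeff (n + 3) := by
  rw [coeff_sub, coeff_symbolPoly Q 0 (n + 1), mul_zero, zero_pow n.succ_ne_zero, mul_zero,
    mul_zero, sub_zero]

lemma natDegree_symbolPoly_sub_le (ε : ℝ) :
    (symbolPoly Q ε - symbolPoly Q 0).natDegree ≤ Q.natDegree + 2 :=
  (natDegree_sub_le_of_le (natDegree_symbolPoly_le Q ε) (natDegree_symbolPoly_le Q 0)).trans_eq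
    (max_self _)

end SymbolDifference

lemma inv_sq_le_rpow_mul_rpow {ρ ε δ : ℝ} (hρ : 0 < ρ) (hρε : ρ ≤ ε) (hδ : 0 ≤ δ) :
    (ρ ^ 2)⁻¹ ≤ ε ^ δ * ρ ^ (-2 - δ) := by
  calc (ρ ^ 2)⁻¹ = ρ ^ δ * ρ ^ (-2 - δ) := by
        rw [← Real.rpow_add hρ, show δ + (-2 - δ) = -((2 : ℕ) : ℝ) by push_cast; ring,
          Real.rpow_neg hρ.le, Real.rpow_natCast]
    _ ≤ ε ^ δ * ρ ^ (-2 - δ) := by gcongr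

lemma mul_inv_cube_le_rpow_mul_rpow {ρ ε δ : ℝ} (hρ : 0 < ρ) (hε : 0 ≤ ε) (hερ : ε ≤ ρ)
    (hδ : δ ≤ 1) : ε * (ρ ^ 3)⁻¹ ≤ ε ^ δ * ρ ^ (-2 - δ) := by
  rcases hε.eq_or_lt with rfl | hε
  · rw [zero_mul]; positivity
  calc ε * (ρ ^ 3)⁻¹ = ε ^ δ * (ε ^ (1 - δ) * (ρ ^ 3)⁻¹) := by
        rw [← mul_assoc, ← Real.rpow_add hε, add_sub_cancel, Real.rpow_one]
    _ ≤ ε ^ δ * (ρ ^ (1 - δ) * (ρ ^ 3)⁻¹) := by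
        have := sub_nonneg.2 hδ
        gcongr
    _ = ε ^ δ * ρ ^ (-2 - δ) := by
        rw [← Real.rpow_natCast, ← Real.rpow_neg hρ.le, ← Real.rpow_add hρ]
        congr 2
        push_cast
        ring

namespace IsAdmissible

variable {Q : ℝ[X]}

lemma mixedDeriv_greenP (hQ : IsAdmissible Q) {ε : ℝ} (hε : 0 ≤ ε) (m l : ℕ) {x : SpaceTime}
    (hx : x ≠ 0) : mixedDeriv m l (greenP Q ε) x =
      reKernel (symbolPoly Q ε) (timeFactor (symbolPoly Q ε) ^ m * spaceFactor ^ l) x := by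
  obtain ⟨M, -, hsymbol⟩ := hQ.exists_isSymbol
  rw [hQ.greenP_eq, mixedDeriv_reKernel (hsymbol ε hε) 1 m l x hx, mul_one]

lemma greenP_bound (hQ : IsAdmissible Q) : ∃ C : ℝ, ∀ ε ∈ Set.Icc (0 : ℝ) 1,
    ∀ x : SpaceTime, x ≠ 0 → |greenP Q ε x| ≤ C * (1 + (parSize x)⁻¹) := by
  obtain ⟨M, hM, hsymbol⟩ := hQ.exists_isSymbol
  obtain ⟨B, hB, hBq⟩ := exists_norm_expSeries_one_le (Q.natDegree + 2) hM
  refine ⟨B, fun ε hε x hx => ?_⟩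
  have hsize := parSize_pos hx
  rw [hQ.greenP_eq]
  refine abs_reKernel_le _ _ _ (by positivity) fun hx0 => ?_
  rw [parSize_of_pos hx0]
  exact hBq _ (hsymbol ε hε.1) _ hx0 _

lemma derivBound_space (hQ : IsAdmissible Q) {l : ℕ} (hl : l ≠ 0) :
    DerivBound (greenP Q) 0 l 0 := by
  obtain ⟨M, hM, hsymbol⟩ := hQ.exists_isSymbol
  obtain ⟨B, hB, hBq⟩ := exists_norm_expSeries_spaceFactor_pow_le (Q.natDegree + 2) hM hl
  refine ⟨B, fun ε hε x hx _ => ?_⟩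
  have hsize := parSize_pos hx
  rw [hQ.mixedDeriv_greenP hε.1 0 l hx, pow_zero, one_mul, mul_zero, zero_add]
  refine abs_reKernel_le _ _ _ (by positivity) fun hx0 => ?_
  rw [parSize_of_pos hx0]
  exact hBq _ (hsymbol ε hε.1) _ _ hx0

lemma derivBound_time (hQ : IsAdmissible Q) (l : ℕ) {c : ℝ} (hc : 0 < c) :
    DerivBound (greenP Q) 1 l c := by
  obtain ⟨M, hM, hsymbol⟩ := hQ.exists_isSymbol
  obtain ⟨A, hA, hcoeff⟩ := exists_abs_coeff_symbolPoly_le Q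
  obtain ⟨B, hB, hBq⟩ := exists_norm_expSeries_timeFactor_mul_le (Q.natDegree + 2) hM hc
    (Q.natDegree + 2) l two_ne_zero
  refine ⟨A * B, fun ε hε x hx hxc => ?_⟩
  have hsize := parSize_pos hx
  rw [hQ.mixedDeriv_greenP hε.1 1 l hx, pow_one]
  refine abs_reKernel_le _ _ _ (by positivity) fun hx0 => ?_
  rw [parSize_of_pos hx0] at hxc ⊢
  rw [mul_assoc A]
  exact hBq _ (hsymbol ε hε.1) ε _ _ hε.1 hA (natDegree_symbolPoly_le Q ε)
    (fun n hn => coeff_symbolPoly_of_lt Q ε hn) (hcoeff ε hε.1) _ _ hx0 hxc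

lemma exists_norm_expSeries_symbolPoly_sub_le (hQ : IsAdmissible Q) :
    ∃ B : ℝ, 0 ≤ B ∧ ∀ ε, 0 ≤ ε → ∀ (t : ℝ) (x : UnitAddCircle), 0 < t → ε ≤ √t + ‖x‖ →
      ‖expSeries (symbolPoly Q ε) spaceFactor t x - expSeries (symbolPoly Q 0) spaceFactor t x‖ ≤
        B * (ε * ((√t + ‖x‖) ^ 3)⁻¹) := by
  obtain ⟨M, hM, hsymbol⟩ := hQ.exists_isSymbol
  obtain ⟨A, hA, hcoeff⟩ := exists_abs_coeff_symbolPoly_le Q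
  obtain ⟨B, hB, hBq⟩ := exists_norm_expSeries_timeFactor_mul_le (Q.natDegree + 2) hM one_pos
    (Q.natDegree + 2) 1 three_ne_zero
  refine ⟨2 * A * B, by positivity, fun ε hε t x ht hsize => ?_⟩
  have hpos : 0 < √t + ‖x‖ := by positivity
  have ht_le : t ≤ (√t + ‖x‖) ^ 2 := by
    nlinarith [Real.sq_sqrt ht.le, Real.sqrt_nonneg t, norm_nonneg x]
  have hdiff := norm_expSeries_sub_le (hsymbol 0 le_rfl) (hsymbol ε hε) spaceFactor ht x
    (B := A * ε * (B * ((√t + ‖x‖) ^ 5)⁻¹)) fun q hq => by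
      rw [← pow_one spaceFactor]
      refine hBq q hq ε _ _ hε (by positivity) (natDegree_symbolPoly_sub_le Q ε)
        (fun n hn => coeff_symbolPoly_sub_of_lt Q ε hn) (fun n => ?_) t x ht (by rwa [one_mul])
      rw [coeff_symbolPoly_sub, mul_assoc, ← pow_succ']
      exact hcoeff ε hε (n + 1)
  set ρ := √t + ‖x‖
  calc _ ≤ 2 * (t * (A * ε * (B * (ρ ^ 5)⁻¹))) := hdiff
    _ ≤ 2 * (ρ ^ 2 * (A * ε * (B * (ρ ^ 5)⁻¹))) := by gcongr
    _ = 2 * A * B * (ε * (ρ ^ 3)⁻¹) := by field_simp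

lemma exists_abs_mixedDeriv_greenP_sub_le (hQ : IsAdmissible Q) :
    ∃ B : ℝ, 0 ≤ B ∧ ∀ ε, 0 ≤ ε → ∀ x : SpaceTime, x ≠ 0 → ε ≤ parSize x →
      |mixedDeriv 0 1 (greenP Q ε) x - mixedDeriv 0 1 (greenP Q 0) x| ≤
        B * (ε * (parSize x ^ 3)⁻¹) := by
  obtain ⟨B, hB, hBε⟩ := hQ.exists_norm_expSeries_symbolPoly_sub_le
  refine ⟨B, hB, fun ε hε x hx hsize => ?_⟩
  have hpos := parSize_pos hx
  rw [hQ.mixedDeriv_greenP hε 0 1 hx, hQ.mixedDeriv_greenP le_rfl 0 1 hx, pow_zero, one_mul,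
    pow_zero, one_mul, pow_one]
  rcases le_or_gt x.1 0 with hx0 | hx0
  · rw [reKernel, reKernel, if_neg hx0.not_gt, if_neg hx0.not_gt, sub_self, abs_zero]
    positivity
  rw [reKernel, reKernel, if_pos hx0, if_pos hx0, ← Complex.sub_re]
  rw [parSize_of_pos hx0] at hsize ⊢
  exact (Complex.abs_re_le_norm _).trans (hBε ε hε _ _ hx0 hsize)

lemma comparisonBound (hQ : IsAdmissible Q) {δ : ℝ} (hδ : δ ∈ Set.Icc (0 : ℝ) 1) :
    ComparisonBound (greenP Q) δ := by
  obtain ⟨B, hB, hfar⟩ := hQ.exists_abs_mixedDeriv_greenP_sub_le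
  obtain ⟨C, hC⟩ := hQ.derivBound_space one_ne_zero
  refine ⟨|C| + |C| + B, fun ε hε x hx => ?_⟩
  have hpos := parSize_pos hx
  have hε0 := hε.1
  rcases lt_or_ge (parSize x) ε with hlt | hge
  · have hnear : ∀ ε' ∈ Set.Icc (0 : ℝ) 1, |mixedDeriv 0 1 (greenP Q ε') x| ≤
        |C| * (ε ^ δ * parSize x ^ (-2 - δ)) := fun ε' hε' =>
      calc |mixedDeriv 0 1 (greenP Q ε') x| ≤ C * (parSize x ^ 2)⁻¹ :=
            hC ε' hε' x hx (by rw [zero_mul]; exact hpos.le)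
        _ ≤ |C| * (ε ^ δ * parSize x ^ (-2 - δ)) := by
            gcongr
            exacts [le_abs_self C, inv_sq_le_rpow_mul_rpow hpos hlt.le hδ.1]
    calc _ ≤ _ := abs_sub _ _
      _ ≤ _ := add_le_add (hnear ε hε) (hnear 0 ⟨le_rfl, zero_le_one⟩)
      _ = (|C| + |C|) * (ε ^ δ * parSize x ^ (-2 - δ)) := (add_mul _ _ _).symm
      _ ≤ (|C| + |C| + B) * (ε ^ δ * parSize x ^ (-2 - δ)) :=
          mul_le_mul_of_nonneg_right (le_add_of_nonneg_right hB) (by positivity)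
  · calc _ ≤ B * (ε * (parSize x ^ 3)⁻¹) := hfar ε hε0 x hx hge
      _ ≤ (|C| + |C| + B) * (ε ^ δ * parSize x ^ (-2 - δ)) :=
          mul_le_mul (le_add_of_nonneg_left (by positivity))
            (mul_inv_cube_le_rpow_mul_rpow hpos hε0 hge hδ.2) (by positivity) (by positivity)

end IsAdmissible

/-! ### The increment bound -/

lemma norm_coe_le_abs (s : ℝ) : ‖(s : UnitAddCircle)‖ ≤ |s| := by
  rw [UnitAddCircle.norm_eq]
  simpa only [Int.cast_zero, sub_zero] using round_le s 0

lemma ne_zero_of_le_parSize {b : ℝ} (hb : 0 < b) {z : SpaceTime} (hz : b ≤ parSize z) :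
    z ≠ 0 := by
  rintro rfl
  refine hb.not_ge (hz.trans_eq ?_)
  simp [parSize]

lemma parSize_le_time_add (z : SpaceTime) (s : ℝ) :
    parSize z ≤ parSize ((s, z.2) : SpaceTime) + √|s - z.1| := by
  have htri := parSize_add_le ((s, z.2) : SpaceTime) (z.1 - s, 0)
  have hsum : ((s, z.2) : SpaceTime) + (z.1 - s, 0) = z := by ext <;> simp
  rw [hsum] at htri
  rwa [abs_sub_comm, ← add_zero √|z.1 - s|, ← norm_zero (E := UnitAddCircle)]

lemma parSize_le_space_add (z : SpaceTime) (s : ℝ) :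
    parSize z ≤ parSize ((z.1, z.2 + (s : UnitAddCircle)) : SpaceTime) + |s| := by
  have htri := parSize_add_le ((z.1, z.2 + (s : UnitAddCircle)) : SpaceTime)
    (0, -(s : UnitAddCircle))
  have hsum : ((z.1, z.2 + (s : UnitAddCircle)) : SpaceTime) + (0, -(s : UnitAddCircle)) = z := by
    ext <;> simp
  rw [hsum] at htri
  refine htri.trans (add_le_add_right ?_ _)
  rw [parSize, abs_zero, Real.sqrt_zero, norm_neg, zero_add]
  exact norm_coe_le_abs s

namespace IsSmoothOffOrigin

variable {f : SpaceTime → ℝ}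

lemma contDiffAt_time (hf : IsSmoothOffOrigin f) {x : SpaceTime} (hx : x ≠ 0) :
    ContDiffAt ℝ ∞ (fun s => f (s, x.2)) x.1 := by
  obtain ⟨t, y⟩ := x
  obtain ⟨r, rfl, -⟩ := exists_coe_eq_and_abs_eq_norm y
  have hslice : ContDiffAt ℝ ∞ (spaceLift f ∘ fun s => (s, r)) t :=
    (hf.contDiffAt (isOpen_offOrigin.mem_nhds hx)).comp t (contDiffAt_id.prodMk contDiffAt_const)
  exact hslice

lemma hasDerivAt_space (hf : IsSmoothOffOrigin f) {t s : ℝ} {y : UnitAddCircle}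
    (hx : ((t, y + (s : UnitAddCircle)) : SpaceTime) ≠ 0) :
    HasDerivAt (fun u : ℝ => f (t, y + (u : UnitAddCircle)))
      (spaceDeriv f (t, y + (s : UnitAddCircle))) s := by
  obtain ⟨r, rfl, -⟩ := exists_coe_eq_and_abs_eq_norm y
  have hdiff : DifferentiableAt ℝ (spaceLift f) (t, r + s) :=
    (hf.contDiffAt (isOpen_offOrigin.mem_nhds (by
      rwa [← AddCircle.coe_add] at hx))).differentiableAt (by simp)
  have hslice : DifferentiableAt ℝ (spaceLift f ∘ fun u : ℝ => (t, r + u)) s :=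
    hdiff.comp s ((differentiableAt_const t).prodMk (differentiableAt_id.const_add r))
  convert! hslice.hasDerivAt using 1
  rw [← add_zero s, ← deriv_comp_const_add]
  simp only [spaceDeriv, spaceLift, Function.comp_apply, AddCircle.coe_add, add_zero, add_assoc]

lemma abs_sub_le_of_timeDeriv_le (hf : IsSmoothOffOrigin f) {z : SpaceTime} {h b B : ℝ}
    (hb : 0 < b) (hh : √|h| ≤ parSize z - b)
    (hB : ∀ w : SpaceTime, w ≠ 0 → b ≤ parSize w → |timeDeriv f w| ≤ B) :
    |f (z.1 + h, z.2) - f z| ≤ B * |h| := by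
  have hsize : ∀ s ∈ Set.uIcc z.1 (z.1 + h), b ≤ parSize ((s, z.2) : SpaceTime) := by
    intro s hs
    have hsh : |s - z.1| ≤ |h| := by
      simpa only [add_sub_cancel_left] using Set.abs_sub_left_of_mem_uIcc hs
    linarith [parSize_le_time_add z s, Real.sqrt_le_sqrt hsh]
  have hne s hs := ne_zero_of_le_parSize hb (hsize s hs)
  simpa only [Real.norm_eq_abs, add_sub_cancel_left] using
    (convex_uIcc z.1 (z.1 + h)).norm_image_sub_le_of_norm_deriv_le (f := fun s => f (s, z.2))
      (fun s hs => (hf.contDiffAt_time (hne s hs)).differentiableAt (by simp))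
      (fun s hs => hB (s, z.2) (hne s hs) (hsize s hs)) Set.left_mem_uIcc Set.right_mem_uIcc

lemma abs_sub_le_of_spaceDeriv_le (hf : IsSmoothOffOrigin f) {z : SpaceTime} {r b B : ℝ}
    (hb : 0 < b) (hr : |r| ≤ parSize z - b)
    (hB : ∀ w : SpaceTime, w ≠ 0 → b ≤ parSize w → |spaceDeriv f w| ≤ B) :
    |f (z.1, z.2 + (r : UnitAddCircle)) - f z| ≤ B * |r| := by
  have hsize : ∀ s ∈ Set.uIcc 0 r,
      b ≤ parSize ((z.1, z.2 + (s : UnitAddCircle)) : SpaceTime) := by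
    intro s hs
    have hsr : |s| ≤ |r| := by simpa only [sub_zero] using Set.abs_sub_left_of_mem_uIcc hs
    linarith [parSize_le_space_add z s]
  have hne s hs := ne_zero_of_le_parSize hb (hsize s hs)
  simpa only [Real.norm_eq_abs, sub_zero, AddCircle.coe_zero, add_zero] using
    (convex_uIcc 0 r).norm_image_sub_le_of_norm_hasDerivWithin_le
      (fun s hs => (hf.hasDerivAt_space (hne s hs)).hasDerivWithinAt)
      (fun s hs => hB _ (hne s hs) (hsize s hs)) Set.left_mem_uIcc Set.right_mem_uIcc

end IsSmoothOffOrigin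

section Increment

variable {G : ℝ → SpaceTime → ℝ}

lemma DerivBound.exists_nonneg {m l : ℕ} {c : ℝ} (h : DerivBound G m l c) :
    ∃ C : ℝ, 0 ≤ C ∧ ∀ ε ∈ Set.Icc (0 : ℝ) 1, ∀ x : SpaceTime, x ≠ 0 → c * ε ≤ parSize x →
      |mixedDeriv m l (G ε) x| ≤ C * (parSize x ^ (2 * m + l + 1))⁻¹ := by
  obtain ⟨C, hC⟩ := h
  refine ⟨|C|, abs_nonneg C, fun ε hε x hx hxc => (hC ε hε x hx hxc).trans ?_⟩
  have hsize := parSize_pos hx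
  gcongr
  exact le_abs_self C

/-- Away from the singularity, `-y` is joined to `x - y` by a segment in time followed by one in
space. -/
lemma exists_abs_increment_le (hspace : DerivBound G 0 2 0) (htime : DerivBound G 1 1 (1 / 2))
    (hsmooth : ∀ ε ∈ Set.Icc (0 : ℝ) 1, IsSmoothOffOrigin (mixedDeriv 0 1 (G ε))) :
    ∃ C : ℝ, 0 ≤ C ∧ ∀ ε ∈ Set.Icc (0 : ℝ) 1, ∀ x y : SpaceTime, y ≠ 0 → ε ≤ parSize y →
      parSize x ≤ parSize y / 2 →
      |mixedDeriv 0 1 (G ε) (x - y) - mixedDeriv 0 1 (G ε) (-y)| ≤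
        C * (parSize x * (parSize y ^ 3)⁻¹) := by
  obtain ⟨C₂, hC₂, hspace⟩ := hspace.exists_nonneg
  obtain ⟨C₃, hC₃, htime⟩ := htime.exists_nonneg
  refine ⟨8 * C₂ + 16 * C₃, by positivity, fun ε hε x y hy hεy hxy => ?_⟩
  set f := mixedDeriv 0 1 (G ε)
  set b := parSize y / 2 with hb_def
  have hb : 0 < b := half_pos (parSize_pos hy)
  obtain ⟨r, hrx, hr, -⟩ := exists_coe_eq_and_abs_eq_norm x.2
  have hx : parSize x = √|x.1| + |r| := by rw [hr]; rfl
  have hxt := Real.sqrt_nonneg |x.1|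
  set z : SpaceTime := ((-y).1 + x.1, (-y).2)
  have hzr : ((z.1, z.2 + (r : UnitAddCircle)) : SpaceTime) = x - y := by
    rw [hrx]; exact Prod.ext (neg_add_eq_sub _ _) (neg_add_eq_sub _ _)
  have hz : parSize y ≤ parSize z + √|x.1| := by
    simpa only [parSize_neg, add_sub_cancel_left] using parSize_le_time_add (-y) ((-y).1 + x.1)
  have htime_le : |f z - f (-y)| ≤ C₃ * (b ^ 4)⁻¹ * |x.1| :=
    (hsmooth ε hε).abs_sub_le_of_timeDeriv_le hb
      (by rw [parSize_neg]; linarith [abs_nonneg r]) fun w hw hbw =>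
        (htime ε hε w hw (by linarith)).trans (by gcongr)
  have hspace_le : |f (x - y) - f z| ≤ C₂ * (b ^ 3)⁻¹ * |r| := by
    rw [← hzr]
    exact (hsmooth ε hε).abs_sub_le_of_spaceDeriv_le hb
      (by linarith) fun w hw hbw =>
        (hspace ε hε w hw (by rw [zero_mul]; exact hb.le.trans hbw)).trans (by gcongr)
  have hx_time : |x.1| ≤ parSize x * parSize y := by
    rw [← Real.mul_self_sqrt (abs_nonneg x.1)]
    gcongr <;> linarith [abs_nonneg r]
  calc |f (x - y) - f (-y)| ≤ |f (x - y) - f z| + |f z - f (-y)| := abs_sub_le _ _ _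
    _ ≤ C₂ * (b ^ 3)⁻¹ * |r| + C₃ * (b ^ 4)⁻¹ * |x.1| := add_le_add hspace_le htime_le
    _ ≤ C₂ * (b ^ 3)⁻¹ * parSize x + C₃ * (b ^ 4)⁻¹ * (parSize x * parSize y) := by
        gcongr; linarith
    _ = (8 * C₂ + 16 * C₃) * (parSize x * (parSize y ^ 3)⁻¹) := by
        have := parSize_pos hy
        rw [hb_def]; field_simp; ring

lemma exists_abs_increment_le_add (h : DerivBound G 0 1 0) :
    ∃ C : ℝ, 0 ≤ C ∧ ∀ ε ∈ Set.Icc (0 : ℝ) 1, ∀ x y : SpaceTime, y ≠ 0 → x ≠ y →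
      |mixedDeriv 0 1 (G ε) (x - y) - mixedDeriv 0 1 (G ε) (-y)| ≤
        C * ((parSize (x - y) ^ 2)⁻¹ + (parSize y ^ 2)⁻¹) := by
  obtain ⟨C, hC, hbound⟩ := h.exists_nonneg
  refine ⟨C, hC, fun ε hε x y hy hxy => ?_⟩
  have hderiv : ∀ z : SpaceTime, z ≠ 0 → |mixedDeriv 0 1 (G ε) z| ≤ C * (parSize z ^ 2)⁻¹ :=
    fun z hz => hbound ε hε z hz (by rw [zero_mul]; exact parSize_nonneg z)
  rw [mul_add, ← parSize_neg y]
  exact (abs_sub _ _).trans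
    (add_le_add (hderiv _ (sub_ne_zero.2 hxy)) (hderiv _ (neg_ne_zero.2 hy)))

lemma inv_sq_add_inv_sq_le_incrementRHS {δ : ℝ} (hδ : δ ∈ Set.Icc (0 : ℝ) 1) (ε : ℝ)
    {x y : SpaceTime} (hy : y ≠ 0) (hxy : x ≠ y)
    (hfar : ¬(ε ≤ parSize y ∧ parSize x < parSize y / 2)) :
    (parSize (x - y) ^ 2)⁻¹ + (parSize y ^ 2)⁻¹ ≤ 10 * incrementRHS δ ε x y := by
  have hy0 := parSize_pos hy
  have hxy0 := parSize_pos (sub_ne_zero.2 hxy)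
  have htri : parSize x ≤ parSize (x - y) + parSize y := by
    simpa only [sub_add_cancel] using parSize_add_le (x - y) y
  have hcompare : ∀ {u v : ℝ}, 0 < u → u / 2 ≤ v → (v ^ 2)⁻¹ ≤ 4 * (u ^ 2)⁻¹ := by
    intro u v hu huv
    calc (v ^ 2)⁻¹ ≤ ((u / 2) ^ 2)⁻¹ := by gcongr
      _ = 4 * (u ^ 2)⁻¹ := by field_simp; norm_num
  rw [incrementRHS]
  split_ifs with hfar_x hnear hsmall
  · linarith [hcompare hy0 (show parSize y / 2 ≤ parSize (x - y) by linarith),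
      inv_nonneg.2 (sq_nonneg (parSize y))]
  · linarith [hcompare hxy0 (show parSize (x - y) / 2 ≤ parSize y by linarith),
      inv_nonneg.2 (sq_nonneg (parSize (x - y)))]
  · linarith [hcompare hy0 (not_le.1 hnear).le, inv_nonneg.2 (sq_nonneg (parSize y))]
  · have hx : parSize y / 2 ≤ parSize x := by
      by_contra! h
      exact hfar ⟨not_lt.1 hsmall, h⟩
    have hrpow : (parSize y ^ 2)⁻¹ ≤ 2 * (parSize x ^ δ * parSize y ^ (-2 - δ)) := by
      calc (parSize y ^ 2)⁻¹ = 2 * (parSize y / 2 * (parSize y ^ 3)⁻¹) := by field_simp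
        _ ≤ 2 * ((parSize y / 2) ^ δ * parSize y ^ (-2 - δ)) := by
          gcongr 2 * ?_
          exact mul_inv_cube_le_rpow_mul_rpow hy0 (by positivity) (by linarith) hδ.2
        _ ≤ _ := by gcongr; exact hδ.1
    linarith [hcompare hy0 (not_le.1 hnear).le]

lemma incrementBound_of_derivBound {δ : ℝ} (hδ : δ ∈ Set.Icc (0 : ℝ) 1)
    (hspace₁ : DerivBound G 0 1 0) (hspace₂ : DerivBound G 0 2 0)
    (htime : DerivBound G 1 1 (1 / 2))
    (hsmooth : ∀ ε ∈ Set.Icc (0 : ℝ) 1, IsSmoothOffOrigin (mixedDeriv 0 1 (G ε))) :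
    IncrementBound G δ := by
  obtain ⟨A, hA, hcrude⟩ := exists_abs_increment_le_add hspace₁
  obtain ⟨B, hB, hfine⟩ := exists_abs_increment_le hspace₂ htime hsmooth
  refine ⟨A * 10 + B, fun ε hε x y hy hxy => ?_⟩
  have hRHS : 0 ≤ incrementRHS δ ε x y := by
    have := parSize_nonneg x
    have := parSize_nonneg y
    have := parSize_nonneg (x - y)
    rw [incrementRHS]; split_ifs <;> positivity
  by_cases hfar : ε ≤ parSize y ∧ parSize x < parSize y / 2
  · have hx0 := parSize_nonneg x
    have htri := parSize_add_le (x - y) (-x)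
    rw [sub_add_eq_add_sub, add_neg_cancel, zero_sub, parSize_neg, parSize_neg] at htri
    have hRHS_eq : incrementRHS δ ε x y = parSize x ^ δ * parSize y ^ (-2 - δ) := by
      rw [incrementRHS, if_neg (by linarith), if_neg (by linarith), if_neg hfar.1.not_gt]
    calc _ ≤ B * (parSize x * (parSize y ^ 3)⁻¹) := hfine ε hε x y hy hfar.1 hfar.2.le
      _ ≤ B * incrementRHS δ ε x y := by
          rw [hRHS_eq]
          exact mul_le_mul_of_nonneg_left
            (mul_inv_cube_le_rpow_mul_rpow (parSize_pos hy) hx0 (by linarith) hδ.2) hB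
      _ ≤ (A * 10 + B) * incrementRHS δ ε x y :=
          mul_le_mul_of_nonneg_right (le_add_of_nonneg_left (by positivity)) hRHS
  · calc _ ≤ A * ((parSize (x - y) ^ 2)⁻¹ + (parSize y ^ 2)⁻¹) := hcrude ε hε x y hy hxy
      _ ≤ A * (10 * incrementRHS δ ε x y) := by
          gcongr; exact inv_sq_add_inv_sq_le_incrementRHS hδ ε hy hxy hfar
      _ = A * 10 * incrementRHS δ ε x y := (mul_assoc _ _ _).symm
      _ ≤ (A * 10 + B) * incrementRHS δ ε x y :=
          mul_le_mul_of_nonneg_right (le_add_of_nonneg_right hB) hRHS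

end Increment

namespace IsAdmissible

variable {Q : ℝ[X]} {ε : ℝ}

lemma isSmoothOffOrigin_mixedDeriv (hQ : IsAdmissible Q) (hε : 0 ≤ ε) (m l : ℕ) :
    IsSmoothOffOrigin (mixedDeriv m l (greenP Q ε)) := by
  obtain ⟨M, -, hsymbol⟩ := hQ.exists_isSymbol
  exact (isSmoothOffOrigin_reKernel (hsymbol ε hε) _).congr
    fun z hz => hQ.mixedDeriv_greenP hε m l hz

lemma isSmoothOffOrigin (hQ : IsAdmissible Q) (hε : 0 ≤ ε) : IsSmoothOffOrigin (greenP Q ε) :=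
  hQ.isSmoothOffOrigin_mixedDeriv hε 0 0

lemma incrementBound (hQ : IsAdmissible Q) {δ : ℝ} (hδ : δ ∈ Set.Icc (0 : ℝ) 1) :
    IncrementBound (greenP Q) δ :=
  incrementBound_of_derivBound hδ (hQ.derivBound_space one_ne_zero)
    (hQ.derivBound_space two_ne_zero) (hQ.derivBound_time 1 one_half_pos)
    fun _ hε => hQ.isSmoothOffOrigin_mixedDeriv hε.1 0 1

end IsAdmissible

lemma isNonAnticipative_greenP (Q : ℝ[X]) (ε : ℝ) : IsNonAnticipative (greenP Q ε) :=
  fun _ hx => if_neg hx.not_gt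

lemma isSpaceSymmetric_greenP (Q : ℝ[X]) (ε : ℝ) : IsSpaceSymmetric (greenP Q ε) := by
  intro t y
  simp only [greenP]
  split_ifs
  · rw [← Complex.conj_re, Complex.conj_tsum]
    congr 2
    ext k
    rw [map_mul, Complex.conj_ofReal, ← fourier_neg, fourier_apply, fourier_apply, smul_neg,
      neg_smul, neg_neg]
  · rfl

/-! ### The cutoff in time -/

/-- A smooth function of time that vanishes before time `1/2` and equals `1` after time `3/4`. -/
def lateCutoff (t : ℝ) : ℝ := Real.smoothTransition (4 * t - 2)

lemma lateCutoff_of_le {t : ℝ} (ht : t ≤ 1 / 2) : lateCutoff t = 0 :=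
  Real.smoothTransition.zero_of_nonpos (by linarith)

lemma lateCutoff_of_ge {t : ℝ} (ht : 3 / 4 ≤ t) : lateCutoff t = 1 :=
  Real.smoothTransition.one_of_one_le (by linarith)

lemma contDiff_lateCutoff : ContDiff ℝ ∞ lateCutoff :=
  Real.smoothTransition.contDiff.comp ((contDiff_const.mul contDiff_id).sub contDiff_const)

lemma abs_one_sub_lateCutoff_le (t : ℝ) : |1 - lateCutoff t| ≤ 1 := by
  have hnonneg : 0 ≤ lateCutoff t := Real.smoothTransition.nonneg _
  have hle : lateCutoff t ≤ 1 := Real.smoothTransition.le_one _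
  rw [abs_le]
  constructor <;> linarith

lemma lateCutoff_eventuallyEq_const_of_notMem {t : ℝ} (ht : t ∉ Set.Icc (1 / 2 : ℝ) (3 / 4)) :
    ∃ c : ℝ, |c| ≤ 1 ∧ lateCutoff =ᶠ[𝓝 t] fun _ => c := by
  rcases lt_or_ge t (1 / 2) with hlt | hge
  · refine ⟨0, by rw [abs_zero]; exact zero_le_one, ?_⟩
    filter_upwards [gt_mem_nhds hlt] with s hs using lateCutoff_of_le hs.le
  · refine ⟨1, abs_one.le, ?_⟩
    filter_upwards [lt_mem_nhds (not_le.1 fun h => ht ⟨hge, h⟩)] with s hs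
      using lateCutoff_of_ge hs.le

lemma deriv_lateCutoff_of_notMem {t : ℝ} (ht : t ∉ Set.Icc (1 / 2 : ℝ) (3 / 4)) :
    deriv lateCutoff t = 0 := by
  obtain ⟨c, -, hc⟩ := lateCutoff_eventuallyEq_const_of_notMem ht
  rw [hc.deriv_eq, deriv_const]

lemma exists_abs_iteratedDeriv_lateCutoff_le (j : ℕ) :
    ∃ B : ℝ, 0 ≤ B ∧ ∀ t, |iteratedDeriv j lateCutoff t| ≤ B := by
  obtain ⟨B, hB⟩ := (isCompact_Icc (a := (1 / 2 : ℝ)) (b := 3 / 4)).exists_bound_of_continuousOn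
    (contDiff_lateCutoff.continuous_iteratedDeriv j (by exact_mod_cast le_top)).continuousOn
  refine ⟨max B 1, by positivity, fun t => ?_⟩
  by_cases ht : t ∈ Set.Icc (1 / 2 : ℝ) (3 / 4)
  · exact (hB t ht).trans (le_max_left _ _)
  · obtain ⟨c, hc, hconst⟩ := lateCutoff_eventuallyEq_const_of_notMem ht
    refine le_trans ?_ (le_max_right _ _)
    rw [hconst.iteratedDeriv_eq, iteratedDeriv_const]
    split_ifs
    · exact hc
    · rw [abs_zero]; exact zero_le_one

/-! ### Products with functions of time -/

lemma iterate_timeDeriv_eq (f : SpaceTime → ℝ) (m : ℕ) (x : SpaceTime) :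
    timeDeriv^[m] f x = iteratedDeriv m (fun s => f (s, x.2)) x.1 := by
  obtain ⟨t, y⟩ := x
  induction m generalizing t with
  | zero => simp
  | succ m ih =>
    rw [Function.iterate_succ_apply', iteratedDeriv_succ, timeDeriv]
    simp only [ih]

lemma mixedDeriv_zero_time_mul (η : ℝ → ℝ) (f : SpaceTime → ℝ) (l : ℕ) :
    mixedDeriv 0 l (fun x => η x.1 * f x) = fun x => η x.1 * mixedDeriv 0 l f x := by
  simp only [mixedDeriv, Function.iterate_zero, id]
  induction l with
  | zero => rfl
  | succ l ih =>
    rw [Function.iterate_succ_apply', ih, Function.iterate_succ_apply']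
    ext x
    simp only [spaceDeriv, deriv_const_mul_field']

lemma mixedDeriv_time_mul {η : ℝ → ℝ} (hη : ContDiff ℝ ∞ η) {f : SpaceTime → ℝ} {l : ℕ}
    (hf : IsSmoothOffOrigin (mixedDeriv 0 l f)) (m : ℕ) {x : SpaceTime} (hx : x ≠ 0) :
    mixedDeriv m l (fun x => η x.1 * f x) x = ∑ i ∈ Finset.range (m + 1),
      m.choose i * iteratedDeriv i η x.1 * mixedDeriv (m - i) l f x := by
  have hiterate : ∀ (n : ℕ) (g : SpaceTime → ℝ), mixedDeriv n l g x =
      iteratedDeriv n (fun s => mixedDeriv 0 l g (s, x.2)) x.1 :=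
    fun n g => iterate_timeDeriv_eq _ n x
  have hm : (m : WithTop ℕ∞) ≤ ∞ := by exact_mod_cast le_top
  simp only [hiterate, mixedDeriv_zero_time_mul]
  exact iteratedDeriv_fun_mul (hη.contDiffAt.of_le hm) ((hf.contDiffAt_time hx).of_le hm)

lemma IsSmoothOffOrigin.time_mul {η : ℝ → ℝ} (hη : ContDiff ℝ ∞ η) {f : SpaceTime → ℝ}
    (hf : IsSmoothOffOrigin f) : IsSmoothOffOrigin fun x => η x.1 * f x :=
  ContDiffOn.mul (f := fun z : ℝ × ℝ => η z.1) (hη.comp contDiff_fst).contDiffOn hf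

/-! ### Late times -/

lemma exists_norm_expSeries_late_le (d : ℕ) {M : ℝ} (hM : 0 < M) {t₀ : ℝ} (ht₀ : 0 < t₀) (m : ℕ)
    (p : ℂ[X]) :
    ∃ B : ℝ, 0 ≤ B ∧ ∀ q, IsSymbol d M q → ∀ t : ℝ, t₀ ≤ t → ∀ x : UnitAddCircle,
      ‖expSeries q (timeFactor q ^ m * p) t x‖ ≤ B := by
  obtain ⟨B, hB, hpow⟩ := exists_pow_mul_exp_neg_le m (half_pos ht₀)
  have hsum := (summable_norm_eval_mul_exp p (c := t₀ / 2 / M) (by positivity)).mul_left B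
  refine ⟨_, tsum_nonneg fun k => by positivity, fun q hq t ht x =>
    tsum_of_norm_bounded hsum.hasSum fun k => ?_⟩
  have hq0 := hq.eval_nonneg (k : ℝ)
  have hgauss := hq.exp_neg_mul_le (half_pos ht₀).le le_rfl (k : ℝ)
  have hsplit : Real.exp (-(q.eval (k : ℝ) * t)) ≤
      Real.exp (-(t₀ / 2 * q.eval (k : ℝ))) * Real.exp (-(q.eval (k : ℝ) * (t₀ / 2))) := by
    rw [← Real.exp_add]
    refine Real.exp_le_exp.2 ?_
    nlinarith
  rw [norm_mul, norm_fourier_apply, mul_one, norm_mul, eval_mul, norm_mul, eval_pow, norm_pow,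
    eval_timeFactor, norm_neg, Complex.norm_real, Complex.norm_real, Real.norm_eq_abs,
    Real.norm_eq_abs, Real.abs_exp, abs_of_nonneg hq0]
  calc q.eval (k : ℝ) ^ m * ‖p.eval (k : ℂ)‖ * Real.exp (-(q.eval (k : ℝ) * t))
      ≤ q.eval (k : ℝ) ^ m * ‖p.eval (k : ℂ)‖ * (Real.exp (-(t₀ / 2 * q.eval (k : ℝ))) *
          Real.exp (-(t₀ / 2 / M * (k : ℝ) ^ 2))) := by
        gcongr
        exact hsplit.trans (mul_le_mul_of_nonneg_left hgauss (Real.exp_pos _).le)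
    _ = q.eval (k : ℝ) ^ m * Real.exp (-(t₀ / 2 * q.eval (k : ℝ))) *
          (‖p.eval (k : ℂ)‖ * Real.exp (-(t₀ / 2 / M * (k : ℝ) ^ 2))) := by ring
    _ ≤ B * (‖p.eval (k : ℂ)‖ * Real.exp (-(t₀ / 2 / M * (k : ℝ) ^ 2))) := by
        gcongr
        exact hpow _ hq0

/-! ### The decomposition of the Green's function -/

/-- The singular part of the Green's function, the function `K_ε` of the theorem. -/
def singularPart (Q : ℝ[X]) (ε : ℝ) : SpaceTime → ℝ :=
  fun x => (1 - lateCutoff x.1) * greenP Q ε x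

/-- The smooth part of the Green's function, the function `R_ε` of the theorem. -/
def smoothPart (Q : ℝ[X]) (ε : ℝ) : SpaceTime → ℝ := fun x => lateCutoff x.1 * greenP Q ε x

lemma tsupport_singularPart_subset (Q : ℝ[X]) (ε : ℝ) :
    tsupport (singularPart Q ε) ⊆ Set.Icc (0 : ℝ) 1 ×ˢ Set.univ := by
  refine closure_minimal (fun x hx => ?_) (isClosed_Icc.prod isClosed_univ)
  refine ⟨⟨?_, ?_⟩, Set.mem_univ _⟩ <;> by_contra! hx1
  · exact hx (by rw [singularPart, isNonAnticipative_greenP Q ε x hx1, mul_zero])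
  · exact hx (by rw [singularPart, lateCutoff_of_ge (by linarith), sub_self, zero_mul])

lemma contDiff_one_sub_lateCutoff : ContDiff ℝ ∞ fun t => 1 - lateCutoff t :=
  contDiff_const.sub contDiff_lateCutoff

lemma mixedDeriv_zero_singularPart (Q : ℝ[X]) (ε : ℝ) (l : ℕ) :
    mixedDeriv 0 l (singularPart Q ε) =
      fun x => (1 - lateCutoff x.1) * mixedDeriv 0 l (greenP Q ε) x :=
  mixedDeriv_zero_time_mul (fun t => 1 - lateCutoff t) (greenP Q ε) l

lemma mixedDeriv_smoothPart_of_lt (Q : ℝ[X]) (ε : ℝ) (m l : ℕ) {x : SpaceTime}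
    (hx : x.1 < 1 / 2) : mixedDeriv m l (smoothPart Q ε) x = 0 := by
  have hzero : (fun s => spaceDeriv^[l] (smoothPart Q ε) (s, x.2)) =ᶠ[𝓝 x.1] fun _ => 0 := by
    filter_upwards [gt_mem_nhds hx] with s hs
    rw [← zero_mul (spaceDeriv^[l] (greenP Q ε) (s, x.2)), ← lateCutoff_of_le hs.le]
    exact congrFun (mixedDeriv_zero_time_mul lateCutoff (greenP Q ε) l) (s, x.2)
  rw [mixedDeriv, iterate_timeDeriv_eq, hzero.iteratedDeriv_eq, iteratedDeriv_const, ite_self]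

lemma parSize_le_three_halves {x : SpaceTime} (hx : |x.1| ≤ 1) : parSize x ≤ 3 / 2 := by
  have hspace := AddCircle.norm_le_half_period (x := x.2) (1 : ℝ) one_ne_zero
  have htime : √|x.1| ≤ 1 := Real.sqrt_le_one.2 hx
  rw [abs_one] at hspace
  rw [parSize]
  linarith

lemma inv_pow_le_sq_mul_inv_pow_add_two {ρ a : ℝ} (hρ : 0 < ρ) (hρa : ρ ≤ a) (n : ℕ) :
    (ρ ^ n)⁻¹ ≤ a ^ 2 * (ρ ^ (n + 2))⁻¹ :=
  calc (ρ ^ n)⁻¹ = ρ ^ 2 * (ρ ^ (n + 2))⁻¹ := by rw [pow_add]; field_simp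
    _ ≤ a ^ 2 * (ρ ^ (n + 2))⁻¹ := by gcongr

namespace IsAdmissible

variable {Q : ℝ[X]}

lemma isSmoothOffOrigin_singularPart (hQ : IsAdmissible Q) {ε : ℝ} (hε : 0 ≤ ε) :
    IsSmoothOffOrigin (singularPart Q ε) :=
  (hQ.isSmoothOffOrigin hε).time_mul contDiff_one_sub_lateCutoff

lemma isSmooth_smoothPart (hQ : IsAdmissible Q) {ε : ℝ} (hε : 0 ≤ ε) :
    IsSmooth (smoothPart Q ε) := by
  refine contDiff_iff_contDiffAt.2 fun z => ?_
  rcases lt_or_ge z.1 (1 / 2) with hlt | hge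
  · refine (contDiffAt_const (c := (0 : ℝ))).congr_of_eventuallyEq ?_
    filter_upwards [(isOpen_lt continuous_fst continuous_const).mem_nhds hlt] with w hw
    rw [spaceLift, smoothPart, lateCutoff_of_le (le_of_lt hw), zero_mul]
  · refine ContDiffOn.contDiffAt ((hQ.isSmoothOffOrigin hε).time_mul contDiff_lateCutoff)
      (isOpen_offOrigin.mem_nhds fun hz => ?_)
    have hz1 : z.1 = 0 := congrArg Prod.fst hz
    linarith

lemma exists_abs_mixedDeriv_greenP_late_le (hQ : IsAdmissible Q) (m l : ℕ) :
    ∃ B : ℝ, 0 ≤ B ∧ ∀ ε, 0 ≤ ε → ∀ x : SpaceTime, 1 / 2 ≤ x.1 →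
      |mixedDeriv m l (greenP Q ε) x| ≤ B := by
  obtain ⟨M, hM, hsymbol⟩ := hQ.exists_isSymbol
  obtain ⟨B, hB, hseries⟩ :=
    exists_norm_expSeries_late_le (Q.natDegree + 2) hM one_half_pos m (spaceFactor ^ l)
  refine ⟨B, hB, fun ε hε x hx => ?_⟩
  have hx0 : x ≠ 0 := by rintro rfl; norm_num at hx
  rw [hQ.mixedDeriv_greenP hε m l hx0]
  exact abs_reKernel_le _ _ _ hB fun _ => hseries _ (hsymbol ε hε) _ hx _

lemma exists_abs_mixedDeriv_smoothPart_le (hQ : IsAdmissible Q) (m l : ℕ) :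
    ∃ C : ℝ, ∀ ε ∈ Set.Icc (0 : ℝ) 1, ∀ x : SpaceTime,
      |mixedDeriv m l (smoothPart Q ε) x| ≤ C := by
  choose A hA hcutoff using exists_abs_iteratedDeriv_lateCutoff_le
  choose B hB hgreen using fun j => hQ.exists_abs_mixedDeriv_greenP_late_le j l
  refine ⟨∑ i ∈ Finset.range (m + 1), m.choose i * A i * B (m - i), fun ε hε x => ?_⟩
  rcases lt_or_ge x.1 (1 / 2) with hlt | hge
  · rw [mixedDeriv_smoothPart_of_lt Q ε m l hlt, abs_zero]
    exact Finset.sum_nonneg fun i _ =>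
      mul_nonneg (mul_nonneg (Nat.cast_nonneg _) (hA i)) (hB _)
  have hx0 : x ≠ 0 := by rintro rfl; norm_num at hge
  calc |mixedDeriv m l (smoothPart Q ε) x|
      = |∑ i ∈ Finset.range (m + 1), m.choose i * iteratedDeriv i lateCutoff x.1 *
          mixedDeriv (m - i) l (greenP Q ε) x| := congrArg abs <|
        mixedDeriv_time_mul contDiff_lateCutoff (hQ.isSmoothOffOrigin_mixedDeriv hε.1 0 l) m hx0
    _ ≤ ∑ i ∈ Finset.range (m + 1), m.choose i * A i * B (m - i) := by
        refine (Finset.abs_sum_le_sum_abs _ _).trans (Finset.sum_le_sum fun i _ => ?_)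
        have := hA i
        rw [abs_mul, abs_mul, Nat.abs_cast]
        gcongr
        exacts [hcutoff i _, hgreen _ ε hε.1 x hge]

lemma exists_abs_mixedDeriv_greenP_early_le (hQ : IsAdmissible Q) (l : ℕ) :
    ∃ C : ℝ, 0 ≤ C ∧ ∀ ε ∈ Set.Icc (0 : ℝ) 1, ∀ x : SpaceTime, x ≠ 0 → x.1 ≤ 1 →
      |mixedDeriv 0 l (greenP Q ε) x| ≤ C * (parSize x ^ (l + 1))⁻¹ := by
  rcases eq_or_ne l 0 with rfl | hl
  · obtain ⟨C, hC⟩ := hQ.greenP_bound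
    refine ⟨|C| * (5 / 2), by positivity, fun ε hε x hx hx1 => ?_⟩
    have hsize := parSize_pos hx
    rcases le_or_gt x.1 0 with hx0 | hx0
    · have hzero : mixedDeriv 0 0 (greenP Q ε) x = 0 := if_neg hx0.not_gt
      rw [hzero, abs_zero]
      positivity
    have hle : 1 + (parSize x)⁻¹ ≤ 5 / 2 * (parSize x)⁻¹ := by
      have := parSize_le_three_halves (by rwa [abs_of_pos hx0] : |x.1| ≤ 1)
      field_simp
      linarith
    calc |mixedDeriv 0 0 (greenP Q ε) x| ≤ C * (1 + (parSize x)⁻¹) := hC ε hε x hx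
      _ ≤ |C| * (5 / 2 * (parSize x)⁻¹) :=
          mul_le_mul (le_abs_self C) hle (by positivity) (abs_nonneg C)
      _ = |C| * (5 / 2) * (parSize x ^ (0 + 1))⁻¹ := by rw [zero_add, pow_one, mul_assoc]
  · obtain ⟨C, hC, hderiv⟩ := (hQ.derivBound_space hl).exists_nonneg
    refine ⟨C, hC, fun ε hε x hx _ => (hderiv ε hε x hx ?_).trans_eq ?_⟩
    · rw [zero_mul]; exact parSize_nonneg x
    · rw [mul_zero, zero_add]

lemma derivBound_space_singularPart (hQ : IsAdmissible Q) (l : ℕ) :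
    DerivBound (singularPart Q) 0 l 0 := by
  obtain ⟨C, hC, hearly⟩ := hQ.exists_abs_mixedDeriv_greenP_early_le l
  refine ⟨C, fun ε hε x hx _ => ?_⟩
  have hsize := parSize_pos hx
  rw [mixedDeriv_zero_singularPart, abs_mul, mul_zero, zero_add]
  rcases le_or_gt x.1 1 with hx1 | hx1
  · exact (mul_le_of_le_one_left (abs_nonneg _) (abs_one_sub_lateCutoff_le _)).trans
      (hearly ε hε x hx hx1)
  · rw [lateCutoff_of_ge (by linarith), sub_self, abs_zero, zero_mul]
    positivity

lemma exists_abs_deriv_lateCutoff_mul_le (hQ : IsAdmissible Q) (l : ℕ) :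
    ∃ C : ℝ, ∀ ε ∈ Set.Icc (0 : ℝ) 1, ∀ x : SpaceTime, x ≠ 0 →
      |deriv lateCutoff x.1 * mixedDeriv 0 l (greenP Q ε) x| ≤
        C * (parSize x ^ (l + 1 + 2))⁻¹ := by
  obtain ⟨A, hA, hearly⟩ := hQ.exists_abs_mixedDeriv_greenP_early_le l
  obtain ⟨B, hB, hcutoff⟩ := exists_abs_iteratedDeriv_lateCutoff_le 1
  rw [iteratedDeriv_one] at hcutoff
  refine ⟨B * (A * (3 / 2) ^ 2), fun ε hε x hx => ?_⟩
  have hsize := parSize_pos hx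
  by_cases hx1 : x.1 ∈ Set.Icc (1 / 2 : ℝ) (3 / 4)
  · have hle : parSize x ≤ 3 / 2 := parSize_le_three_halves
      (abs_le.2 ⟨by linarith [hx1.1], by linarith [hx1.2]⟩)
    rw [abs_mul, mul_assoc B, mul_assoc A]
    calc _ ≤ B * (A * (parSize x ^ (l + 1))⁻¹) := by
          gcongr
          exacts [hcutoff _, hearly ε hε x hx (by linarith [hx1.2])]
      _ ≤ B * (A * ((3 / 2) ^ 2 * (parSize x ^ (l + 1 + 2))⁻¹)) := by
          gcongr
          exact inv_pow_le_sq_mul_inv_pow_add_two hsize hle (l + 1)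
  · rw [deriv_lateCutoff_of_notMem hx1, zero_mul, abs_zero]
    positivity

lemma derivBound_time_singularPart (hQ : IsAdmissible Q) (l : ℕ) {c : ℝ} (hc : 0 < c) :
    DerivBound (singularPart Q) 1 l c := by
  obtain ⟨A, hA⟩ := hQ.exists_abs_deriv_lateCutoff_mul_le l
  obtain ⟨B, hB⟩ := hQ.derivBound_time l hc
  refine ⟨A + B, fun ε hε x hx hxc => ?_⟩
  have hleibniz : mixedDeriv 1 l (singularPart Q ε) x =
      (1 - lateCutoff x.1) * mixedDeriv 1 l (greenP Q ε) x -
        deriv lateCutoff x.1 * mixedDeriv 0 l (greenP Q ε) x := by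
    refine (mixedDeriv_time_mul contDiff_one_sub_lateCutoff
      (hQ.isSmoothOffOrigin_mixedDeriv hε.1 0 l) 1 hx).trans ?_
    simp [Finset.sum_range_succ, sub_eq_add_neg]
  rw [hleibniz, show 2 * 1 + l + 1 = l + 1 + 2 by ring, add_comm A, add_mul]
  refine (abs_sub _ _).trans (add_le_add ?_ (hA ε hε x hx))
  rw [abs_mul, show l + 1 + 2 = 2 * 1 + l + 1 by ring]
  exact (mul_le_of_le_one_left (abs_nonneg _) (abs_one_sub_lateCutoff_le _)).trans
    (hB ε hε x hx hxc)

lemma comparisonBound_singularPart (hQ : IsAdmissible Q) {δ : ℝ}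
    (hδ : δ ∈ Set.Icc (0 : ℝ) 1) : ComparisonBound (singularPart Q) δ := by
  obtain ⟨C, hC⟩ := hQ.comparisonBound hδ
  refine ⟨C, fun ε hε x hx => ?_⟩
  rw [mixedDeriv_zero_singularPart, mixedDeriv_zero_singularPart, ← mul_sub, abs_mul]
  exact (mul_le_of_le_one_left (abs_nonneg _) (abs_one_sub_lateCutoff_le _)).trans (hC ε hε x hx)

lemma incrementBound_singularPart (hQ : IsAdmissible Q) {δ : ℝ} (hδ : δ ∈ Set.Icc (0 : ℝ) 1) :
    IncrementBound (singularPart Q) δ := by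
  refine incrementBound_of_derivBound hδ (hQ.derivBound_space_singularPart 1)
    (hQ.derivBound_space_singularPart 2) (hQ.derivBound_time_singularPart 1 one_half_pos)
    fun ε hε => ?_
  rw [mixedDeriv_zero_singularPart]
  exact (hQ.isSmoothOffOrigin_mixedDeriv hε.1 0 1).time_mul contDiff_one_sub_lateCutoff

end IsAdmissible

/-! ### Smooth functions on space-time -/

lemma exists_abs_le_of_continuous {f : SpaceTime → ℝ} (hf : Continuous f) (a b : ℝ) :
    ∃ B : ℝ, ∀ x : SpaceTime, x.1 ∈ Set.Icc a b → |f x| ≤ B := by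
  obtain ⟨B, hB⟩ := (isCompact_Icc.prod isCompact_univ).exists_bound_of_continuousOn
    (hf.continuousOn (s := Set.Icc a b ×ˢ Set.univ))
  exact ⟨B, fun x hx => hB x ⟨hx, Set.mem_univ _⟩⟩

lemma mixedDeriv_zero_succ (l : ℕ) (f : SpaceTime → ℝ) :
    mixedDeriv 0 (l + 1) f = spaceDeriv (mixedDeriv 0 l f) :=
  Function.iterate_succ_apply' spaceDeriv l f

namespace IsSmooth

variable {f : SpaceTime → ℝ}

lemma continuous (hf : IsSmooth f) : Continuous f :=
  isOpenQuotientMap_spaceProj.continuous_comp_iff.1 (ContDiff.continuous hf)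

lemma hasDerivAt_time_fderiv (hf : IsSmooth f) (t r : ℝ) :
    HasDerivAt (fun s => f (s, (r : UnitAddCircle))) (fderiv ℝ (spaceLift f) (t, r) (1, 0)) t :=
  HasFDerivAt.comp_hasDerivAt (l := spaceLift f) (f := fun s => (s, r)) t
    (ContDiff.differentiable hf (by simp) (t, r)).hasFDerivAt
    ((hasDerivAt_id t).prodMk (hasDerivAt_const t r))

lemma hasDerivAt_space_fderiv (hf : IsSmooth f) (t r : ℝ) :
    HasDerivAt (fun s : ℝ => f (t, (s : UnitAddCircle)))
      (fderiv ℝ (spaceLift f) (t, r) (0, 1)) r :=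
  HasFDerivAt.comp_hasDerivAt (l := spaceLift f) (f := fun s => (t, s)) r
    (ContDiff.differentiable hf (by simp) (t, r)).hasFDerivAt
    ((hasDerivAt_const r t).prodMk (hasDerivAt_id r))

lemma spaceLift_timeDeriv (hf : IsSmooth f) :
    spaceLift (_root_.timeDeriv f) = fun z => fderiv ℝ (spaceLift f) z (1, 0) :=
  funext fun z => (hf.hasDerivAt_time_fderiv z.1 z.2).deriv

lemma spaceLift_spaceDeriv (hf : IsSmooth f) :
    spaceLift (_root_.spaceDeriv f) = fun z => fderiv ℝ (spaceLift f) z (0, 1) := by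
  ext ⟨t, r⟩
  have hshift := HasDerivAt.comp_const_add r 0
    (f := fun s : ℝ => f (t, (s : UnitAddCircle))) (by
      rw [add_zero]; exact hf.hasDerivAt_space_fderiv t r)
  simp only [AddCircle.coe_add] at hshift
  exact hshift.deriv

lemma hasDerivAt_time (hf : IsSmooth f) (t : ℝ) (y : UnitAddCircle) :
    HasDerivAt (fun s => f (s, y)) (_root_.timeDeriv f (t, y)) t := by
  obtain ⟨r, rfl, -⟩ := exists_coe_eq_and_abs_eq_norm y
  exact (hf.hasDerivAt_time_fderiv t r).congr_deriv
    (congrFun hf.spaceLift_timeDeriv (t, r)).symm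

lemma hasDerivAt_space (hf : IsSmooth f) (t r : ℝ) :
    HasDerivAt (fun s : ℝ => f (t, (s : UnitAddCircle)))
      (_root_.spaceDeriv f (t, (r : UnitAddCircle))) r :=
  (hf.hasDerivAt_space_fderiv t r).congr_deriv (congrFun hf.spaceLift_spaceDeriv (t, r)).symm

lemma timeDeriv (hf : IsSmooth f) : IsSmooth (_root_.timeDeriv f) := by
  rw [IsSmooth, hf.spaceLift_timeDeriv]
  exact (ContDiff.fderiv_right (m := ∞) hf (by simp)).clm_apply contDiff_const

lemma spaceDeriv (hf : IsSmooth f) : IsSmooth (_root_.spaceDeriv f) := by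
  rw [IsSmooth, hf.spaceLift_spaceDeriv]
  exact (ContDiff.fderiv_right (m := ∞) hf (by simp)).clm_apply contDiff_const

lemma mixedDeriv_zero (hf : IsSmooth f) (l : ℕ) : IsSmooth (mixedDeriv 0 l f) := by
  induction l with
  | zero => exact hf
  | succ l ih =>
    rw [mixedDeriv_zero_succ]
    exact ih.spaceDeriv

end IsSmooth

/-- `f` is supported in the time strip `[-T, T] × 𝕋`. -/
def TimeSupported (T : ℝ) (f : SpaceTime → ℝ) : Prop := ∀ x : SpaceTime, T < |x.1| → f x = 0

namespace TimeSupported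

variable {T : ℝ} {f : SpaceTime → ℝ}

lemma timeDeriv (hf : TimeSupported T f) : TimeSupported T (_root_.timeDeriv f) := by
  intro x hx
  have hzero : (fun s => f (s, x.2)) =ᶠ[𝓝 x.1] fun _ => 0 := by
    filter_upwards [(isOpen_lt continuous_const continuous_abs).mem_nhds hx] with s hs
    exact hf (s, x.2) hs
  rw [_root_.timeDeriv, hzero.deriv_eq, deriv_const]

lemma spaceDeriv (hf : TimeSupported T f) : TimeSupported T (_root_.spaceDeriv f) := by
  intro x hx
  have hzero : (fun s : ℝ => f (x.1, x.2 + (s : UnitAddCircle))) = fun _ => 0 :=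
    funext fun s => hf (x.1, x.2 + (s : UnitAddCircle)) hx
  rw [_root_.spaceDeriv, hzero, deriv_const]

lemma mixedDeriv_zero (hf : TimeSupported T f) (l : ℕ) : TimeSupported T (mixedDeriv 0 l f) := by
  induction l with
  | zero => exact hf
  | succ l ih =>
    rw [mixedDeriv_zero_succ]
    exact ih.spaceDeriv

end TimeSupported

lemma exists_timeSupported {f : SpaceTime → ℝ} (hf : HasCompactSupport f) :
    ∃ T : ℝ, 0 < T ∧ TimeSupported T f := by
  obtain ⟨R, hR⟩ := hf.isCompact.isBounded.exists_norm_le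
  refine ⟨max R 1, by positivity, fun x hx => by_contra fun hfx => hx.not_ge ?_⟩
  exact (norm_fst_le x).trans ((hR x (subset_tsupport f hfx)).trans (le_max_left _ _))

/-! ### Spatial Fourier modes -/

/-- The spatial Fourier modes `∫ f(t, y) e^{2πiky} dy`. For later convenience `f` is paired with
the character `fourier k` itself, so this is the Fourier coefficient of `f(t, ·)` at `-k`. -/
def fourierMode (f : SpaceTime → ℝ) (k : ℤ) (t : ℝ) : ℂ :=
  ∫ y : UnitAddCircle, (f (t, y) : ℂ) * fourier k y

section FourierMode

variable {f g : SpaceTime → ℝ}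

lemma continuous_mul_fourier (hf : Continuous f) (k : ℤ) (t : ℝ) :
    Continuous fun y : UnitAddCircle => (f (t, y) : ℂ) * fourier k y :=
  (Complex.continuous_ofReal.comp (hf.comp (by fun_prop))).mul (fourier k).continuous

lemma integrable_mul_fourier (hf : Continuous f) (k : ℤ) (t : ℝ) :
    Integrable fun y : UnitAddCircle => (f (t, y) : ℂ) * fourier k y :=
  (continuous_mul_fourier hf k t).integrable_of_hasCompactSupport
    (HasCompactSupport.of_compactSpace _)

lemma norm_fourierMode_le {B t : ℝ} (hB : ∀ y, |f (t, y)| ≤ B) (k : ℤ) :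
    ‖fourierMode f k t‖ ≤ B := by
  have hbound := norm_integral_le_of_norm_le_const (μ := (volume : Measure UnitAddCircle))
    (f := fun y : UnitAddCircle => (f (t, y) : ℂ) * fourier k y) (C := B)
    (Eventually.of_forall fun y => by
      rw [norm_mul, norm_fourier_apply, mul_one, Complex.norm_real]
      exact hB y)
  rwa [measureReal_def, UnitAddCircle.measure_univ, ENNReal.toReal_one, mul_one] at hbound

lemma fourierMode_const_mul (c : ℝ) (f : SpaceTime → ℝ) (k : ℤ) (t : ℝ) :
    fourierMode (fun x => c * f x) k t = c * fourierMode f k t := by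
  simp only [fourierMode, Complex.ofReal_mul, mul_assoc, integral_const_mul]

lemma fourierMode_sum {ι : Type*} (s : Finset ι) {f : ι → SpaceTime → ℝ}
    (hf : ∀ i, Continuous (f i)) (k : ℤ) (t : ℝ) :
    fourierMode (fun x => ∑ i ∈ s, f i x) k t = ∑ i ∈ s, fourierMode (f i) k t := by
  simp only [fourierMode, Complex.ofReal_sum, Finset.sum_mul]
  exact integral_finsetSum _ fun i _ => integrable_mul_fourier (hf i) k t

lemma fourierMode_neg_sub (hf : Continuous f) (hg : Continuous g) (k : ℤ) (t : ℝ) :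
    fourierMode (fun x => -f x - g x) k t = -fourierMode f k t - fourierMode g k t := by
  simp only [fourierMode, Complex.ofReal_sub, Complex.ofReal_neg, sub_mul, neg_mul]
  rw [← integral_neg]
  exact integral_sub (integrable_mul_fourier hf k t).neg (integrable_mul_fourier hg k t)

lemma fourierMode_spaceDeriv (hf : IsSmooth f) (k : ℤ) (t : ℝ) :
    fourierMode (spaceDeriv f) k t = -(2 * Real.pi * Complex.I * k) * fourierMode f k t := by
  have hmk : Continuous fun r : ℝ => (r : UnitAddCircle) := AddCircle.continuous_mk' 1
  have hfourier : ∀ r ∈ Set.uIcc (0 : ℝ) 1,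
      HasDerivAt (fun r : ℝ => (fourier k (r : UnitAddCircle) : ℂ))
        (2 * Real.pi * Complex.I * k * fourier k (r : UnitAddCircle)) r := fun r _ => by
    simpa only [Complex.ofReal_one, div_one] using hasDerivAt_fourier 1 k r
  have hspace : ∀ r ∈ Set.uIcc (0 : ℝ) 1, HasDerivAt
      (fun r : ℝ => ((f (t, (r : UnitAddCircle)) : ℝ) : ℂ))
      ((spaceDeriv f (t, (r : UnitAddCircle)) : ℝ) : ℂ) r := fun r _ =>
    (hf.hasDerivAt_space t r).ofReal_comp
  have hspace_cont : Continuous fun r : ℝ => ((spaceDeriv f (t, (r : UnitAddCircle)) : ℝ) : ℂ) :=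
    Complex.continuous_ofReal.comp (hf.spaceDeriv.continuous.comp (continuous_const.prodMk hmk))
  have hfourier_cont : Continuous fun r : ℝ =>
      (2 * Real.pi * Complex.I * k * fourier k (r : UnitAddCircle) : ℂ) :=
    continuous_const.mul ((fourier k).continuous.comp hmk)
  have hparts := intervalIntegral.integral_mul_deriv_eq_deriv_mul hfourier hspace
    (hfourier_cont.intervalIntegrable _ _) (hspace_cont.intervalIntegrable _ _)
  rw [AddCircle.coe_period, AddCircle.coe_zero, sub_self, zero_sub] at hparts
  simp only [fourierMode, ← UnitAddCircle.intervalIntegral_preimage 0, zero_add,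
    mul_comm ((_ : ℝ) : ℂ) (fourier k _)]
  simpa only [mul_assoc, intervalIntegral.integral_const_mul, neg_mul] using hparts

lemma fourierMode_mixedDeriv_zero (hf : IsSmooth f) (k : ℤ) (t : ℝ) (l : ℕ) :
    fourierMode (mixedDeriv 0 l f) k t =
      (-(2 * Real.pi * Complex.I * k)) ^ l * fourierMode f k t := by
  induction l with
  | zero => rw [pow_zero, one_mul]; rfl
  | succ l ih =>
    rw [mixedDeriv_zero_succ, fourierMode_spaceDeriv (hf.mixedDeriv_zero l), ih, pow_succ']
    ring

lemma summable_fourierMode (hf : IsSmooth f) (t : ℝ) : Summable fun k => fourierMode f k t := by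
  obtain ⟨B, hB⟩ := exists_abs_le_of_continuous (hf.mixedDeriv_zero 2).continuous t t
  have hdecay : ∀ k : ℤ, (k : ℝ) ^ 2 * ‖fourierMode f k t‖ ≤ B := by
    intro k
    refine le_trans ?_ (norm_fourierMode_le (fun y => hB (t, y) (Set.left_mem_Icc.2 le_rfl)) k)
    rw [fourierMode_mixedDeriv_zero hf, norm_mul, norm_pow, norm_neg, norm_mul, norm_mul, norm_mul,
      Complex.norm_I, Complex.norm_intCast, Complex.norm_real, Complex.norm_ofNat, mul_one,
      Real.norm_of_nonneg Real.pi_pos.le, ← sq_abs]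
    gcongr
    exact le_mul_of_one_le_left (abs_nonneg _) (by linarith [Real.pi_gt_three])
  refine Summable.of_norm_bounded_eventually
    ((Real.summable_one_div_int_pow.2 one_lt_two).mul_left B) ?_
  filter_upwards [(Set.finite_singleton (0 : ℤ)).compl_mem_cofinite] with k hk
  have hk_pos : (0 : ℝ) < (k : ℝ) ^ 2 := sq_pos_of_ne_zero (Int.cast_ne_zero.2 hk)
  rw [mul_one_div, le_div_iff₀' hk_pos]
  exact hdecay k

lemma hasSum_fourierMode (hf : IsSmooth f) (t : ℝ) :
    HasSum (fun k => fourierMode f k t) (f (t, 0) : ℂ) := by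
  let F : C(UnitAddCircle, ℂ) := ⟨fun y => (f (t, y) : ℂ),
    Complex.continuous_ofReal.comp (hf.continuous.comp (by fun_prop))⟩
  have hcoeff : fourierCoeff (F : UnitAddCircle → ℂ) = fun k => fourierMode f (-k) t := by
    ext k
    rw [fourierCoeff, AddCircle.integral_haarAddCircle, inv_one, one_smul, fourierMode]
    exact integral_congr_ae (Eventually.of_forall fun y => mul_comm _ _)
  have hsummable : Summable (fourierCoeff (F : UnitAddCircle → ℂ)) := by
    rw [hcoeff]
    exact (Equiv.neg ℤ).summable_iff.2 (summable_fourierMode hf t)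
  have hseries := has_pointwise_sum_fourier_series_of_summable hsummable 0
  simp only [hcoeff, fourier_eval_zero, smul_eq_mul, mul_one] at hseries
  exact (Equiv.neg ℤ).hasSum_iff.1 hseries

lemma hasDerivAt_fourierMode (hf : IsSmooth f) (k : ℤ) (t : ℝ) :
    HasDerivAt (fourierMode f k) (fourierMode (timeDeriv f) k t) t := by
  obtain ⟨B, hB⟩ := exists_abs_le_of_continuous hf.timeDeriv.continuous (t - 1) (t + 1)
  refine (hasDerivAt_integral_of_dominated_loc_of_deriv_le (bound := fun _ => B)
    (F := fun t (y : UnitAddCircle) => (f (t, y) : ℂ) * fourier k y)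
    (F' := fun t (y : UnitAddCircle) => ((timeDeriv f (t, y) : ℝ) : ℂ) * fourier k y)
    (s := Set.Icc (t - 1) (t + 1)) (Icc_mem_nhds (by linarith) (by linarith))
    (Eventually.of_forall fun s =>
      (continuous_mul_fourier hf.continuous k s).aestronglyMeasurable)
    (integrable_mul_fourier hf.continuous k t)
    (continuous_mul_fourier hf.timeDeriv.continuous k t).aestronglyMeasurable
    (Eventually.of_forall fun y s hs => ?_) (integrable_const B)
    (Eventually.of_forall fun y s _ => ?_)).2
  · rw [norm_mul, norm_fourier_apply, mul_one, Complex.norm_real]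
    exact hB (s, y) hs
  · exact ((hf.hasDerivAt_time s y).ofReal_comp).mul_const _

end FourierMode

/-! ### The operator `L_ε` on Fourier modes -/

section opL

variable {Q : ℝ[X]} {f : SpaceTime → ℝ}

lemma opL_eq (Q : ℝ[X]) (ε : ℝ) (f : SpaceTime → ℝ) :
    opL Q ε f = if ε = 0 then mixedDeriv 0 2 f else fun x => -(ε ^ 2)⁻¹ *
      ∑ j ∈ Finset.range (Q.natDegree + 1),
        Q.coeff j * ((Complex.I * (ε : ℂ)) ^ j).re * mixedDeriv 0 j f x := by
  ext x
  rw [opL]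
  split_ifs <;> rfl

lemma IsSmooth.opL (hf : IsSmooth f) (Q : ℝ[X]) (ε : ℝ) : IsSmooth (opL Q ε f) := by
  rw [opL_eq]
  split_ifs
  · exact hf.mixedDeriv_zero 2
  · exact ContDiff.mul (f := fun _ : ℝ × ℝ => -(ε ^ 2)⁻¹) contDiff_const
      (ContDiff.sum (f := fun j (z : ℝ × ℝ) => Q.coeff j * ((Complex.I * (ε : ℂ)) ^ j).re *
        spaceLift (mixedDeriv 0 j f) z) fun j _ => contDiff_const.mul (hf.mixedDeriv_zero j))

lemma TimeSupported.opL {T : ℝ} (hf : TimeSupported T f) (Q : ℝ[X]) (ε : ℝ) :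
    TimeSupported T (opL Q ε f) := by
  intro x hx
  simp only [_root_.opL, hf.mixedDeriv_zero _ x hx, mul_zero, Finset.sum_const_zero, ite_self]

lemma re_I_mul_pow_mul_pow_of_even {j : ℕ} (hj : Even j) (ε a : ℝ) :
    (((Complex.I * (ε : ℂ)) ^ j).re : ℂ) * (-(a * Complex.I)) ^ j = ((ε * a) ^ j : ℝ) := by
  obtain ⟨i, rfl⟩ := even_iff_exists_two_mul.1 hj
  have hleft : (Complex.I * (ε : ℂ)) ^ (2 * i) = (((-1) ^ i * ε ^ (2 * i) : ℝ) : ℂ) := by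
    rw [mul_pow, pow_mul, Complex.I_sq]
    push_cast
    rfl
  have hright : (-(a * Complex.I) : ℂ) ^ (2 * i) = (((-1) ^ i * a ^ (2 * i) : ℝ) : ℂ) := by
    rw [(even_two_mul i).neg_pow, mul_pow, pow_mul Complex.I, Complex.I_sq]
    push_cast
    ring
  have hsign : ((-1 : ℝ) ^ i) * (-1) ^ i = 1 := by rw [← mul_pow]; norm_num
  rw [hleft, hright, Complex.ofReal_re, ← Complex.ofReal_mul, mul_mul_mul_comm, hsign,
    one_mul, ← mul_pow]

lemma IsAdmissible.sum_coeff_mul_pow (hQ : IsAdmissible Q) (ε a : ℝ) :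
    ∑ j ∈ Finset.range (Q.natDegree + 1),
      ((Q.coeff j * ((Complex.I * (ε : ℂ)) ^ j).re : ℝ) : ℂ) * (-(a * Complex.I)) ^ j =
        (Q.eval (-(ε * a)) : ℝ) := by
  rw [hQ.even, eval_eq_sum_range, Complex.ofReal_sum]
  refine Finset.sum_congr rfl fun j _ => ?_
  rcases Nat.even_or_odd j with hj | hj
  · rw [Complex.ofReal_mul, mul_assoc, re_I_mul_pow_mul_pow_of_even hj, ← Complex.ofReal_mul]
  · simp only [hQ.coeff_odd hj, zero_mul, Complex.ofReal_zero]

lemma IsAdmissible.fourierMode_opL (hQ : IsAdmissible Q) (ε : ℝ) (hf : IsSmooth f) (k : ℤ)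
    (t : ℝ) : fourierMode (_root_.opL Q ε f) k t = -(symbolL Q ε k : ℂ) * fourierMode f k t := by
  have hfactor : (-(2 * Real.pi * Complex.I * k) : ℂ) =
      -(((2 * Real.pi * k : ℝ) : ℂ) * Complex.I) := by
    push_cast
    ring
  rw [opL_eq, symbolL]
  split_ifs with hε
  · rw [fourierMode_mixedDeriv_zero hf, hfactor, neg_sq, mul_pow, Complex.I_sq]
    push_cast
    ring
  · rw [fourierMode_const_mul, fourierMode_sum _ (f := fun j x => Q.coeff j *
      ((Complex.I * (ε : ℂ)) ^ j).re * mixedDeriv 0 j f x) fun j =>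
      continuous_const.mul (hf.mixedDeriv_zero j).continuous]
    simp_rw [fourierMode_const_mul, fourierMode_mixedDeriv_zero hf, ← mul_assoc]
    rw [← Finset.sum_mul, hfactor, hQ.sum_coeff_mul_pow, ← mul_assoc]
    push_cast
    ring_nf

end opL

/-! ### The Green's function equation -/

section Green

variable {Q : ℝ[X]}

lemma IsAdmissible.aestronglyMeasurable_greenP (hQ : IsAdmissible Q) {ε : ℝ} (hε : 0 ≤ ε) :
    AEStronglyMeasurable (greenP Q ε) := by
  have hopen : IsOpen {x : SpaceTime | 0 < x.1} := isOpen_lt continuous_const continuous_fst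
  have hindicator : greenP Q ε = Set.indicator {x : SpaceTime | 0 < x.1} (greenP Q ε) := by
    refine (Set.indicator_eq_self.2 fun x hx => ?_).symm
    by_contra hx_nonpos
    exact hx (if_neg hx_nonpos)
  have hcontinuous : ContinuousOn (greenP Q ε) {x : SpaceTime | 0 < x.1} := by
    intro x hx
    obtain ⟨z, rfl⟩ := isOpenQuotientMap_spaceProj.surjective x
    refine (isOpenQuotientMap_spaceProj.continuousAt_comp_iff.1 ?_).continuousWithinAt
    refine (hQ.isSmoothOffOrigin hε).continuousOn.continuousAt
      (isOpen_offOrigin.mem_nhds fun hz => ?_)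
    exact (show 0 < z.1 from hx).ne' (congrArg Prod.fst hz)
  rw [hindicator]
  exact (aestronglyMeasurable_indicator_iff hopen.measurableSet).2
    (hcontinuous.aestronglyMeasurable hopen.measurableSet)

lemma integrableOn_const_mul_one_add_rpow (C T : ℝ) :
    IntegrableOn (fun t : ℝ => C * (1 + t ^ (-(1 / 2) : ℝ))) (Set.Ioc 0 T) := by
  have hrpow : IntegrableOn (fun t : ℝ => t ^ (-(1 / 2) : ℝ)) (Set.Ioc 0 T) :=
    (intervalIntegral.intervalIntegrable_rpow' (by norm_num)).1
  exact ((integrableOn_const measure_Ioc_lt_top.ne).add hrpow).const_mul C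

lemma inv_parSize_le_rpow {x : SpaceTime} (hx : 0 < x.1) :
    (parSize x)⁻¹ ≤ x.1 ^ (-(1 / 2) : ℝ) := by
  rw [Real.rpow_neg hx.le, ← Real.sqrt_eq_rpow, parSize_of_pos hx]
  have := Real.sqrt_pos.2 hx
  gcongr
  exact le_add_of_nonneg_right (norm_nonneg x.2)

lemma IsAdmissible.integrableOn_greenP (hQ : IsAdmissible Q) {ε : ℝ} (hε : ε ∈ Set.Icc (0 : ℝ) 1)
    (T : ℝ) : IntegrableOn (greenP Q ε) (Set.Iic T ×ˢ (Set.univ : Set UnitAddCircle)) := by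
  obtain ⟨C, hC⟩ := hQ.greenP_bound
  have hdominant : Integrable fun x : SpaceTime => Set.indicator (Set.Ioc 0 T)
      (fun t : ℝ => |C| * (1 + t ^ (-(1 / 2) : ℝ))) x.1 :=
    ((integrableOn_const_mul_one_add_rpow |C| T).integrable_indicator
      measurableSet_Ioc).comp_fst (volume : Measure UnitAddCircle)
  refine Integrable.mono' hdominant.integrableOn
    (hQ.aestronglyMeasurable_greenP hε.1).restrict
    ((ae_restrict_iff' (measurableSet_Iic.prod MeasurableSet.univ)).2
      (Eventually.of_forall fun x hx => ?_))
  rcases le_or_gt x.1 0 with hx_nonpos | hx_pos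
  · rw [greenP, if_neg hx_nonpos.not_gt, norm_zero]
    refine Set.indicator_nonneg (fun t ht => ?_) _
    have := ht.1
    positivity
  · rw [Set.indicator_of_mem (show x.1 ∈ Set.Ioc 0 T from ⟨hx_pos, hx.1⟩), Real.norm_eq_abs]
    have hx_ne : x ≠ 0 := fun h => hx_pos.ne' (congrArg Prod.fst h)
    have := parSize_pos hx_ne
    refine (hC ε hε x hx_ne).trans ?_
    gcongr
    exacts [le_abs_self C, inv_parSize_le_rpow hx_pos]

lemma IsAdmissible.locallyIntegrable_greenP (hQ : IsAdmissible Q) {ε : ℝ}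
    (hε : ε ∈ Set.Icc (0 : ℝ) 1) : LocallyIntegrable (greenP Q ε) := fun x =>
  ⟨Set.Iic (x.1 + 1) ×ˢ Set.univ, prod_mem_nhds (Iic_mem_nhds (lt_add_one _)) univ_mem,
    hQ.integrableOn_greenP hε _⟩

lemma setIntegral_Ioc_exp_neg_mul_le {a : ℝ} (ha : 0 < a) (T : ℝ) :
    ∫ t in Set.Ioc 0 T, Real.exp (-(a * t)) ≤ 1 / a := by
  simp only [← neg_mul]
  calc ∫ t in Set.Ioc 0 T, Real.exp (-a * t) ≤ ∫ t in Set.Ioi 0, Real.exp (-a * t) :=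
        setIntegral_mono_set (integrableOn_exp_mul_Ioi (neg_neg_iff_pos.2 ha) 0)
          (Eventually.of_forall fun t => Real.exp_nonneg _)
          Set.Ioc_subset_Ioi_self.eventuallyLE
    _ = 1 / a := by
        rw [integral_exp_mul_Ioi (neg_neg_iff_pos.2 ha), mul_zero, Real.exp_zero, neg_div_neg_eq]

lemma IsAdmissible.summable_setIntegral_exp (hQ : IsAdmissible Q) {ε : ℝ} (hε : 0 ≤ ε) (T : ℝ) :
    Summable fun k : ℤ => ∫ t in Set.Ioc 0 T, Real.exp (-(symbolL Q ε k * t)) := by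
  obtain ⟨M, hM, hsymbol⟩ := hQ.exists_isSymbol
  refine Summable.of_norm_bounded_eventually
    ((Real.summable_one_div_int_pow.2 one_lt_two).mul_left M) ?_
  filter_upwards [(Set.finite_singleton (0 : ℤ)).compl_mem_cofinite] with k hk
  have hk_pos : (0 : ℝ) < (k : ℝ) ^ 2 / M :=
    div_pos (sq_pos_of_ne_zero (Int.cast_ne_zero.2 hk)) hM
  have hlower : (k : ℝ) ^ 2 / M ≤ symbolL Q ε k := by
    rw [hQ.symbolL_eq]
    exact (hsymbol ε hε).sq_div_le k
  rw [Real.norm_of_nonneg (integral_nonneg fun t => Real.exp_nonneg _)]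
  calc _ ≤ 1 / symbolL Q ε k := setIntegral_Ioc_exp_neg_mul_le (hk_pos.trans_le hlower) T
    _ ≤ 1 / ((k : ℝ) ^ 2 / M) := one_div_le_one_div_of_le hk_pos hlower
    _ = _ := by rw [one_div_div, mul_one_div]

/-- The `k`-th term of the series defining `greenP`. -/
def greenTerm (Q : ℝ[X]) (ε : ℝ) (k : ℤ) (x : SpaceTime) : ℂ :=
  (Real.exp (-(symbolL Q ε k * x.1)) : ℂ) * fourier k x.2

lemma continuous_greenTerm (Q : ℝ[X]) (ε : ℝ) (k : ℤ) : Continuous (greenTerm Q ε k) :=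
  (Complex.continuous_ofReal.comp (by fun_prop)).mul ((fourier k).continuous.comp continuous_snd)

lemma norm_greenTerm (Q : ℝ[X]) (ε : ℝ) (k : ℤ) (x : SpaceTime) :
    ‖greenTerm Q ε k x‖ = Real.exp (-(symbolL Q ε k * x.1)) := by
  rw [greenTerm, norm_mul, norm_fourier_apply, mul_one, Complex.norm_real, Real.norm_eq_abs,
    Real.abs_exp]

lemma IsAdmissible.hasSum_re_greenTerm (hQ : IsAdmissible Q) {ε : ℝ} (hε : 0 ≤ ε)
    {x : SpaceTime} (hx : 0 < x.1) :
    HasSum (fun k => (greenTerm Q ε k x).re) (greenP Q ε x) := by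
  obtain ⟨M, -, hsymbol⟩ := hQ.exists_isSymbol
  have hsummable := summable_mul_fourier ((hsymbol ε hε).summable 1 hx) x.2
  simp only [eval_one, one_mul, ← hQ.symbolL_eq] at hsummable
  rw [greenP, if_pos hx]
  exact Complex.hasSum_re hsummable.hasSum

lemma integrableOn_greenTerm_mul (Q : ℝ[X]) (ε : ℝ) (k : ℤ) {ψ : SpaceTime → ℝ}
    (hψ : Continuous ψ) (T : ℝ) :
    IntegrableOn (fun x => greenTerm Q ε k x * ψ x) (Set.Ioc 0 T ×ˢ Set.univ) :=
  (((continuous_greenTerm Q ε k).mul (Complex.continuous_ofReal.comp hψ)).continuousOn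
    |>.integrableOn_compact (isCompact_Icc.prod isCompact_univ)).mono_set
      (Set.prod_mono_left Set.Ioc_subset_Icc_self)

lemma setIntegral_greenTerm_mul (Q : ℝ[X]) (ε : ℝ) (k : ℤ) {ψ : SpaceTime → ℝ}
    (hψ : Continuous ψ) (T : ℝ) :
    ∫ x in Set.Ioc 0 T ×ˢ Set.univ, greenTerm Q ε k x * ψ x =
      ∫ t in Set.Ioc 0 T, (Real.exp (-(symbolL Q ε k * t)) : ℂ) * fourierMode ψ k t := by
  rw [Measure.volume_eq_prod, setIntegral_prod _ (integrableOn_greenTerm_mul Q ε k hψ T)]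
  simp only [greenTerm, fourierMode, ← integral_const_mul, Measure.restrict_univ, mul_assoc,
    mul_comm (fourier k _) (ψ _ : ℂ)]

lemma IsAdmissible.summable_setIntegral_norm_greenTerm_mul (hQ : IsAdmissible Q) {ε : ℝ}
    (hε : 0 ≤ ε) {ψ : SpaceTime → ℝ} (hψ : Continuous ψ) (T : ℝ) :
    Summable fun k => ∫ x in Set.Ioc 0 T ×ˢ Set.univ, ‖greenTerm Q ε k x * ψ x‖ := by
  obtain ⟨B, hB⟩ := exists_abs_le_of_continuous hψ 0 T
  refine Summable.of_nonneg_of_le (fun k => integral_nonneg fun x => norm_nonneg _) (fun k => ?_)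
    ((hQ.summable_setIntegral_exp hε T).mul_right B)
  have hexp : IntegrableOn (fun x : SpaceTime => Real.exp (-(symbolL Q ε k * x.1)) * B)
      (Set.Ioc 0 T ×ˢ Set.univ) :=
    (Continuous.continuousOn (by fun_prop) |>.integrableOn_compact
      (isCompact_Icc.prod isCompact_univ)).mono_set (Set.prod_mono_left Set.Ioc_subset_Icc_self)
  calc _ ≤ ∫ x in Set.Ioc 0 T ×ˢ (Set.univ : Set UnitAddCircle),
        Real.exp (-(symbolL Q ε k * x.1)) * B := by
        refine setIntegral_mono_on (integrableOn_greenTerm_mul Q ε k hψ T).norm hexp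
          (measurableSet_Ioc.prod MeasurableSet.univ) fun x hx => ?_
        rw [norm_mul, norm_greenTerm, Complex.norm_real]
        gcongr
        exact hB x (Set.Ioc_subset_Icc_self hx.1)
    _ = _ := by
        rw [Measure.volume_eq_prod, setIntegral_prod_mul
          (fun t => Real.exp (-(symbolL Q ε k * t))) fun _ : UnitAddCircle => B]
        simp [measureReal_def]

lemma IsAdmissible.hasSum_setIntegral_greenP_mul (hQ : IsAdmissible Q) {ε : ℝ} (hε : 0 ≤ ε)
    {ψ : SpaceTime → ℝ} (hψ : Continuous ψ) (T : ℝ) :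
    HasSum (fun k => (∫ t in Set.Ioc 0 T,
        (Real.exp (-(symbolL Q ε k * t)) : ℂ) * fourierMode ψ k t).re)
      (∫ x in Set.Ioc 0 T ×ˢ Set.univ, greenP Q ε x * ψ x) := by
  have hintegrable := fun k => integrableOn_greenTerm_mul Q ε k hψ T
  have hsum := hasSum_integral_of_summable_integral_norm (fun k => (hintegrable k).re)
    (Summable.of_nonneg_of_le (fun k => integral_nonneg fun x => norm_nonneg _)
      (fun k => integral_mono (hintegrable k).re.norm (hintegrable k).norm fun x =>
        Complex.abs_re_le_norm _)
      (hQ.summable_setIntegral_norm_greenTerm_mul hε hψ T))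
  have hterm : ∀ k, ∫ x in Set.Ioc 0 T ×ˢ Set.univ, RCLike.re (greenTerm Q ε k x * (ψ x : ℂ)) =
      (∫ t in Set.Ioc 0 T, (Real.exp (-(symbolL Q ε k * t)) : ℂ) * fourierMode ψ k t).re :=
    fun k => by rw [← setIntegral_greenTerm_mul Q ε k hψ T]; exact integral_re (hintegrable k)
  have hvalue : ∫ x in Set.Ioc 0 T ×ˢ Set.univ, greenP Q ε x * ψ x =
      ∫ x in Set.Ioc 0 T ×ˢ Set.univ, ∑' k, RCLike.re (greenTerm Q ε k x * (ψ x : ℂ)) := by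
    refine setIntegral_congr_fun (measurableSet_Ioc.prod MeasurableSet.univ) fun x hx => ?_
    simp only [RCLike.re_to_complex, Complex.re_mul_ofReal]
    exact ((hQ.hasSum_re_greenTerm hε hx.1.1).mul_right (ψ x)).tsum_eq.symm
  simpa only [hterm, hvalue] using hsum

/-- The function which the weak formulation of `(∂₀ - L_ε) G = δ₀` pairs with `G`. -/
def adjointOp (Q : ℝ[X]) (ε : ℝ) (φ : SpaceTime → ℝ) : SpaceTime → ℝ :=
  fun x => -timeDeriv φ x - opL Q ε φ x

lemma IsSmooth.adjointOp {φ : SpaceTime → ℝ} (hφ : IsSmooth φ) (Q : ℝ[X]) (ε : ℝ) :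
    IsSmooth (adjointOp Q ε φ) :=
  ContDiff.sub (ContDiff.neg hφ.timeDeriv) (hφ.opL Q ε)

lemma TimeSupported.adjointOp {T : ℝ} {φ : SpaceTime → ℝ} (hφ : TimeSupported T φ) (Q : ℝ[X])
    (ε : ℝ) : TimeSupported T (adjointOp Q ε φ) := fun x hx => by
  rw [_root_.adjointOp, hφ.timeDeriv x hx, hφ.opL Q ε x hx, neg_zero, sub_zero]

lemma IsAdmissible.hasDerivAt_exp_mul_fourierMode (hQ : IsAdmissible Q) (ε : ℝ)
    {φ : SpaceTime → ℝ} (hφ : IsSmooth φ) (k : ℤ) (t : ℝ) :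
    HasDerivAt (fun t => -((Real.exp (-(symbolL Q ε k * t)) : ℂ) * fourierMode φ k t))
      ((Real.exp (-(symbolL Q ε k * t)) : ℂ) * fourierMode (adjointOp Q ε φ) k t) t := by
  have hexp : HasDerivAt (fun s : ℝ => (Real.exp (-(symbolL Q ε k * s)) : ℂ))
      ((Real.exp (-(symbolL Q ε k * t)) * -(symbolL Q ε k * 1) : ℝ) : ℂ) t :=
    ((((hasDerivAt_id t).const_mul (symbolL Q ε k)).neg).exp).ofReal_comp
  have hmode : fourierMode (adjointOp Q ε φ) k t =
      -fourierMode (timeDeriv φ) k t + symbolL Q ε k * fourierMode φ k t := by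
    rw [← sub_neg_eq_add, ← neg_mul, ← hQ.fourierMode_opL ε hφ]
    exact fourierMode_neg_sub hφ.timeDeriv.continuous (hφ.opL Q ε).continuous k t
  refine ((hexp.mul (hasDerivAt_fourierMode hφ k t)).neg).congr_deriv ?_
  rw [hmode]
  push_cast
  ring

lemma IsAdmissible.setIntegral_exp_mul_fourierMode (hQ : IsAdmissible Q) (ε : ℝ)
    {φ : SpaceTime → ℝ} (hφ : IsSmooth φ) {T T' : ℝ} (hφT : TimeSupported T φ) (hT : 0 ≤ T)
    (hTT' : T < T') (k : ℤ) :
    ∫ t in Set.Ioc 0 T', (Real.exp (-(symbolL Q ε k * t)) : ℂ) *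
      fourierMode (adjointOp Q ε φ) k t = fourierMode φ k 0 := by
  have hT' : 0 < T' := hT.trans_lt hTT'
  have hmode_end : fourierMode φ k T' = 0 := by
    simp [fourierMode, fun y => hφT (T', y) (hTT'.trans_le (le_abs_self T'))]
  have hmode_cont : Continuous (fourierMode (adjointOp Q ε φ) k) :=
    continuous_iff_continuousAt.2 fun t =>
      (hasDerivAt_fourierMode (hφ.adjointOp Q ε) k t).continuousAt
  have hcont : Continuous fun t : ℝ =>
      (Real.exp (-(symbolL Q ε k * t)) : ℂ) * fourierMode (adjointOp Q ε φ) k t :=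
    (Complex.continuous_ofReal.comp (by fun_prop)).mul hmode_cont
  rw [← intervalIntegral.integral_of_le hT'.le, intervalIntegral.integral_eq_sub_of_hasDerivAt
    (fun t _ => hQ.hasDerivAt_exp_mul_fourierMode ε hφ k t) (hcont.intervalIntegrable _ _),
    hmode_end]
  simp

lemma IsAdmissible.integral_greenP_mul_adjointOp (hQ : IsAdmissible Q) {ε : ℝ} (hε : 0 ≤ ε)
    {φ : SpaceTime → ℝ} (hφ : IsSmooth φ) (hsupp : HasCompactSupport φ) :
    ∫ x, greenP Q ε x * adjointOp Q ε φ x = φ 0 := by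
  obtain ⟨T, hT, hφT⟩ := exists_timeSupported hsupp
  have hvanish : ∀ x ∉ Set.Ioc 0 (T + 1) ×ˢ (Set.univ : Set UnitAddCircle),
      greenP Q ε x * adjointOp Q ε φ x = 0 := fun x hx => by
    rcases le_or_gt x.1 0 with hx_nonpos | hx_pos
    · rw [greenP, if_neg hx_nonpos.not_gt, zero_mul]
    · have hlate : T + 1 < x.1 := not_le.1 fun h => hx ⟨⟨hx_pos, h⟩, Set.mem_univ _⟩
      rw [hφT.adjointOp Q ε x (by linarith [le_abs_self x.1]), mul_zero]
  have hsum := hQ.hasSum_setIntegral_greenP_mul hε (hφ.adjointOp Q ε).continuous (T + 1)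
  simp only [hQ.setIntegral_exp_mul_fourierMode ε hφ hφT hT.le (lt_add_one T),
    setIntegral_eq_integral_of_forall_compl_eq_zero hvanish] at hsum
  exact hsum.unique (Complex.hasSum_re (hasSum_fourierMode hφ 0))

lemma IsAdmissible.isGreenFunction (hQ : IsAdmissible Q) {ε : ℝ} (hε : ε ∈ Set.Icc (0 : ℝ) 1) :
    IsGreenFunction (opL Q ε) (greenP Q ε) where
  nonAnticipative := isNonAnticipative_greenP Q ε
  locallyIntegrable := hQ.locallyIntegrable_greenP hε
  weak_eq _ hφ hsupp := hQ.integral_greenP_mul_adjointOp hε.1 hφ hsupp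

end Green

end

theorem proposition2p1 (Q : Polynomial ℝ) (hQ : IsAdmissible Q) :
    -- `P_ε` is the Green's function, and it is smooth away from the origin
    (∀ ε ∈ Set.Icc (0 : ℝ) 1,
      IsGreenFunction (opL Q ε) (greenP Q ε) ∧ IsSmoothOffOrigin (greenP Q ε)) ∧
    -- the bounds for `P_ε`
    (∃ C : ℝ, ∀ ε ∈ Set.Icc (0 : ℝ) 1, ∀ x : SpaceTime, x ≠ 0 →
      |greenP Q ε x| ≤ C * (1 + (parSize x)⁻¹)) ∧
    (∀ l : ℕ, 1 ≤ l → DerivBound (greenP Q) 0 l 0) ∧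
    (∀ (l : ℕ) (c : ℝ), 0 < c → DerivBound (greenP Q) 1 l c) ∧
    (∀ δ ∈ Set.Ioo (0 : ℝ) 1, ComparisonBound (greenP Q) δ) ∧
    (∀ δ ∈ Set.Icc (0 : ℝ) 1, IncrementBound (greenP Q) δ) ∧
    -- the decomposition `P_ε = K_ε + R_ε`
    ∃ K R : ℝ → SpaceTime → ℝ,
      (∀ ε ∈ Set.Icc (0 : ℝ) 1,
        (∀ x : SpaceTime, greenP Q ε x = K ε x + R ε x) ∧
        IsNonAnticipative (K ε) ∧ IsNonAnticipative (R ε) ∧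
        IsSpaceSymmetric (K ε) ∧ IsSpaceSymmetric (R ε) ∧
        tsupport (K ε) ⊆ Set.Icc (0 : ℝ) 1 ×ˢ Set.univ ∧
        IsSmoothOffOrigin (K ε) ∧ IsSmooth (R ε)) ∧
      -- `R_ε` is smooth uniformly in `ε`
      (∀ m l : ℕ, ∃ C : ℝ, ∀ ε ∈ Set.Icc (0 : ℝ) 1, ∀ x : SpaceTime,
        |mixedDeriv m l (R ε) x| ≤ C) ∧
      -- the bounds for `K_ε`
      (∀ l : ℕ, DerivBound K 0 l 0) ∧
      (∀ (l : ℕ) (c : ℝ), 0 < c → DerivBound K 1 l c) ∧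
      (∀ δ ∈ Set.Ioo (0 : ℝ) 1, ComparisonBound K δ) ∧
      (∀ δ ∈ Set.Icc (0 : ℝ) 1, IncrementBound K δ) := by
  refine ⟨fun ε hε => ⟨hQ.isGreenFunction hε, hQ.isSmoothOffOrigin hε.1⟩, hQ.greenP_bound,
    fun l hl => hQ.derivBound_space (Nat.one_le_iff_ne_zero.1 hl),
    fun l c hc => hQ.derivBound_time l hc,
    fun δ hδ => hQ.comparisonBound (Set.Ioo_subset_Icc_self hδ), fun δ hδ => hQ.incrementBound hδ,
    singularPart Q, smoothPart Q, fun ε hε => ⟨fun x => ?_, fun x hx => ?_, fun x hx => ?_,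
      fun t y => ?_, fun t y => ?_, tsupport_singularPart_subset Q ε,
      hQ.isSmoothOffOrigin_singularPart hε.1, hQ.isSmooth_smoothPart hε.1⟩,
    hQ.exists_abs_mixedDeriv_smoothPart_le, hQ.derivBound_space_singularPart,
    fun l c hc => hQ.derivBound_time_singularPart l hc,
    fun δ hδ => hQ.comparisonBound_singularPart (Set.Ioo_subset_Icc_self hδ),
    fun δ hδ => hQ.incrementBound_singularPart hδ⟩
  · rw [singularPart, smoothPart]; ring
  · rw [singularPart, isNonAnticipative_greenP Q ε x hx, mul_zero]
  · rw [smoothPart, isNonAnticipative_greenP Q ε x hx, mul_zero]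
  · simp only [singularPart, isSpaceSymmetric_greenP Q ε t y]
  · simp only [smoothPart, isSpaceSymmetric_greenP Q ε t y]
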